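/- Let $N\ge 1$, $s_1,s_2\in(0,1)$, $1<p_1,p_2<\infty$, $N>\max\{s_1p_1,s_2p_2\}$, $\alpha,\beta>-1$, and let $\Omega\subset\mathbb R^N$ be a bounded domain with boundary of class $C^1$ (in particular, any smooth bounded domain). Write $p_i^*=\frac{Np_i}{N-s_ip_i}$ and $p_i'=\frac{p_i}{p_i-1}$. For $s\in(0,1)$ and $p>1$ let $$[u]_{s,p}=\Big(\iint_{\mathbb R^{2N}}\frac{|u(x)-u(y)|^{p}}{|x-y|^{N+sp}}\,dx\,dy\Big)^{1/p},$$ and let $X_{0,s,p}(\Omega)$ be the space of (classes of) measurable $u:\mathbb R^N\to\mathbb R$ with $u|_\Omega\in L^p(\Omega)$, $[u]_{s,p}<\infty$ and $u=0$ a.e. in $\mathbb R^N\setminus\Omega$, normed by $[\cdot]_{s,p}$. Let $X=X_{0,s_1,p_1}(\Omega)\times X_{0,s_2,p_2}(\Omega)$ and let $f_i\in X_{0,s_i,p_i}(\Omega)^*$ $(i=1,2)$, with dual norm $\|f_i\|$. Consider the system $$(\mathcal P_{f_1,f_2})\quad\begin{cases}(-\Delta)^{s_1}_{p_1}u=u|u|^{\alpha-1}|v|^{\beta+1}+f_1&\text{in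 }\Omega,\\(-\Delta)^{s_2}_{p_2}v=|u|^{\alpha+1}v|v|^{\beta-1}+f_2&\text{in }\Omega,\\u=v=0&\text{in }\mathbb R^N\setminus\Omega,\end{cases}$$ with energy functional on $X$ $$\mathcal I(u,v)=\tfrac{\alpha+1}{p_1}[u]_{s_1,p_1}^{p_1}+\tfrac{\beta+1}{p_2}[v]_{s_2,p_2}^{p_2}-\int_\Omega|u|^{\alpha+1}|v|^{\beta+1}dx-(\alpha+1)\langle f_1,u\rangle-(\beta+1)\langle f_2,v\rangle,$$ and let $\Theta=\{(u,v)\in X\setminus\{0\}:\langle\mathcal I'(u,v),(u,v)\rangle=0\}$, where $\langle\mathcal I'(u,v),(u,v)\rangle$ is the derivative of $\mathcal I$ at $(u,v)$ in the direction $(u,v)$. A weak solution of $(\mathcal P_{f_1,f_2})$ is a pair $(u,v)\in X$ such that for all $\varphi\in X_{0,s_1,p_1}(\Omega)$ and $\psi\in X_{0,s_2,p_2}(\Omega)$ the functions $u|u|^{\alpha-1}|v|^{\beta+1}\varphi$ and $|u|^{\alpha+1}v|v|^{\beta-1}\psi$ are integrable on $\Omega$ (with $u|u|^{\alpha-1}:=0$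 where $u=0$ and $v|v|^{\beta-1}:=0$ where $v=0$) and $$\iint_{\mathbb R^{2N}}\frac{|u(x)-u(y)|^{p_1-2}(u(x)-u(y))(\varphi(x)-\varphi(y))}{|x-y|^{N+s_1p_1}}\,dx\,dy=\int_\Omega u|u|^{\alpha-1}|v|^{\beta+1}\varphi\,dx+\langle f_1,\varphi\rangle,$$ $$\iint_{\mathbb R^{2N}}\frac{|v(x)-v(y)|^{p_2-2}(v(x)-v(y))(\psi(x)-\psi(y))}{|x-y|^{N+s_2p_2}}\,dx\,dy=\int_\Omega |u|^{\alpha+1}v|v|^{\beta-1}\psi\,dx+\langle f_2,\psi\rangle.$$ Let $S_{p_i}$ be the infimum of $[u]_{s_i,p_i}^{p_i}\big/\big(\int_{\mathbb R^N}|u|^{p_i^*}dx\big)^{p_i/p_i^*}$ over all nonzero $u\in L^{p_i^*}(\mathbb R^N)$ with $[u]_{s_i,p_i}<\infty$, and put $$b(r,t)=\tfrac{(r+1)(t-1)}{(\alpha+\beta+2)(\alpha+\beta+1)},\qquad c(t)=\tfrac{\alpha+\beta+2-t}{\alpha+\beta+1},\qquad d(r,t)=\Big(\tfrac{\alpha+1}{p_1'r^{p_1'}}+\tfrac{\beta+1}{p_2't^{p_2'}}\Big)^{-1}.$$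 Fix $0<\nu<[p_1c(p_1)]^{1/p_1}$ and $0<\mu<[p_2c(p_2)]^{1/p_2}$, and with $\sigma=\min\{S_{p_1}^{p_1^*/p_1},S_{p_2}^{p_2^*/p_2}\}$ let $$\varepsilon_1=(\alpha+1)\,d(\nu,\mu)\Big(c(p_1)-\tfrac{\nu^{p_1}}{p_1}\Big)\big(b(\alpha,p_1)\,\sigma\big)^{\frac{p_1}{p_1^*-p_1}},\qquad \varepsilon_2=(\beta+1)\,d(\nu,\mu)\Big(c(p_2)-\tfrac{\mu^{p_2}}{p_2}\Big)\big(b(\beta,p_2)\,\sigma\big)^{\frac{p_2}{p_2^*-p_2}}.$$ **Theorem.** Assume - $(H_1)$ $\ \frac{\alpha+1}{p_1^*}+\frac{\beta+1}{p_2^*}=1$; - $(H_2)$ $\ \max\{p_1,p_2\}<\alpha+\beta+2$; - $(H_3)$ $\ 0<\|f_1\|+\|f_2\|<\min\{\varepsilon_1,\varepsilon_2,1\}$. Then there is a weak solution $(u^*,v^*)\in\Theta$ of $(\mathcal P_{f_1,f_2})$, and it satisfies $\mathcal I(u^*,v^*)=\min_\Theta\mathcal I<0$; that is, the infimum of $\mathcal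 I$ over $\Theta$ is attained at $(u^*,v^*)$ and is negative. -/

import Mathlib

open MeasureTheory

noncomputable section

namespace FracSystem

/-- The Euclidean space `ℝ^N`. -/
abbrev Eu (N : ℕ) : Type := EuclideanSpace ℝ (Fin N)

/-- A bounded domain (nonempty, open, connected, bounded) with boundary of class `C¹`: near each
boundary point it is the strict sublevel set of a `C¹` function with nonvanishing derivative there.
Every smooth bounded domain is one. -/
structure IsC1BoundedDomain {N : ℕ} (Ω : Set (Eu N)) : Prop where
  isOpen : IsOpen Ω
  isConnected : IsConnected Ω
  isBounded : Bornology.IsBounded Ω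
  boundary : ∀ x ∈ frontier Ω, ∃ U : Set (Eu N), IsOpen U ∧ x ∈ U ∧
    ∃ ρ : Eu N → ℝ, ContDiff ℝ 1 ρ ∧ fderiv ℝ ρ x ≠ 0 ∧ Ω ∩ U = {y ∈ U | ρ y < 0}

/-- The critical exponent `p_s^* = N p / (N - s p)`. -/
def critExp (N : ℕ) (s p : ℝ) : ℝ := N * p / (N - s * p)

/-- The integrand `|u(x) - u(y)|^p / |x - y|^(N + s p)` on `ℝ^N × ℝ^N`. -/
def gagliardoIntegrand {N : ℕ} (s p : ℝ) (u : Eu N → ℝ) (z : Eu N × Eu N) : ℝ :=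
  |u z.1 - u z.2| ^ p / ‖z.1 - z.2‖ ^ ((N : ℝ) + s * p)

/-- `∬ |u(x) - u(y)|^p / |x - y|^(N + s p) dx dy` over `ℝ^N × ℝ^N`. -/
def gagliardo {N : ℕ} (s p : ℝ) (u : Eu N → ℝ) : ℝ :=
  ∫ z : Eu N × Eu N, gagliardoIntegrand s p u z

/-- The difference quotient whose `L^p` norm is the Gagliardo seminorm (auxiliary). -/
def quot {N : ℕ} (s p : ℝ) (u : Eu N → ℝ) (z : Eu N × Eu N) : ℝ :=
  (u z.1 - u z.2) / ‖z.1 - z.2‖ ^ (((N : ℝ) + s * p) / p)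

theorem norm_quot_rpow {N : ℕ} {s p : ℝ} (hp : 1 < p) (u : Eu N → ℝ) (z : Eu N × Eu N) :
    ‖quot s p u z‖ ^ p = gagliardoIntegrand s p u z := by
  have h0 : 0 < p := by linarith
  have h1 : 0 ≤ ‖z.1 - z.2‖ ^ (((N : ℝ) + s * p) / p) := Real.rpow_nonneg (norm_nonneg _) _
  rw [quot, gagliardoIntegrand, Real.norm_eq_abs, abs_div, abs_of_nonneg h1,
    Real.div_rpow (abs_nonneg _) h1, ← Real.rpow_mul (norm_nonneg _), div_mul_cancel₀ _ h0.ne']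

theorem aesm_quot {N : ℕ} (s p : ℝ) (u : Eu N →ₘ[volume] ℝ) :
    AEStronglyMeasurable (quot s p u) (volume : Measure (Eu N × Eu N)) := by
  have hu : Measurable (u : Eu N → ℝ) := u.stronglyMeasurable.measurable
  have : Measurable (quot s p u) := by
    unfold quot
    exact ((hu.comp measurable_fst).sub (hu.comp measurable_snd)).div
      ((measurable_fst.sub measurable_snd).norm.pow_const _)
  exact this.aestronglyMeasurable

theorem memLp_quot_iff {N : ℕ} {s p : ℝ} (hp : 1 < p) (u : Eu N →ₘ[volume] ℝ) :
    MemLp (quot s p u) (ENNReal.ofReal p) (volume : Measure (Eu N × Eu N)) ↔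
      Integrable (gagliardoIntegrand s p u) (volume : Measure (Eu N × Eu N)) := by
  have h0 : 0 < p := by linarith
  have h := integrable_norm_rpow_iff (aesm_quot s p u) (p := ENNReal.ofReal p)
    (by simpa using h0) ENNReal.ofReal_ne_top
  rw [← h, ENNReal.toReal_ofReal h0.le]
  simp_rw [norm_quot_rpow hp]

theorem gagliardo_eq {N : ℕ} {s p : ℝ} (hp : 1 < p) (u : Eu N →ₘ[volume] ℝ)
    (hu : Integrable (gagliardoIntegrand s p u) (volume : Measure (Eu N × Eu N))) :
    gagliardo s p u ^ (1 / p) =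
      (eLpNorm (quot s p u) (ENNReal.ofReal p) (volume : Measure (Eu N × Eu N))).toReal := by
  have h0 : 0 < p := by linarith
  rw [((memLp_quot_iff hp u).2 hu).eLpNorm_eq_integral_rpow_norm (by simpa using h0)
    ENNReal.ofReal_ne_top, ENNReal.toReal_ofReal h0.le]
  simp_rw [norm_quot_rpow hp]
  rw [ENNReal.toReal_ofReal, one_div]
  · rfl
  · refine Real.rpow_nonneg (integral_nonneg fun z => ?_) _
    exact div_nonneg (Real.rpow_nonneg (abs_nonneg _) _) (Real.rpow_nonneg (norm_nonneg _) _)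

theorem ae_prod {N : ℕ} {P : Eu N → Prop} (h : ∀ᵐ x, P x) :
    ∀ᵐ z : Eu N × Eu N, P z.1 ∧ P z.2 :=
  (Measure.quasiMeasurePreserving_fst.ae h).and (Measure.quasiMeasurePreserving_snd.ae h)

theorem quot_add {N : ℕ} (s p : ℝ) (u v : Eu N →ₘ[volume] ℝ) :
    quot s p (u + v : Eu N →ₘ[volume] ℝ) =ᵐ[volume] quot s p u + quot s p v := by
  filter_upwards [ae_prod (AEEqFun.coeFn_add u v)] with z hz
  simp only [quot, Pi.add_apply, hz.1, hz.2]
  ring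

theorem quot_smul {N : ℕ} (s p : ℝ) (c : ℝ) (u : Eu N →ₘ[volume] ℝ) :
    quot s p (c • u : Eu N →ₘ[volume] ℝ) =ᵐ[volume] c • quot s p u := by
  filter_upwards [ae_prod (AEEqFun.coeFn_smul c u)] with z hz
  simp only [quot, Pi.smul_apply, hz.1, hz.2, smul_eq_mul]
  ring

theorem quot_zero {N : ℕ} (s p : ℝ) :
    quot s p (0 : Eu N →ₘ[volume] ℝ) =ᵐ[volume] 0 := by
  simpa using quot_smul s p 0 (0 : Eu N →ₘ[volume] ℝ)

/-- The space `X_{0,s,p}(Ω)`, as a linear space of a.e.-classes of measurable functions on `ℝ^N`: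
`u|_Ω ∈ L^p(Ω)`, `u = 0` a.e. outside `Ω`, and finite Gagliardo integral. As `u` vanishes outside
`Ω`, the Gagliardo integral over `ℝ^{2N}` equals that over `ℝ^{2N} \ (Ω^c × Ω^c)`. -/
def X0Submodule {N : ℕ} (Ω : Set (Eu N)) (s p : ℝ) [hp : Fact (1 < p)] :
    Submodule ℝ (Eu N →ₘ[volume] ℝ) where
  carrier := {u | MemLp u (ENNReal.ofReal p) (volume.restrict Ω) ∧
    (∀ᵐ x, x ∉ Ω → u x = 0) ∧
    Integrable (gagliardoIntegrand s p u) (volume : Measure (Eu N × Eu N))}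
  zero_mem' := by
    refine ⟨?_, ?_, ?_⟩
    · exact (memLp_congr_ae (ae_restrict_of_ae AEEqFun.coeFn_zero)).2 MemLp.zero
    · filter_upwards [AEEqFun.coeFn_zero (α := Eu N) (β := ℝ) (μ := volume)] with x hx _
      simpa using hx
    · rw [← memLp_quot_iff hp.out, memLp_congr_ae (quot_zero s p)]
      exact MemLp.zero
  add_mem' := by
    rintro u v ⟨hu1, hu2, hu3⟩ ⟨hv1, hv2, hv3⟩
    refine ⟨?_, ?_, ?_⟩
    · exact (memLp_congr_ae (ae_restrict_of_ae (AEEqFun.coeFn_add u v))).2 (hu1.add hv1)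
    · filter_upwards [AEEqFun.coeFn_add u v, hu2, hv2] with x hx h1 h2 hn
      simp [hx, h1 hn, h2 hn]
    · rw [← memLp_quot_iff hp.out] at hu3 hv3 ⊢
      rw [memLp_congr_ae (quot_add s p u v)]
      exact hu3.add hv3
  smul_mem' := by
    rintro c u ⟨hu1, hu2, hu3⟩
    refine ⟨?_, ?_, ?_⟩
    · exact (memLp_congr_ae (ae_restrict_of_ae (AEEqFun.coeFn_smul c u))).2 (hu1.const_smul c)
    · filter_upwards [AEEqFun.coeFn_smul c u, hu2] with x hx h1 hn
      simp [hx, h1 hn]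
    · rw [← memLp_quot_iff hp.out] at hu3 ⊢
      rw [memLp_congr_ae (quot_smul s p c u)]
      exact hu3.const_smul c

/-- `X_{0,s,p}(Ω)` as a type; its norm is given below. -/
def X0 {N : ℕ} (Ω : Set (Eu N)) (s p : ℝ) [Fact (1 < p)] : Type := X0Submodule Ω s p

section

variable {N : ℕ} {Ω : Set (Eu N)} {s p : ℝ} [hp : Fact (1 < p)]

instance : AddCommGroup (X0 Ω s p) := inferInstanceAs (AddCommGroup (X0Submodule Ω s p))

instance : Module ℝ (X0 Ω s p) := inferInstanceAs (Module ℝ (X0Submodule Ω s p))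

/-- The underlying function on `ℝ^N` (a measurable representative). -/
def X0.toFun (u : X0 Ω s p) : Eu N → ℝ := (u.1 : Eu N →ₘ[volume] ℝ)

instance : CoeFun (X0 Ω s p) (fun _ => Eu N → ℝ) := ⟨X0.toFun⟩

/-- The norm `[u]_{s,p} = (∬ |u(x) - u(y)|^p / |x - y|^(N + s p) dx dy)^(1/p)`. -/
instance : Norm (X0 Ω s p) := ⟨fun u => gagliardo s p u ^ (1 / p)⟩

theorem X0.norm_def (u : X0 Ω s p) : ‖u‖ = gagliardo s p u ^ (1 / p) := rfl

theorem X0.norm_eq (u : X0 Ω s p) : ‖u‖ =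
    (eLpNorm (quot s p u) (ENNReal.ofReal p) (volume : Measure (Eu N × Eu N))).toReal :=
  gagliardo_eq hp.out u.1 u.2.2.2

theorem X0.memLp (u : X0 Ω s p) :
    MemLp (quot s p u) (ENNReal.ofReal p) (volume : Measure (Eu N × Eu N)) :=
  (memLp_quot_iff hp.out u.1).2 u.2.2.2

theorem X0.norm_add_le' (u v : X0 Ω s p) : ‖u + v‖ ≤ ‖u‖ + ‖v‖ := by
  rw [X0.norm_eq, X0.norm_eq, X0.norm_eq,
    ← ENNReal.toReal_add u.memLp.eLpNorm_ne_top v.memLp.eLpNorm_ne_top]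
  refine ENNReal.toReal_mono
    (ENNReal.add_ne_top.2 ⟨u.memLp.eLpNorm_ne_top, v.memLp.eLpNorm_ne_top⟩) ?_
  rw [show eLpNorm (quot s p (u + v : X0 Ω s p)) (ENNReal.ofReal p) volume =
    eLpNorm (quot s p u + quot s p v) (ENNReal.ofReal p) volume from
    eLpNorm_congr_ae (quot_add s p u.1 v.1)]
  exact eLpNorm_add_le u.memLp.1 v.memLp.1 (by simpa using hp.out.le)

theorem X0.norm_smul' (c : ℝ) (u : X0 Ω s p) : ‖c • u‖ = |c| * ‖u‖ := by
  rw [X0.norm_eq, X0.norm_eq,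
    show eLpNorm (quot s p (c • u : X0 Ω s p)) (ENNReal.ofReal p) volume =
    eLpNorm (c • quot s p u) (ENNReal.ofReal p) volume from
    eLpNorm_congr_ae (quot_smul s p c u.1), eLpNorm_const_smul, ENNReal.toReal_mul]
  simp

/-- The structure is registered as a seminormed group so that no condition on `Ω` is needed; for
bounded `Ω` the seminorm is a norm, since `u` vanishes outside `Ω`. -/
instance : SeminormedAddCommGroup (X0 Ω s p) :=
  SeminormedAddCommGroup.ofCore (𝕜 := ℝ)
    { norm_nonneg := fun u => by rw [X0.norm_eq]; exact ENNReal.toReal_nonneg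
      norm_smul := fun c u => X0.norm_smul' c u
      norm_triangle := fun u v => X0.norm_add_le' u v }

instance : NormedSpace ℝ (X0 Ω s p) where
  norm_smul_le c u := (X0.norm_smul' c u).le

end

/-- The best Sobolev constant: the infimum of
`∬ |u(x)-u(y)|^p / |x-y|^(N+sp) dx dy / (∫ |u|^{p^*})^(p/p^*)` over the nonzero
`u ∈ L^{p^*}(ℝ^N)` with finite Gagliardo integral. -/
def sobolevConst (N : ℕ) (s p : ℝ) : ℝ :=
  sInf {q : ℝ | ∃ u : Eu N →ₘ[volume] ℝ, u ≠ 0 ∧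
    MemLp u (ENNReal.ofReal (critExp N s p)) volume ∧
    Integrable (gagliardoIntegrand s p u) (volume : Measure (Eu N × Eu N)) ∧
    q = gagliardo s p u / (∫ x, |u x| ^ critExp N s p) ^ (p / critExp N s p)}

/-- `b(r,t) = (r+1)(t-1) / ((α+β+2)(α+β+1))`. -/
def bConst (α β r t : ℝ) : ℝ := (r + 1) * (t - 1) / ((α + β + 2) * (α + β + 1))

/-- `c(t) = (α+β+2-t) / (α+β+1)`. -/
def cConst (α β t : ℝ) : ℝ := (α + β + 2 - t) / (α + β + 1)

/-- The conjugate exponent `p' = p / (p-1)`. -/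
def conjExp (p : ℝ) : ℝ := p / (p - 1)

/-- `d(r,t) = 1 / ((α+1)/(p₁' r^{p₁'}) + (β+1)/(p₂' t^{p₂'}))`. -/
def dConst (p₁ p₂ α β r t : ℝ) : ℝ :=
  1 / ((α + 1) / (conjExp p₁ * r ^ conjExp p₁) + (β + 1) / (conjExp p₂ * t ^ conjExp p₂))

/-- `min (S_{p₁}^{p₁^*/p₁}, S_{p₂}^{p₂^*/p₂})`. -/
def minSob (N : ℕ) (s₁ s₂ p₁ p₂ : ℝ) : ℝ :=
  min (sobolevConst N s₁ p₁ ^ (critExp N s₁ p₁ / p₁))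
    (sobolevConst N s₂ p₂ ^ (critExp N s₂ p₂ / p₂))

/-- The threshold `ε₁`. -/
def eps₁ (N : ℕ) (s₁ s₂ p₁ p₂ α β ν μ : ℝ) : ℝ :=
  (α + 1) * dConst p₁ p₂ α β ν μ * (cConst α β p₁ - ν ^ p₁ / p₁) *
    (bConst α β α p₁ * minSob N s₁ s₂ p₁ p₂) ^ (p₁ / (critExp N s₁ p₁ - p₁))

/-- The threshold `ε₂`. -/
def eps₂ (N : ℕ) (s₁ s₂ p₁ p₂ α β ν μ : ℝ) : ℝ :=
  (β + 1) * dConst p₁ p₂ α β ν μ * (cConst α β p₂ - μ ^ p₂ / p₂) *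
    (bConst α β β p₂ * minSob N s₁ s₂ p₁ p₂) ^ (p₂ / (critExp N s₂ p₂ - p₂))

section

variable {N : ℕ} {Ω : Set (Eu N)} {s₁ s₂ p₁ p₂ : ℝ} [Fact (1 < p₁)] [Fact (1 < p₂)]

/-- The energy functional
`I(u,v) = (α+1)/p₁ [u]^{p₁} + (β+1)/p₂ [v]^{p₂} - ∫_Ω |u|^{α+1}|v|^{β+1}
  - (α+1)⟨f₁,u⟩ - (β+1)⟨f₂,v⟩` on `X = X_{0,s₁,p₁}(Ω) × X_{0,s₂,p₂}(Ω)`. -/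
def energy (α β : ℝ) (f₁ : StrongDual ℝ (X0 Ω s₁ p₁)) (f₂ : StrongDual ℝ (X0 Ω s₂ p₂))
    (w : X0 Ω s₁ p₁ × X0 Ω s₂ p₂) : ℝ :=
  (α + 1) / p₁ * ‖w.1‖ ^ p₁ + (β + 1) / p₂ * ‖w.2‖ ^ p₂
    - (∫ x in Ω, |w.1 x| ^ (α + 1) * |w.2 x| ^ (β + 1))
    - (α + 1) * f₁ w.1 - (β + 1) * f₂ w.2

/-- The Nehari-type set `Θ = {w ∈ X \ {0} : ⟨I'(w), w⟩ = 0}`. The pairing `⟨I'(w), w⟩` is the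
derivative of `I` at `w` in the direction `w`, which exists at every `w` for all `α, β > -1`. -/
def nehari (α β : ℝ) (f₁ : StrongDual ℝ (X0 Ω s₁ p₁)) (f₂ : StrongDual ℝ (X0 Ω s₂ p₂)) :
    Set (X0 Ω s₁ p₁ × X0 Ω s₂ p₂) :=
  {w | w ≠ 0 ∧ HasLineDerivAt ℝ (energy α β f₁ f₂) 0 w w}

/-- The weak form of `(-Δ)^s_p u` tested with `φ`:
`∬ |u(x)-u(y)|^{p-2} (u(x)-u(y)) (φ(x)-φ(y)) / |x-y|^{N+sp} dx dy`. -/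
def fracPLaplace {s p : ℝ} [Fact (1 < p)] (u φ : X0 Ω s p) : ℝ :=
  ∫ z : Eu N × Eu N, |u z.1 - u z.2| ^ (p - 2) * (u z.1 - u z.2) * (φ z.1 - φ z.2) /
    ‖z.1 - z.2‖ ^ ((N : ℝ) + s * p)

/-- `(u,v) ∈ X` is a weak solution of
`(-Δ)^{s₁}_{p₁} u = u|u|^{α-1}|v|^{β+1} + f₁`, `(-Δ)^{s₂}_{p₂} v = |u|^{α+1} v|v|^{β-1} + f₂` in `Ω`,
`u = v = 0` outside `Ω`. That the coupling terms can be tested is part of the definition. -/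
def IsWeakSolution (α β : ℝ) (f₁ : StrongDual ℝ (X0 Ω s₁ p₁)) (f₂ : StrongDual ℝ (X0 Ω s₂ p₂))
    (w : X0 Ω s₁ p₁ × X0 Ω s₂ p₂) : Prop :=
  (∀ φ : X0 Ω s₁ p₁,
    IntegrableOn (fun x => w.1 x * |w.1 x| ^ (α - 1) * |w.2 x| ^ (β + 1) * φ x) Ω ∧
    fracPLaplace w.1 φ =
      (∫ x in Ω, w.1 x * |w.1 x| ^ (α - 1) * |w.2 x| ^ (β + 1) * φ x) + f₁ φ) ∧
  (∀ φ : X0 Ω s₂ p₂,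
    IntegrableOn (fun x => |w.1 x| ^ (α + 1) * (w.2 x * |w.2 x| ^ (β - 1)) * φ x) Ω ∧
    fracPLaplace w.2 φ =
      (∫ x in Ω, |w.1 x| ^ (α + 1) * (w.2 x * |w.2 x| ^ (β - 1)) * φ x) + f₂ φ)

end

end FracSystem

end

namespace FracSystem

open Filter Topology Set

/-- On a compact set, if `q < 0` wherever the nonnegative function `r` vanishes, then `q` is
dominated by a multiple of `r`. -/
theorem exists_le_mul_of_isCompact {X : Type*} [TopologicalSpace X] {K : Set X} (hK : IsCompact K)
    {q r : X → ℝ} (hq : Continuous q) (hr : Continuous r) (hr0 : ∀ x ∈ K, 0 ≤ r x)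
    (hqr : ∀ x ∈ K, r x = 0 → q x < 0) : ∃ C : ℝ, 0 ≤ C ∧ ∀ x ∈ K, q x ≤ C * r x := by
  have hK' : IsCompact (K ∩ {x | 0 ≤ q x}) := hK.inter_right (isClosed_le continuous_const hq)
  rcases (K ∩ {x | 0 ≤ q x}).eq_empty_or_nonempty with he | hne
  · refine ⟨0, le_rfl, fun x hx => ?_⟩
    by_contra hcon
    have : x ∈ K ∩ {x | 0 ≤ q x} := ⟨hx, by simp only [mem_ofPred_eq]; linarith⟩
    rw [he] at this
    exact this
  · obtain ⟨x0, hx0, hmin⟩ := hK'.exists_isMinOn hne hr.continuousOn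
    obtain ⟨x1, hx1, hmax⟩ := hK'.exists_isMaxOn hne hq.continuousOn
    have hr0' : 0 < r x0 := by
      rcases (hr0 x0 hx0.1).lt_or_eq with h | h
      · exact h
      · exact absurd (hqr x0 hx0.1 h.symm) (not_lt.2 hx0.2)
    have hC : 0 ≤ q x1 / r x0 := div_nonneg hx1.2 hr0'.le
    refine ⟨q x1 / r x0, hC, fun x hx => ?_⟩
    rcases lt_or_ge (q x) 0 with h | h
    · exact h.le.trans (mul_nonneg hC (hr0 x hx))
    · have h1 : q x ≤ q x1 := hmax ⟨hx, h⟩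
      have h2 : r x0 ≤ r x := hmin ⟨hx, h⟩
      calc q x ≤ q x1 / r x0 * r x0 := by rwa [div_mul_cancel₀ _ hr0'.ne']
        _ ≤ _ := by gcongr

/-- The inequality behind the Brezis–Lieb lemma, for functions homogeneous under a family of
dilations. -/
theorem exists_abs_sub_le_of_homogeneous {E : Type*} [NormedAddCommGroup E] [ProperSpace E]
    {δ : ℝ → E → E} (hadd : ∀ l a b, δ l (a + b) = δ l a + δ l b) {j Φ : E → ℝ}
    (hj : Continuous j) (hΦ : Continuous Φ) (hjδ : ∀ l, 0 < l → ∀ a, j (δ l a) = l * j a)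
    (hΦδ : ∀ l, 0 < l → ∀ a, Φ (δ l a) = l * Φ a) (hΦ0 : ∀ a, 0 ≤ Φ a)
    (hΦz : ∀ a, Φ a = 0 → a = 0) (hbd : Bornology.IsBounded {a | Φ a ≤ 1})
    {ε : ℝ} (hε : 0 < ε) :
    ∃ C : ℝ, 0 ≤ C ∧ ∀ a b, |j (a + b) - j a| ≤ ε * Φ a + C * Φ b := by
  have hS : IsCompact {z : E × E | Φ z.1 + Φ z.2 = 1} := by
    refine Metric.isCompact_of_isClosed_isBounded
      (isClosed_eq (by fun_prop) continuous_const) ((hbd.prod hbd).subset ?_)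
    rintro ⟨a, b⟩ h
    have h' : Φ a + Φ b = 1 := h
    exact ⟨by have := hΦ0 b; simp only [mem_ofPred_eq]; linarith,
      by have := hΦ0 a; simp only [mem_ofPred_eq]; linarith⟩
  obtain ⟨C, hC0, hC⟩ := exists_le_mul_of_isCompact hS
    (q := fun z => |j (z.1 + z.2) - j z.1| - ε * Φ z.1) (r := fun z => Φ z.2)
    (by fun_prop) (by fun_prop) (fun z _ => hΦ0 _) (by
      rintro ⟨a, b⟩ h h0
      have hb := hΦz b h0
      have h' : Φ a + Φ b = 1 := h
      have h0' : Φ b = 0 := h0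
      subst hb
      simp only [add_zero, sub_self, abs_zero]
      nlinarith)
  refine ⟨C, hC0, fun a b => ?_⟩
  rcases (add_nonneg (hΦ0 a) (hΦ0 b)).eq_or_lt with h | h
  · have h1 := hΦ0 a
    have h2 := hΦ0 b
    have h3 := hΦz b (by linarith)
    subst h3
    simp only [add_zero, sub_self, abs_zero]
    positivity
  · set l := (Φ a + Φ b)⁻¹ with hl
    have hl0 : 0 < l := inv_pos.2 h
    have := hC (δ l a, δ l b) (by
      simp only [mem_ofPred_eq, hΦδ l hl0, ← mul_add]
      exact inv_mul_cancel₀ h.ne')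
    simp only [← hadd, hjδ l hl0, hΦδ l hl0, ← mul_sub, abs_mul, abs_of_pos hl0] at this
    have h5 : l * |j (a + b) - j a| ≤ l * (ε * Φ a + C * Φ b) := by linarith
    exact le_of_mul_le_mul_left h5 hl0

theorem exists_abs_rpow_sub_le {p ε : ℝ} (hp : 0 < p) (hε : 0 < ε) :
    ∃ C : ℝ, 0 ≤ C ∧ ∀ a b : ℝ, |(|a + b| ^ p - |a| ^ p)| ≤ ε * |a| ^ p + C * |b| ^ p := by
  have hc : Continuous fun a : ℝ => |a| ^ p := continuous_abs.rpow_const fun _ => Or.inr hp.le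
  have hh : ∀ l : ℝ, 0 < l → ∀ a : ℝ, |l ^ p⁻¹ * a| ^ p = l * |a| ^ p := by
    intro l hl a
    rw [abs_mul, Real.mul_rpow (abs_nonneg _) (abs_nonneg _), abs_of_pos (Real.rpow_pos_of_pos hl _),
      Real.rpow_inv_rpow hl.le hp.ne']
  refine exists_abs_sub_le_of_homogeneous (δ := fun l a => l ^ p⁻¹ * a) (fun l a b => mul_add _ _ _)
    (j := fun a : ℝ => |a| ^ p) (Φ := fun a : ℝ => |a| ^ p) hc hc hh hh
    (fun a => by positivity) (fun a h => ?_) ?_ hε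
  · simpa using (Real.rpow_eq_zero (abs_nonneg a) hp.ne').1 h
  · refine (Metric.isBounded_closedBall (x := (0 : ℝ)) (r := 1)).subset fun a ha => ?_
    have ha' : |a| ^ p ≤ 1 := ha
    rw [mem_closedBall_zero_iff, Real.norm_eq_abs]
    by_contra hcon
    exact absurd ha' (not_le.2 (Real.one_lt_rpow (not_le.1 hcon) hp))

theorem exists_abs_mul_rpow_sub_le {A B P Q ε : ℝ} (hA : 0 < A) (hB : 0 < B) (hP : 0 < P)
    (hQ : 0 < Q) (hAB : A / P + B / Q = 1) (hε : 0 < ε) :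
    ∃ C : ℝ, 0 ≤ C ∧ ∀ a b : ℝ × ℝ,
      |(|(a + b).1| ^ A * |(a + b).2| ^ B - |a.1| ^ A * |a.2| ^ B)| ≤
        ε * (|a.1| ^ P + |a.2| ^ Q) + C * (|b.1| ^ P + |b.2| ^ Q) := by
  have hc : ∀ p : ℝ, 0 < p → Continuous fun a : ℝ => |a| ^ p := fun p hp =>
    continuous_abs.rpow_const fun _ => Or.inr hp.le
  have hh : ∀ (l : ℝ), 0 < l → ∀ (p r a : ℝ), 0 < p → |l ^ p⁻¹ * a| ^ r = l ^ (r / p) * |a| ^ r := by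
    intro l hl p r a hp
    rw [abs_mul, Real.mul_rpow (abs_nonneg _) (abs_nonneg _), abs_of_pos (Real.rpow_pos_of_pos hl _),
      ← Real.rpow_mul hl.le, inv_mul_eq_div]
  refine exists_abs_sub_le_of_homogeneous (E := ℝ × ℝ)
    (δ := fun l a => (l ^ P⁻¹ * a.1, l ^ Q⁻¹ * a.2))
    (fun l a b => by simp [mul_add])
    (j := fun a => |a.1| ^ A * |a.2| ^ B) (Φ := fun a => |a.1| ^ P + |a.2| ^ Q)
    (((hc A hA).comp continuous_fst).mul ((hc B hB).comp continuous_snd))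
    (((hc P hP).comp continuous_fst).add ((hc Q hQ).comp continuous_snd))
    (fun l hl a => ?_) (fun l hl a => ?_) (fun a => by positivity) (fun a h => ?_) ?_ hε
  · simp only [hh l hl _ _ _ hP, hh l hl _ _ _ hQ]
    calc _ = l ^ (A / P) * l ^ (B / Q) * (|a.1| ^ A * |a.2| ^ B) := by ring
      _ = _ := by rw [← Real.rpow_add hl, hAB, Real.rpow_one]
  · simp only [hh l hl _ _ _ hP, hh l hl _ _ _ hQ, div_self hP.ne', div_self hQ.ne', Real.rpow_one]
    ring
  · have h1 : 0 ≤ |a.1| ^ P := by positivity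
    have h2 : 0 ≤ |a.2| ^ Q := by positivity
    have h3 : |a.1| ^ P = 0 := by linarith
    have h4 : |a.2| ^ Q = 0 := by linarith
    ext
    · simpa using (Real.rpow_eq_zero (abs_nonneg a.1) hP.ne').1 h3
    · simpa using (Real.rpow_eq_zero (abs_nonneg a.2) hQ.ne').1 h4
  · refine (Metric.isBounded_closedBall (x := (0 : ℝ × ℝ)) (r := 1)).subset fun a ha => ?_
    have ha' : |a.1| ^ P + |a.2| ^ Q ≤ 1 := ha
    have h1 : 0 ≤ |a.1| ^ P := by positivity
    have h2 : 0 ≤ |a.2| ^ Q := by positivity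
    rw [mem_closedBall_zero_iff, Prod.norm_def, max_le_iff, Real.norm_eq_abs, Real.norm_eq_abs]
    constructor
    · by_contra hcon
      linarith [Real.one_lt_rpow (not_le.1 hcon) hP]
    · by_contra hcon
      linarith [Real.one_lt_rpow (not_le.1 hcon) hQ]

/-- The Brezis–Lieb lemma. -/
theorem tendsto_integral_brezis_lieb {Y E : Type*} [MeasurableSpace Y] {μ : Measure Y}
    [NormedAddCommGroup E] {j Φ : E → ℝ} (hj : Continuous j) (hΦ : Continuous Φ)
    (hΦ0 : ∀ a, 0 ≤ Φ a) (hz : Φ 0 = 0) (hjz : j 0 = 0)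
    (hineq : ∀ ε : ℝ, 0 < ε → ∃ C : ℝ, 0 ≤ C ∧ ∀ a b, |j (a + b) - j a| ≤ ε * Φ a + C * Φ b)
    {f : ℕ → Y → E} {g : Y → E} (hf : ∀ n, AEStronglyMeasurable (f n) μ)
    (hg : AEStronglyMeasurable g μ) (hgi : Integrable (fun x => Φ (g x)) μ)
    (hfi : ∀ n, Integrable (fun x => Φ (f n x - g x)) μ) {M : ℝ}
    (hM : ∀ n, ∫ x, Φ (f n x - g x) ∂μ ≤ M)
    (hae : ∀ᵐ x ∂μ, Tendsto (fun n => f n x) atTop (𝓝 (g x))) :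
    Tendsto (fun n => ∫ x, |j (f n x) - j (f n x - g x) - j (g x)| ∂μ) atTop (𝓝 0) := by
  have hM0 : 0 ≤ M := (integral_nonneg fun x => hΦ0 _).trans (hM 0)
  obtain ⟨C₁, hC₁0, hC₁⟩ := hineq 1 one_pos
  have hjΦ : ∀ b, |j b| ≤ C₁ * Φ b := fun b => by simpa [hjz, hz] using hC₁ 0 b
  set D : ℕ → Y → ℝ := fun n x => j (f n x) - j (f n x - g x) - j (g x) with hD
  have hmD : ∀ n, AEStronglyMeasurable (D n) μ := fun n =>
    ((hj.comp_aestronglyMeasurable (hf n)).sub (hj.comp_aestronglyMeasurable ((hf n).sub hg))).sub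
      (hj.comp_aestronglyMeasurable hg)
  have hpt : ∀ C ε : ℝ, (∀ a b, |j (a + b) - j a| ≤ ε * Φ a + C * Φ b) → ∀ n x,
      |D n x| ≤ ε * Φ (f n x - g x) + (C + C₁) * Φ (g x) := by
    intro C ε h n x
    have h1 := h (f n x - g x) (g x)
    rw [sub_add_cancel] at h1
    calc |D n x| ≤ |j (f n x) - j (f n x - g x)| + |j (g x)| := abs_sub _ _
      _ ≤ _ := by linarith [hjΦ (g x)]
  have hDi : ∀ n, Integrable (D n) μ := fun n =>
    (((hfi n).const_mul 1).add (hgi.const_mul (C₁ + C₁))).mono' (hmD n)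
      (Eventually.of_forall fun x => hpt _ _ hC₁ n x)
  have key : ∀ ε : ℝ, 0 < ε → ∀ᶠ n in atTop, ∫ x, |D n x| ∂μ ≤ ε * M + ε := by
    intro ε hε
    obtain ⟨C, hC0, hC⟩ := hineq ε hε
    set W : ℕ → Y → ℝ := fun n x => max (|D n x| - ε * Φ (f n x - g x)) 0 with hW
    have hWm : ∀ n, AEStronglyMeasurable (W n) μ := fun n =>
      (((hmD n).norm.sub ((hfi n).1.const_mul ε))).sup aestronglyMeasurable_const
    have hWb : ∀ n x, ‖W n x‖ ≤ (C + C₁) * Φ (g x) := by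
      intro n x
      rw [Real.norm_of_nonneg (le_max_right _ _)]
      refine max_le ?_ (mul_nonneg (by linarith) (hΦ0 _))
      linarith [hpt C ε hC n x]
    have hWi : ∀ n, Integrable (W n) μ := fun n =>
      (hgi.const_mul (C + C₁)).mono' (hWm n) (Eventually.of_forall (hWb n))
    have hlim : Tendsto (fun n => ∫ x, W n x ∂μ) atTop (𝓝 (∫ _, (0 : ℝ) ∂μ)) := by
      refine tendsto_integral_of_dominated_convergence (fun x => (C + C₁) * Φ (g x)) hWm
        (hgi.const_mul _) (fun n => Eventually.of_forall (hWb n)) ?_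
      filter_upwards [hae] with x hx
      have h1 : Tendsto (fun n => f n x - g x) atTop (𝓝 0) := by
        simpa using hx.sub_const (g x)
      have h2 : Tendsto (fun n => |D n x| - ε * Φ (f n x - g x)) atTop
          (𝓝 (|j (g x) - j 0 - j (g x)| - ε * Φ 0)) :=
        ((((hj.tendsto _).comp hx).sub ((hj.tendsto _).comp h1)).sub_const _).abs.sub
          (((hΦ.tendsto _).comp h1).const_mul ε)
      have h3 := h2.max (tendsto_const_nhds (x := (0 : ℝ)))
      simpa [hjz, hz] using h3
    rw [integral_zero] at hlim
    filter_upwards [hlim.eventually_le_const hε] with n hn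
    calc ∫ x, |D n x| ∂μ ≤ ∫ x, (ε * Φ (f n x - g x) + W n x) ∂μ := by
          refine integral_mono (hDi n).norm (((hfi n).const_mul ε).add (hWi n)) fun x => ?_
          have := le_max_left (|D n x| - ε * Φ (f n x - g x)) 0
          simp only [hW]
          linarith
      _ = ε * ∫ x, Φ (f n x - g x) ∂μ + ∫ x, W n x ∂μ := by
          rw [integral_add ((hfi n).const_mul ε) (hWi n), integral_const_mul]
      _ ≤ _ := by gcongr; exact hM n
  refine (tendsto_order.2 ⟨fun a ha => Eventually.of_forall fun n =>
    ha.trans_le (integral_nonneg fun x => abs_nonneg _), fun a ha => ?_⟩)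
  have hε : 0 < a / (2 * (M + 1)) := by positivity
  filter_upwards [key _ hε] with n hn
  have h6 : a / (2 * (M + 1)) * M + a / (2 * (M + 1)) = a / 2 := by field_simp
  exact hn.trans_lt (by linarith)

end FracSystem

namespace FracSystem

open Filter Topology Set

theorem hasDerivAt_abs_rpow_of_ne {x : ℝ} (hx : x ≠ 0) (p : ℝ) :
    HasDerivAt (fun y : ℝ => |y| ^ p) (p * |x| ^ (p - 2) * x) x := by
  have h0 : 0 < |x| := abs_pos.2 hx
  have h1 := (hasDerivAt_abs hx).rpow_const (p := p) (Or.inl h0.ne')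
  convert h1 using 1
  rw [show p - 1 = (p - 2) + 1 by ring, Real.rpow_add_one h0.ne']
  rcases lt_or_gt_of_ne hx with h | h
  · rw [abs_of_neg h, sign_neg h]; simp; ring
  · rw [abs_of_pos h, sign_pos h]; simp; ring

theorem hasDerivAt_mul_abs_rpow {A : ℝ} (hA : 0 < A) (x : ℝ) :
    HasDerivAt (fun y : ℝ => y * |y| ^ A) ((A + 1) * |x| ^ A) x := by
  rcases eq_or_ne x 0 with rfl | hx
  · rw [hasDerivAt_iff_tendsto_slope]
    have hc : Continuous fun a : ℝ => |a| ^ A := continuous_abs.rpow_const fun _ => Or.inr hA.le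
    have h1 : Tendsto (fun a : ℝ => |a| ^ A) (𝓝[≠] 0) (𝓝 ((A + 1) * |0| ^ A)) := by
      have := (hc.tendsto 0).mono_left (nhdsWithin_le_nhds (s := {0}ᶜ))
      simpa [Real.zero_rpow hA.ne'] using this
    refine h1.congr' ?_
    filter_upwards [self_mem_nhdsWithin] with y hy
    have hy' : y ≠ 0 := hy
    rw [slope_def_field]
    simp [mul_div_cancel_left₀ _ hy']
  · have h := (hasDerivAt_id x).mul (hasDerivAt_abs_rpow_of_ne hx A)
    refine h.congr_deriv ?_
    have h0 : 0 < |x| := abs_pos.2 hx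
    have : |x| ^ A = |x| ^ (A - 2) * (x * x) := by
      rw [← abs_mul_abs_self x, ← mul_assoc, ← Real.rpow_add_one h0.ne', ← Real.rpow_add_one h0.ne']
      congr 1; ring
    simp only [id, this]
    ring

theorem add_rpow_le_two_rpow_mul {a b p : ℝ} (ha : 0 ≤ a) (hb : 0 ≤ b) (hp : 0 ≤ p) :
    (a + b) ^ p ≤ 2 ^ p * (a ^ p + b ^ p) := by
  have hm : a + b ≤ 2 * max a b := by linarith [le_max_left a b, le_max_right a b]
  calc (a + b) ^ p ≤ (2 * max a b) ^ p := by gcongr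
    _ = 2 ^ p * (max a b) ^ p := Real.mul_rpow (by norm_num) (by positivity)
    _ ≤ _ := by
      gcongr
      rcases max_cases a b with ⟨h, _⟩ | ⟨h, _⟩ <;> rw [h]
      · linarith [Real.rpow_nonneg hb p]
      · linarith [Real.rpow_nonneg ha p]

theorem abs_rpow_add_sub_le {A : ℝ} (hA : 0 ≤ A) (hA1 : A ≤ 1) (x y : ℝ) :
    |(|x + y| ^ A - |x| ^ A)| ≤ |y| ^ A := by
  have key : ∀ x y : ℝ, |x + y| ^ A ≤ |x| ^ A + |y| ^ A := fun x y =>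
    (Real.rpow_le_rpow (abs_nonneg _) (abs_add_le x y) hA).trans
      (Real.rpow_add_le_add_rpow (abs_nonneg _) (abs_nonneg _) hA hA1)
  rw [abs_le]
  constructor
  · have := key (x + y) (-y)
    rw [add_neg_cancel_right, abs_neg] at this
    linarith
  · linarith [key x y]

theorem abs_rpow_add_sub_le_mul {A : ℝ} (hA : 0 < A) (hA1 : A ≤ 1) {x : ℝ} (hx : x ≠ 0) (y : ℝ) :
    |(|x + y| ^ A - |x| ^ A)| ≤ |x| ^ (A - 1) * |y| := by
  have hx0 : 0 < |x| := abs_pos.2 hx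
  have key : ∀ z : ℝ, 0 ≤ z → |z ^ A - 1| ≤ |z - 1| := by
    intro z hz
    rcases le_total z 1 with h | h
    · rw [abs_of_nonpos (by linarith [Real.rpow_le_one hz h hA.le]), abs_of_nonpos (by linarith)]
      have := Real.rpow_le_rpow_of_exponent_ge' hz h hA.le hA1
      rw [Real.rpow_one] at this
      linarith
    · rw [abs_of_nonneg (by linarith [Real.one_le_rpow h hA.le]), abs_of_nonneg (by linarith)]
      have := Real.rpow_le_rpow_of_exponent_le h hA1
      rw [Real.rpow_one] at this
      linarith
  have h1 : |x + y| ^ A = |x| ^ A * (|x + y| / |x|) ^ A := by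
    rw [Real.div_rpow (abs_nonneg _) hx0.le, mul_div_cancel₀]
    exact (Real.rpow_pos_of_pos hx0 A).ne'
  have h2 : |x| ^ A = |x| ^ (A - 1) * |x| := by
    rw [← Real.rpow_add_one hx0.ne']; congr 1; ring
  calc |(|x + y| ^ A - |x| ^ A)| = |x| ^ A * |(|x + y| / |x|) ^ A - 1| := by
        rw [h1, ← mul_sub_one, abs_mul, abs_of_nonneg (Real.rpow_nonneg hx0.le A)]
    _ ≤ |x| ^ A * |(|x + y| / |x| - 1)| := by
        exact mul_le_mul_of_nonneg_left (key _ (by positivity)) (Real.rpow_nonneg hx0.le A)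
    _ = |x| ^ (A - 1) * |(|x + y| - |x|)| := by
        rw [h2, mul_assoc]
        congr 1
        nth_rewrite 1 [← abs_of_pos hx0]
        rw [← abs_mul, mul_sub_one, mul_div_cancel₀ _ hx0.ne']
    _ ≤ _ := by
        refine mul_le_mul_of_nonneg_left ?_ (Real.rpow_nonneg hx0.le _)
        simpa using abs_abs_sub_abs_le (x + y) x

theorem abs_rpow_add_sub_le_of_one_lt {A : ℝ} (hA : 1 < A) (x y : ℝ) {t : ℝ} (ht : |t| ≤ 1) :
    |(|x + t * y| ^ A - |x| ^ A)| ≤ A * (|x| + |y|) ^ A * |t| := by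
  set M := |x| + |y| with hM
  have hM0 : 0 ≤ M := by positivity
  have h := (convex_Icc (-M) M).norm_image_sub_le_of_norm_hasDerivWithin_le (x := x) (y := x + t * y)
    (f := fun x : ℝ => |x| ^ A) (f' := fun x => A * |x| ^ (A - 2) * x) (C := A * M ^ (A - 1))
    (fun z _ => (hasDerivAt_abs_rpow z hA).hasDerivWithinAt) (fun z hz => by
      have hz' : |z| ≤ M := abs_le.2 hz
      rw [norm_mul, norm_mul, Real.norm_of_nonneg (Real.rpow_nonneg (abs_nonneg z) _),
        Real.norm_of_nonneg (by linarith), Real.norm_eq_abs, mul_assoc]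
      refine mul_le_mul_of_nonneg_left ?_ (by linarith)
      rcases eq_or_ne z 0 with rfl | hz0
      · simp; positivity
      · rw [← Real.rpow_add_one (abs_pos.2 hz0).ne', show A - 2 + 1 = A - 1 by ring]
        exact Real.rpow_le_rpow (abs_nonneg _) hz' (by linarith))
    (abs_le.1 (by simp [hM])) (abs_le.1 (by
      refine (abs_add_le _ _).trans ?_
      rw [abs_mul]
      have := mul_le_mul_of_nonneg_right ht (abs_nonneg y)
      linarith))
  rw [Real.norm_eq_abs, Real.norm_eq_abs, add_sub_cancel_left, abs_mul] at h
  refine h.trans ?_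
  rcases hM0.eq_or_lt with h0 | h0
  · have : |y| = 0 := by have := abs_nonneg x; have := abs_nonneg y; linarith
    rw [this]; simp; positivity
  · have hyM : |y| ≤ M := by rw [hM]; linarith [abs_nonneg x]
    calc A * M ^ (A - 1) * (|t| * |y|) ≤ A * M ^ (A - 1) * (|t| * M) := by gcongr
      _ = A * (M ^ (A - 1) * M) * |t| := by ring
      _ = _ := by rw [← Real.rpow_add_one h0.ne', sub_add_cancel]

theorem abs_add_rpow_add_abs_sub_rpow (a b p : ℝ) :
    |a + b| ^ p + |a - b| ^ p = |(|a| + |b|)| ^ p + |(|a| - |b|)| ^ p := by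
  rcases abs_cases a with ⟨ha, _⟩ | ⟨ha, _⟩ <;> rcases abs_cases b with ⟨hb, _⟩ | ⟨hb, _⟩ <;>
    rw [ha, hb]
  · rw [sub_neg_eq_add, ← sub_eq_add_neg, add_comm]
  · rw [← abs_neg (a + b), ← abs_neg (a - b), add_comm]
    congr 3 <;> ring
  · rw [← abs_neg (a + b), ← abs_neg (a - b)]
    congr 3 <;> ring

/-- `|a + h|^p + |a - h|^p - 2|a|^p` is of order `q > 1` in the increment `h`. -/
theorem exists_second_difference_le {p : ℝ} (hp : 1 < p) :
    ∃ C q : ℝ, 0 ≤ C ∧ 1 < q ∧ ∀ a b t : ℝ, 0 < t → t ≤ 1 →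
      |a + t * b| ^ p + |a - t * b| ^ p - 2 * |a| ^ p ≤ C * t ^ q * (|a| ^ p + |b| ^ p) := by
  rcases le_or_gt p 2 with hp2 | hp2
  · refine ⟨2, p, by norm_num, hp, fun a b t ht _ => ?_⟩
    have hsq : ∀ x : ℝ, |x| ^ p = (x ^ 2) ^ (p / 2) := fun x => by
      rw [← sq_abs, ← Real.rpow_natCast, ← Real.rpow_mul (abs_nonneg _)]
      congr 1; push_cast; ring
    have hc := (Real.concaveOn_rpow (p := p / 2) (by linarith) (by linarith)).2
      (mem_Ici.2 (sq_nonneg (a + t * b))) (mem_Ici.2 (sq_nonneg (a - t * b)))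
      (show (0 : ℝ) ≤ 1 / 2 by norm_num) (show (0 : ℝ) ≤ 1 / 2 by norm_num) (by norm_num)
    simp only [smul_eq_mul] at hc
    have h1 : (1 / 2 : ℝ) * (a + t * b) ^ 2 + 1 / 2 * (a - t * b) ^ 2 = a ^ 2 + (t * b) ^ 2 := by
      ring
    rw [h1] at hc
    have h2 := Real.rpow_add_le_add_rpow (sq_nonneg a) (sq_nonneg (t * b)) (p := p / 2)
      (by linarith) (by linarith)
    simp only [← hsq] at hc h2
    rw [abs_mul, abs_of_pos ht, Real.mul_rpow ht.le (abs_nonneg _)] at h2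
    have h3 : 0 ≤ 2 * t ^ p * |a| ^ p := by positivity
    nlinarith
  · refine ⟨2 * p * (p - 1) * 2 ^ p * 2 ^ p, 2, by have : 0 < p - 1 := by linarith
                                                   positivity, by norm_num, fun a b t ht ht1 => ?_⟩
    have hp0 : 0 < p := by linarith
    have hK : (1 : ℝ) ≤ p * (p - 1) := by nlinarith
    have h2p : (1 : ℝ) ≤ 2 ^ p := Real.one_le_rpow (by norm_num) hp0.le
    set x := |a| with hx
    set h := t * |b| with hh
    have hx0 : 0 ≤ x := abs_nonneg _
    have hh0 : 0 ≤ h := by positivity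
    have hsum : |a + t * b| ^ p + |a - t * b| ^ p = |x + h| ^ p + |x - h| ^ p := by
      rw [abs_add_rpow_add_abs_sub_rpow, abs_mul, abs_of_pos ht]
    have hxb : (x + |b|) ^ p ≤ 2 ^ p * (x ^ p + |b| ^ p) :=
      add_rpow_le_two_rpow_mul hx0 (abs_nonneg b) hp0.le
    have ht2 : t ^ p ≤ t ^ (2 : ℝ) := Real.rpow_le_rpow_of_exponent_ge ht ht1 hp2.le
    rw [hsum]
    rcases lt_or_ge h x with hlt | hge
    · rw [abs_of_nonneg (by linarith), abs_of_nonneg (by linarith)]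
      have hsl : ∀ y z : ℝ, 0 ≤ y → 0 ≤ z → ∀ r : ℝ, 1 ≤ r →
          y ^ r - z ^ r ≤ r * y ^ (r - 1) * (y - z) := by
        intro y z hy hz r hr
        rcases hy.eq_or_lt with rfl | hy
        · rcases hz.eq_or_lt with rfl | hz
          · simp
          · rw [Real.zero_rpow (by linarith)]
            rcases hr.eq_or_lt with rfl | hr'
            · simp
            · rw [Real.zero_rpow (by linarith)]
              have := Real.rpow_nonneg hz.le r
              simp; exact this
        · have hb := one_add_mul_self_le_rpow_one_add (s := z / y - 1)
            (by linarith [div_nonneg hz hy.le]) hr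
          rw [add_sub_cancel, Real.div_rpow hz hy.le] at hb
          have hyr : 0 < y ^ r := Real.rpow_pos_of_pos hy r
          rw [le_div_iff₀ hyr] at hb
          have e1 : y ^ r = y ^ (r - 1) * y := by rw [← Real.rpow_add_one hy.ne', sub_add_cancel]
          have e2 : (1 + r * (z / y - 1)) * y ^ r = y ^ r + r * y ^ (r - 1) * (z - y) := by
            rw [e1]; field_simp
          rw [e2] at hb
          linarith
      have i1 := hsl (x + h) x (by linarith) hx0 p hp.le
      have i2 := hsl (x - h) x (by linarith) hx0 p hp.le
      have i3 := hsl (x + h) (x - h) (by linarith) (by linarith) (p - 1) (by linarith)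
      have e : p - 1 - 1 = p - 2 := by ring
      rw [e] at i3
      have i4 : (x + h) ^ p + (x - h) ^ p - 2 * x ^ p ≤
          p * h * ((x + h) ^ (p - 1) - (x - h) ^ (p - 1)) := by
        linarith
      have i5 : p * h * ((x + h) ^ (p - 1) - (x - h) ^ (p - 1)) ≤
          p * h * ((p - 1) * (x + h) ^ (p - 2) * (2 * h)) := by
        refine mul_le_mul_of_nonneg_left (by linarith) (by positivity)
      have hb0 := abs_nonneg b
      have hhb : h ≤ |b| := by rw [hh]; nlinarith
      have hxh : 0 < x + |b| := by linarith
      have i6 : (x + h) ^ (p - 2) * |b| ^ 2 ≤ (x + |b|) ^ p := by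
        calc (x + h) ^ (p - 2) * |b| ^ 2 ≤ (x + |b|) ^ (p - 2) * (x + |b|) ^ 2 := by
              refine mul_le_mul (Real.rpow_le_rpow (by linarith) (by linarith) (by linarith))
                (by gcongr; linarith) (by positivity) (by positivity)
          _ = _ := by
              rw [← Real.rpow_natCast (x + |b|) 2, ← Real.rpow_add hxh]; congr 1; push_cast; ring
      calc (x + h) ^ p + (x - h) ^ p - 2 * x ^ p
          ≤ p * h * ((p - 1) * (x + h) ^ (p - 2) * (2 * h)) := i4.trans i5
        _ = 2 * (p * (p - 1)) * t ^ 2 * ((x + h) ^ (p - 2) * |b| ^ 2) := by rw [hh]; ring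
        _ ≤ 2 * (p * (p - 1)) * t ^ 2 * (2 ^ p * (x ^ p + |b| ^ p)) := by
            refine mul_le_mul_of_nonneg_left (i6.trans hxb) (by positivity)
        _ = 2 * (p * (p - 1)) * 2 ^ p * t ^ (2 : ℝ) * (x ^ p + |b| ^ p) * 1 := by
            rw [← Real.rpow_natCast t 2]; push_cast; ring
        _ ≤ 2 * (p * (p - 1)) * 2 ^ p * t ^ (2 : ℝ) * (x ^ p + |b| ^ p) * 2 ^ p := by gcongr
        _ = _ := by ring
    · have hb : ∀ y : ℝ, |y| ≤ 2 * h → |y| ^ p ≤ 2 ^ p * h ^ p := fun y hy => by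
        rw [← Real.mul_rpow (by norm_num) hh0]
        exact Real.rpow_le_rpow (abs_nonneg _) hy hp0.le
      have h1 := hb (x + h) (by rw [abs_of_nonneg (by linarith)]; linarith)
      have h2 := hb (x - h) (by rw [abs_of_nonpos (by linarith)]; linarith)
      have h3 := Real.rpow_nonneg hx0 p
      have hbp : 0 ≤ |b| ^ p := by positivity
      calc |x + h| ^ p + |x - h| ^ p - 2 * x ^ p ≤ 2 * (2 ^ p * h ^ p) := by linarith
        _ = 2 * 2 ^ p * (t ^ p * |b| ^ p) := by
            rw [hh, Real.mul_rpow ht.le (abs_nonneg _)]; ring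
        _ ≤ 2 * 2 ^ p * (t ^ (2 : ℝ) * (x ^ p + |b| ^ p)) := by gcongr; linarith
        _ = 2 * 1 * 2 ^ p * 1 * t ^ (2 : ℝ) * (x ^ p + |b| ^ p) := by ring
        _ ≤ 2 * (p * (p - 1)) * 2 ^ p * 2 ^ p * t ^ (2 : ℝ) * (x ^ p + |b| ^ p) := by gcongr
        _ = _ := by ring

end FracSystem

namespace FracSystem

open Filter Topology Set

/-- The truncated average of second differences of `|·|^A` against `t⁻² dt` controls the singular
power `s^(A-1)` from above. -/
theorem exists_le_integral_second_difference {A : ℝ} (hA : 0 < A) (hA1 : A ≤ 1) :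
    ∃ c C : ℝ, 0 < c ∧ 0 ≤ C ∧ ∀ η s : ℝ, 0 < η → η < 1 → 0 < s →
      (if η ≤ s then c * s ^ (A - 1) else 0) - C ≤
        ∫ t in η..1, (|s + t| ^ A + |s - t| ^ A - 2 * s ^ A) * t ^ (-2 : ℝ) := by
  set r := A + 1 with hr
  have hr0 : 0 < r := by linarith
  have h2r : (2 : ℝ) < 2 ^ r := by
    have := Real.rpow_lt_rpow_of_exponent_lt (x := 2) (by norm_num) (show (1 : ℝ) < r by linarith)
    rwa [Real.rpow_one] at this
  set c₁ := (2 ^ r - 2) / r with hc₁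
  have hc₁0 : 0 < c₁ := div_pos (by linarith) hr0
  set c := A * c₁ / 2 with hc
  have hc0 : 0 < c := by positivity
  set C₀ := (2 ^ r + r) * 2 / r + 2 * r with hC₀
  have hC₀0 : 0 ≤ C₀ := by positivity
  refine ⟨c, C₀ + 2 * c, hc0, by positivity, fun η s hη hη1 hs => ?_⟩
  set N : ℝ → ℝ := fun t => ((s + t) * |s + t| ^ A + (s - t) * |s - t| ^ A - 2 * s ^ r) / r with hN
  have hmul : ∀ x : ℝ, 0 < x → x * |x| ^ A = x ^ r := fun x hx => by
    rw [abs_of_pos hx, hr, Real.rpow_add_one hx.ne', mul_comm]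
  have hNd : ∀ t, HasDerivAt N (|s + t| ^ A - |s - t| ^ A) t := by
    intro t
    have h1 := (hasDerivAt_mul_abs_rpow hA (s + t)).comp t ((hasDerivAt_id t).const_add s)
    have h2 := (hasDerivAt_mul_abs_rpow hA (s - t)).comp t ((hasDerivAt_id t).const_sub s)
    have h3 := ((h1.add h2).sub_const (2 * s ^ r)).div_const r
    refine h3.congr_deriv ?_
    rw [← hr]; field_simp; ring
  -- lower bounds for `N`
  have hNsmall : ∀ t, s ≤ t → c₁ * s ^ r ≤ N t := by
    intro t hst
    have ht : 0 < t := hs.trans_le hst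
    have e1 : (s - t) * |s - t| ^ A = -(t - s) ^ r := by
      rcases hst.eq_or_lt with rfl | h
      · simp [Real.zero_rpow hr0.ne']
      · rw [← hmul (t - s) (by linarith), abs_sub_comm]; ring
    have e2 := Real.add_rpow_le_rpow_add (a := t - s) (b := 2 * s) (by linarith) (by linarith)
      (show (1 : ℝ) ≤ r by linarith)
    rw [Real.mul_rpow (by norm_num) hs.le, show t - s + 2 * s = s + t by ring] at e2
    simp only [hN, e1, hmul (s + t) (by linarith), hc₁]
    rw [div_mul_eq_mul_div]
    gcongr
    linarith
  have hN0 : ∀ t, 0 < t → 0 ≤ N t := by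
    intro t ht
    rcases le_total s t with hst | hst
    · exact le_trans (by positivity) (hNsmall t hst)
    · rcases hst.eq_or_lt with rfl | hlt
      · exact le_trans (by positivity) (hNsmall t le_rfl)
      have hcv := (convexOn_rpow (p := r) (by linarith)).2
        (mem_Ici.2 (show 0 ≤ s + t by linarith)) (mem_Ici.2 (show 0 ≤ s - t by linarith))
        (show (0 : ℝ) ≤ 1 / 2 by norm_num) (show (0 : ℝ) ≤ 1 / 2 by norm_num) (by norm_num)
      simp only [smul_eq_mul] at hcv
      rw [show (1 / 2 : ℝ) * (s + t) + 1 / 2 * (s - t) = s by ring] at hcv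
      simp only [hN, hmul (s + t) (by linarith), hmul (s - t) (by linarith)]
      exact div_nonneg (by linarith) hr0.le
  -- upper bound for `N 1`
  have hN1 : N 1 ≤ C₀ * s := by
    have hsr := Real.rpow_nonneg hs.le r
    have hb : (s + 1) * |s + 1| ^ A + (s - 1) * |s - 1| ^ A - 2 * s ^ r ≤ r * (C₀ * s) := by
      rw [hmul (s + 1) (by linarith)]
      rcases le_or_gt s 1 with h1 | h1
      · have e1 : (s - 1) * |s - 1| ^ A = -(1 - s) ^ r := by
          rcases h1.eq_or_lt with rfl | h
          · simp [Real.zero_rpow hr0.ne']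
          · rw [← hmul (1 - s) (by linarith), abs_sub_comm]; ring
        have e2 : 1 - r * s ≤ (1 - s) ^ r := by
          have := one_add_mul_self_le_rpow_one_add (s := -s) (by linarith)
            (show (1 : ℝ) ≤ r by linarith)
          rw [← sub_eq_add_neg] at this
          linarith
        have hcv := (convexOn_rpow (p := r) (by linarith)).2
          (mem_Ici.2 (show (0 : ℝ) ≤ 1 by norm_num)) (mem_Ici.2 (show (0 : ℝ) ≤ 2 by norm_num))
          (show (0 : ℝ) ≤ 1 - s by linarith) hs.le (by ring)
        simp only [smul_eq_mul, Real.one_rpow, mul_one] at hcv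
        rw [show 1 - s + s * 2 = s + 1 by ring] at hcv
        have e3 : r * (C₀ * s) = ((2 ^ r + r) * 2 + 2 * r * r) * s := by rw [hC₀]; field_simp
        rw [e1, e3]
        nlinarith [mul_pos hr0 hs, mul_pos (mul_pos hr0 hr0) hs,
          mul_pos (by linarith : (0 : ℝ) < 2 ^ r) hs]
      · rw [hmul (s - 1) (by linarith)]
        have e1 : (s - 1) ^ r ≤ s ^ r := Real.rpow_le_rpow (by linarith) (by linarith) hr0.le
        have e2 : (s + 1) ^ r - s ^ r ≤ r * (s + 1) := by
          have hs1 : 0 < s + 1 := by linarith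
          have hb := one_add_mul_self_le_rpow_one_add (s := s / (s + 1) - 1)
            (by linarith [div_nonneg hs.le hs1.le]) (show (1 : ℝ) ≤ r by linarith)
          rw [add_sub_cancel, Real.div_rpow hs.le hs1.le,
            le_div_iff₀ (Real.rpow_pos_of_pos hs1 r)] at hb
          have e4 : (s + 1) ^ r = (s + 1) ^ A * (s + 1) := by
            rw [hr, Real.rpow_add_one hs1.ne']
          have e5 : (1 + r * (s / (s + 1) - 1)) * (s + 1) ^ r = (s + 1) ^ r - r * (s + 1) ^ A := by
            rw [e4]; field_simp; ring
          rw [e5] at hb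
          have e6 : (s + 1) ^ A ≤ s + 1 := by
            have := Real.rpow_le_rpow_of_exponent_le (show 1 ≤ s + 1 by linarith) hA1
            rwa [Real.rpow_one] at this
          nlinarith
        have e3 : r * (C₀ * s) = ((2 ^ r + r) * 2 + 2 * r * r) * s := by rw [hC₀]; field_simp
        rw [e3]
        nlinarith [mul_pos hr0 hs, mul_pos (mul_pos hr0 hr0) hs,
          mul_pos (by linarith : (0 : ℝ) < 2 ^ r) hs]
    rw [hN]
    simp only
    rw [div_le_iff₀ hr0]
    linarith
  -- integration by parts
  have hpos : ∀ t ∈ uIcc η 1, 0 < t := fun t ht => by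
    rw [uIcc_of_le hη1.le] at ht
    exact hη.trans_le ht.1
  have hNc : Continuous N := continuous_iff_continuousAt.2 fun t => (hNd t).continuousAt
  have hΨ : ∀ t ∈ uIcc η 1, HasDerivAt (fun t => -N t / (s * t))
      (-(|s + t| ^ A - |s - t| ^ A) / (s * t) + N t / (s * t ^ 2)) t := by
    intro t ht
    have ht0 := hpos t ht
    have h := (hNd t).neg.div ((hasDerivAt_id t).const_mul s) (by simp; exact ⟨hs.ne', ht0.ne'⟩)
    refine h.congr_deriv ?_
    simp only [id]
    field_simp
    simp only [Pi.neg_apply]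
    ring
  have hcA : ∀ f : ℝ → ℝ, Continuous f → Continuous fun t => |f t| ^ A := fun f hf =>
    (continuous_abs.comp hf).rpow_const fun _ => Or.inr hA.le
  have c1 : Continuous fun t => |s + t| ^ A := hcA _ (by fun_prop)
  have c2 : Continuous fun t => |s - t| ^ A := hcA _ (by fun_prop)
  have hΨi : IntervalIntegrable
      (fun t => -(|s + t| ^ A - |s - t| ^ A) / (s * t) + N t / (s * t ^ 2)) volume η 1 := by
    refine ContinuousOn.intervalIntegrable ?_
    refine ContinuousOn.add (ContinuousOn.div (by fun_prop) (by fun_prop) ?_)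
      (ContinuousOn.div hNc.continuousOn (by fun_prop) ?_)
    · intro t ht; have := hpos t ht; positivity
    · intro t ht; have := hpos t ht; positivity
  have hNi : IntervalIntegrable (fun t => A / s * (N t / t ^ 2)) volume η 1 := by
    refine ContinuousOn.intervalIntegrable (ContinuousOn.mul continuousOn_const
      (ContinuousOn.div hNc.continuousOn (by fun_prop) ?_))
    intro t ht; have := hpos t ht; positivity
  have hsplit : ∫ t in η..1, (|s + t| ^ A + |s - t| ^ A - 2 * s ^ A) * t ^ (-2 : ℝ) =
      (-N 1 / (s * 1) - -N η / (s * η)) + ∫ t in η..1, A / s * (N t / t ^ 2) := by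
    rw [← intervalIntegral.integral_eq_sub_of_hasDerivAt hΨ hΨi,
      ← intervalIntegral.integral_add hΨi hNi]
    refine intervalIntegral.integral_congr fun t ht => ?_
    have ht0 := hpos t ht
    have e1 : t ^ (-2 : ℝ) = (t ^ 2)⁻¹ := by
      rw [Real.rpow_neg ht0.le]; norm_num
    have e2 : r * N t = (s + t) * |s + t| ^ A + (s - t) * |s - t| ^ A - 2 * s ^ r := by
      simp only [hN]; field_simp
    have e3 : s ^ r = s ^ A * s := by rw [hr, Real.rpow_add_one hs.ne']
    have e4 : N t + A * N t = r * N t := by rw [hr]; ring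
    simp only [e1]
    field_simp
    rw [e3] at e2
    linarith
  have hlow : (if η ≤ s then c * s ^ (A - 1) else 0) - 2 * c ≤
      ∫ t in η..1, A / s * (N t / t ^ 2) := by
    have hnn : 0 ≤ ∫ t in η..1, A / s * (N t / t ^ 2) :=
      intervalIntegral.integral_nonneg hη1.le fun t ht => by
        have := hN0 t (hη.trans_le ht.1)
        positivity
    split_ifs with hηs
    · rcases le_or_gt s (1 / 2) with hs2 | hs2
      · have hs1 : s ≤ 1 := by linarith
        have hsub : IntervalIntegrable (fun t => A / s * (N t / t ^ 2)) volume s 1 :=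
          hNi.mono_set (by rw [uIcc_of_le hs1, uIcc_of_le hη1.le]; exact Icc_subset_Icc_left hηs)
        have i1 : ∫ t in s..1, A / s * (N t / t ^ 2) ≤ ∫ t in η..1, A / s * (N t / t ^ 2) :=
          intervalIntegral.integral_mono_interval hηs hs1 le_rfl
            ((ae_restrict_mem measurableSet_Ioc).mono fun t ht => by
              have h0 : 0 < t := hη.trans ht.1
              have := hN0 t h0
              simp only [Pi.zero_apply]
              positivity) hNi
        have hd : ∀ t ∈ uIcc s 1, HasDerivAt (fun t => -(A * c₁ * s ^ A) * t⁻¹)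
            (A * c₁ * s ^ A * (t ^ 2)⁻¹) t := by
          intro t ht
          rw [uIcc_of_le hs1] at ht
          have h0 : t ≠ 0 := (hs.trans_le ht.1).ne'
          refine ((hasDerivAt_inv h0).const_mul _).congr_deriv ?_
          ring
        have hdi : IntervalIntegrable (fun t => A * c₁ * s ^ A * (t ^ 2)⁻¹) volume s 1 := by
          refine ContinuousOn.intervalIntegrable (continuousOn_const.mul
            (ContinuousOn.inv₀ (by fun_prop) ?_))
          intro t ht
          rw [uIcc_of_le hs1] at ht
          have h0 : 0 < t := hs.trans_le ht.1
          positivity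
        have i2 : ∫ t in s..1, A * c₁ * s ^ A * (t ^ 2)⁻¹ ≤ ∫ t in s..1, A / s * (N t / t ^ 2) := by
          refine intervalIntegral.integral_mono_on hs1 hdi hsub fun t ht => ?_
          have h0 : 0 < t := hs.trans_le ht.1
          have e3 : s ^ r = s ^ A * s := by rw [hr, Real.rpow_add_one hs.ne']
          have := hNsmall t ht.1
          rw [e3] at this
          calc A * c₁ * s ^ A * (t ^ 2)⁻¹ = A / s * (c₁ * (s ^ A * s) / t ^ 2) := by
                field_simp
            _ ≤ _ := by gcongr
        rw [intervalIntegral.integral_eq_sub_of_hasDerivAt hd hdi] at i2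
        have e5 : s ^ (A - 1) = s ^ A * s⁻¹ := by
          rw [Real.rpow_sub_one hs.ne', div_eq_mul_inv]
        have hinv : 2 ≤ s⁻¹ := by
          rw [le_inv_comm₀ (by norm_num) hs]; linarith
        have e6 : c * s ^ (A - 1) ≤ -(A * c₁ * s ^ A) * 1⁻¹ - -(A * c₁ * s ^ A) * s⁻¹ := by
          rw [e5, hc]
          have : 0 < A * c₁ * s ^ A := by positivity
          nlinarith
        linarith
      · have : s ^ (A - 1) ≤ 2 := by
          have h1 : s ^ (A - 1) ≤ (1 / 2 : ℝ) ^ (A - 1) :=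
            Real.rpow_le_rpow_of_nonpos (by norm_num) hs2.le (by linarith)
          have h2 : (1 / 2 : ℝ) ^ (A - 1) ≤ (1 / 2 : ℝ) ^ (-1 : ℝ) :=
            Real.rpow_le_rpow_of_exponent_ge (by norm_num) (by norm_num) (by linarith)
          rw [Real.rpow_neg_one] at h2
          norm_num at h1 h2 ⊢
          linarith
        nlinarith
    · linarith
  rw [hsplit]
  have e1 : N 1 / (s * 1) ≤ C₀ := by rw [mul_one, div_le_iff₀ hs]; exact hN1
  have e2 : 0 ≤ N η / (s * η) := div_nonneg (hN0 η hη) (by positivity)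
  rw [neg_div, neg_div]
  linarith

end FracSystem

namespace FracSystem

open Filter Topology Set

section

variable {Y : Type*} [MeasurableSpace Y] {μ : Measure Y}

/-- If the second differences of `t ↦ ∫ a |u + t φ|^A`, `A ≤ 1`, are `O(t^q)` with `q > 1`, then the
formal derivative `∫ a |u|^(A-1) |φ|` converges and `a φ` vanishes a.e. where `u` does. -/
theorem integrable_of_second_difference_le [SFinite μ] {a u φ : Y → ℝ} (ha : Measurable a)
    (hu : Measurable u) (hφ : Measurable φ) (ha0 : ∀ x, 0 ≤ a x) {A : ℝ} (hA : 0 < A)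
    (hA1 : A ≤ 1) (hm : Integrable (fun x => a x * |φ x| ^ A) μ) {C q : ℝ} (hC : 0 ≤ C)
    (hq : 1 < q) (h : ∀ t : ℝ, 0 < t → t ≤ 1 →
      ∫ x, a x * (|u x + t * φ x| ^ A + |u x - t * φ x| ^ A - 2 * |u x| ^ A) ∂μ ≤ C * t ^ q) :
    Integrable (fun x => a x * (|u x| ^ (A - 1) * |φ x|)) μ ∧
      ∀ᵐ x ∂μ, u x = 0 → a x * φ x = 0 := by
  obtain ⟨c, C₁, hc, hC₁, hsc⟩ := exists_le_integral_second_difference hA hA1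
  set m : Y → ℝ := fun x => a x * |φ x| ^ A with hmdef
  set s : Y → ℝ := fun x => |u x| / |φ x| with hsdef
  have hm0 : ∀ x, 0 ≤ m x := fun x => mul_nonneg (ha0 x) (by positivity)
  have hs0 : ∀ x, 0 ≤ s x := fun x => by positivity
  have hsm : Measurable s := by fun_prop
  have hmm : Measurable m := by fun_prop
  set F : Y → ℝ → ℝ := fun x t =>
    a x * (|u x + t * φ x| ^ A + |u x - t * φ x| ^ A - 2 * |u x| ^ A) * t ^ (-2 : ℝ) with hF
  have hFm : Measurable (Function.uncurry F) := by
    simp only [hF, Function.uncurry_def]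
    fun_prop
  have hF' : ∀ x t, F x t = a x * (|u x + t * φ x| ^ A + |u x - t * φ x| ^ A - 2 * |u x| ^ A) *
    t ^ (-2 : ℝ) := fun _ _ => rfl
  -- scaling
  have hscale : ∀ x, φ x ≠ 0 → ∀ t, 0 < t →
      F x t = m x * ((|s x + t| ^ A + |s x - t| ^ A - 2 * (s x) ^ A) * t ^ (-2 : ℝ)) := by
    intro x hx t ht
    have hφ0 : 0 < |φ x| := abs_pos.2 hx
    have e : ∀ y, |φ x| ^ A * |y| ^ A = |(|φ x| * y)| ^ A := fun y => by
      rw [abs_mul, abs_abs, Real.mul_rpow (abs_nonneg _) (abs_nonneg _)]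
    have e1 : |φ x| * (s x + t) = |u x| + |t * φ x| := by
      rw [abs_mul, abs_of_pos ht, hsdef]; field_simp
    have e2 : |φ x| * (s x - t) = |u x| - |t * φ x| := by
      rw [abs_mul, abs_of_pos ht, hsdef]; field_simp
    have e3 : |φ x| ^ A * (s x) ^ A = |u x| ^ A := by
      rw [← Real.mul_rpow hφ0.le (hs0 x), hsdef]; congr 1; field_simp
    rw [hF', abs_add_rpow_add_abs_sub_rpow, ← e1, ← e2, ← e, ← e, ← e3]
    ring
  have hzero : ∀ x, φ x = 0 → ∀ t, F x t = 0 := by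
    intro x hx t
    rw [hF', hx, mul_zero, add_zero, sub_zero]; ring
  -- pointwise lower bound
  have hpt : ∀ η : ℝ, 0 < η → η < 1 → ∀ x,
      m x * ((if s x = 0 then 2 * (-Real.log η) else if η ≤ s x then c * (s x) ^ (A - 1) else 0))
        - C₁ * m x ≤ ∫ t in η..1, F x t := by
    intro η hη hη1 x
    rcases eq_or_ne (φ x) 0 with hx | hx
    · have : m x = 0 := by simp [hmdef, hx, Real.zero_rpow hA.ne']
      simp [this, hzero x hx]
    · have hcongr : ∫ t in η..1, F x t = m x * ∫ t in η..1,
          ((|s x + t| ^ A + |s x - t| ^ A - 2 * (s x) ^ A) * t ^ (-2 : ℝ)) := by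
        rw [← intervalIntegral.integral_const_mul]
        refine intervalIntegral.integral_congr fun t ht => hscale x hx t ?_
        rw [uIcc_of_le hη1.le] at ht
        exact hη.trans_le ht.1
      rw [hcongr]
      split_ifs with h0 h1
      · have hcont : ∀ f : ℝ → ℝ, ContinuousOn f (uIcc η 1) → IntervalIntegrable f volume η 1 :=
          fun f hf => hf.intervalIntegrable
        have hpos : ∀ t ∈ uIcc η 1, 0 < t := fun t ht => by
          rw [uIcc_of_le hη1.le] at ht
          exact hη.trans_le ht.1
        have i1 : ∫ t in η..1, 2 * t⁻¹ ≤
            ∫ t in η..1, ((|s x + t| ^ A + |s x - t| ^ A - 2 * (s x) ^ A) * t ^ (-2 : ℝ)) := by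
          refine intervalIntegral.integral_mono_on hη1.le ?_ ?_ fun t ht => ?_
          · exact hcont _ (continuousOn_const.mul (continuousOn_id.inv₀ fun t ht => (hpos t ht).ne'))
          · refine hcont _ (ContinuousOn.mul (Continuous.continuousOn ?_) ?_)
            · have hcA : ∀ f : ℝ → ℝ, Continuous f → Continuous fun t => |f t| ^ A := fun f hf =>
                (continuous_abs.comp hf).rpow_const fun _ => Or.inr hA.le
              exact ((hcA _ (by fun_prop)).add (hcA _ (by fun_prop))).sub continuous_const
            · exact ContinuousOn.rpow_const continuousOn_id fun t ht => Or.inl (hpos t ht).ne'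
          · have ht0 : 0 < t := hη.trans_le ht.1
            rw [h0, zero_add, zero_sub, abs_neg, abs_of_pos ht0, Real.zero_rpow hA.ne', mul_zero,
              sub_zero, ← two_mul, mul_assoc, ← Real.rpow_add ht0, ← Real.rpow_neg_one]
            gcongr 2 * ?_
            exact Real.rpow_le_rpow_of_exponent_ge ht0 ht.2 (by linarith)
        rw [intervalIntegral.integral_const_mul, integral_inv_of_pos hη one_pos, one_div,
          Real.log_inv] at i1
        have := mul_le_mul_of_nonneg_left i1 (hm0 x)
        nlinarith [mul_nonneg hC₁ (hm0 x)]
      · have := hsc η (s x) hη hη1 ((hs0 x).lt_of_ne' h0)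
        rw [if_pos h1] at this
        nlinarith [mul_le_mul_of_nonneg_left this (hm0 x)]
      · have := hsc η (s x) hη hη1 ((hs0 x).lt_of_ne' h0)
        rw [if_neg h1] at this
        nlinarith [mul_le_mul_of_nonneg_left this (hm0 x)]
  -- Fubini
  have hFub : ∀ η : ℝ, 0 < η → η < 1 → Integrable (fun x => ∫ t in η..1, F x t) μ ∧
      ∫ x, (∫ t in η..1, F x t) ∂μ ≤ C / (q - 1) := by
    intro η hη hη1
    have hFi : Integrable (Function.uncurry F) (μ.prod (volume.restrict (Ioc η 1))) := by
      have hb : Integrable (fun z : Y × ℝ => m z.1 * (2 * η ^ (-2 : ℝ)))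
          (μ.prod (volume.restrict (Ioc η 1))) := (hm.mul_const _).comp_fst _
      refine hb.mono' hFm.aestronglyMeasurable ?_
      have hmem : ∀ᵐ z : Y × ℝ ∂μ.prod (volume.restrict (Ioc η 1)), z.2 ∈ Ioc η 1 :=
        Measure.quasiMeasurePreserving_snd.ae (ae_restrict_mem measurableSet_Ioc)
      filter_upwards [hmem] with z hz
      obtain ⟨x, t⟩ := z
      have ht0 : 0 < t := hη.trans hz.1
      have e1 := abs_rpow_add_sub_le hA.le hA1 (u x) (t * φ x)
      have e2 := abs_rpow_add_sub_le hA.le hA1 (u x) (-(t * φ x))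
      rw [← sub_eq_add_neg, abs_neg] at e2
      have e3 : |t * φ x| ^ A ≤ |φ x| ^ A := by
        rw [abs_mul, abs_of_pos ht0]
        exact Real.rpow_le_rpow (by positivity)
          (mul_le_of_le_one_left (abs_nonneg _) hz.2) hA.le
      have e4 : |(|u x + t * φ x| ^ A + |u x - t * φ x| ^ A - 2 * |u x| ^ A)| ≤ 2 * |φ x| ^ A := by
        rw [abs_le] at e1 e2 ⊢
        constructor <;> linarith [e1.1, e1.2, e2.1, e2.2]
      have e5 : t ^ (-2 : ℝ) ≤ η ^ (-2 : ℝ) :=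
        Real.rpow_le_rpow_of_nonpos hη hz.1.le (by norm_num)
      simp only [Function.uncurry_apply_pair, hF', norm_mul, Real.norm_eq_abs, abs_of_nonneg (ha0 x),
        abs_of_nonneg (Real.rpow_nonneg ht0.le (-2 : ℝ))]
      calc a x * |(|u x + t * φ x| ^ A + |u x - t * φ x| ^ A - 2 * |u x| ^ A)| * t ^ (-2 : ℝ)
          ≤ a x * (2 * |φ x| ^ A) * η ^ (-2 : ℝ) := by
            have := ha0 x
            gcongr
        _ = _ := by simp only [hmdef]; ring
    have hJ : ∀ x, ∫ t in η..1, F x t = ∫ t, F x t ∂(volume.restrict (Ioc η 1)) := fun x =>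
      intervalIntegral.integral_of_le hη1.le
    simp only [hJ]
    refine ⟨hFi.integral_prod_left, ?_⟩
    rw [integral_integral_swap hFi]
    have hcont : IntegrableOn (fun t : ℝ => C * t ^ (q - 2)) (Ioc η 1) := by
      have : IntervalIntegrable (fun t : ℝ => C * t ^ (q - 2)) volume η 1 :=
        (intervalIntegral.intervalIntegrable_rpow' (by linarith)).const_mul C
      exact this.1
    have i1 : ∫ t in Ioc η 1, ∫ x, F x t ∂μ ≤ ∫ t in Ioc η 1, C * t ^ (q - 2) := by
      refine setIntegral_mono_on hFi.integral_prod_right hcont measurableSet_Ioc fun t ht => ?_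
      have ht0 : 0 < t := hη.trans ht.1
      simp only [hF']
      rw [integral_mul_const]
      calc _ ≤ C * t ^ q * t ^ (-2 : ℝ) :=
            mul_le_mul_of_nonneg_right (h t ht0 ht.2) (Real.rpow_nonneg ht0.le _)
        _ = _ := by rw [mul_assoc, ← Real.rpow_add ht0]; rfl
    refine i1.trans ?_
    rw [← intervalIntegral.integral_of_le hη1.le, intervalIntegral.integral_const_mul,
      integral_rpow (Or.inl (by linarith)), div_eq_mul_inv]
    refine mul_le_mul_of_nonneg_left ?_ hC
    rw [show q - 2 + 1 = q - 1 by ring, Real.one_rpow]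
    have h1 : 0 < (q - 1)⁻¹ := inv_pos.2 (by linarith)
    have h2 : 0 ≤ η ^ (q - 1) := Real.rpow_nonneg hη.le _
    nlinarith
  set K := C / (q - 1) + C₁ * ∫ x, m x ∂μ with hK
  set G : ℝ → Y → ℝ := fun η x =>
    m x * ((if s x = 0 then 2 * (-Real.log η) else if η ≤ s x then c * (s x) ^ (A - 1) else 0))
    with hG
  have hGm : ∀ η, Measurable (G η) := fun η => hmm.mul (Measurable.ite
    (hsm (measurableSet_singleton 0)) measurable_const (Measurable.ite
    (measurableSet_le measurable_const hsm) (by fun_prop) measurable_const))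
  have hG0 : ∀ η, 0 < η → η < 1 → ∀ x, 0 ≤ G η x := fun η hη hη1 x => by
    refine mul_nonneg (hm0 x) ?_
    have := Real.log_neg hη hη1
    have := hs0 x
    split_ifs
    · linarith
    · positivity
    · exact le_rfl
  have hGi : ∀ η, 0 < η → η < 1 → ∫⁻ x, ENNReal.ofReal (G η x) ∂μ ≤ ENNReal.ofReal K := by
    intro η hη hη1
    obtain ⟨hJi, hJ⟩ := hFub η hη hη1
    have hsum : Integrable (fun x => (∫ t in η..1, F x t) + C₁ * m x) μ := hJi.add (hm.const_mul _)
    have hle : ∀ x, G η x ≤ (∫ t in η..1, F x t) + C₁ * m x := fun x => by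
      linarith [hpt η hη hη1 x]
    calc ∫⁻ x, ENNReal.ofReal (G η x) ∂μ
        ≤ ∫⁻ x, ENNReal.ofReal ((∫ t in η..1, F x t) + C₁ * m x) ∂μ :=
          lintegral_mono fun x => ENNReal.ofReal_le_ofReal (hle x)
      _ = ENNReal.ofReal (∫ x, ((∫ t in η..1, F x t) + C₁ * m x) ∂μ) :=
          (ofReal_integral_eq_lintegral_ofReal hsum (Eventually.of_forall fun x =>
            (hG0 η hη hη1 x).trans (hle x))).symm
      _ ≤ _ := by
          refine ENNReal.ofReal_le_ofReal ?_
          rw [integral_add hJi (hm.const_mul _), integral_const_mul]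
          linarith
  have hz : ∀ᵐ x ∂μ, u x = 0 → a x * φ x = 0 := by
    set Z : ENNReal := ∫⁻ x in {x | s x = 0}, ENNReal.ofReal (m x) ∂μ with hZ
    have hZn : ∀ n : ℕ, 0 < n → ENNReal.ofReal n * Z ≤ ENNReal.ofReal K := by
      intro n hn
      have hn' : (0 : ℝ) < n := by exact_mod_cast hn
      refine le_trans ?_ (hGi (Real.exp (-n)) (Real.exp_pos _) (by simpa using hn))
      rw [hZ, ← lintegral_const_mul _ hmm.ennreal_ofReal]
      refine le_trans (setLIntegral_mono' (hsm (measurableSet_singleton 0)) fun x hx => ?_)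
        (setLIntegral_le_lintegral _ _)
      have hx' : s x = 0 := hx
      rw [← ENNReal.ofReal_mul hn'.le]
      refine ENNReal.ofReal_le_ofReal ?_
      simp only [hG, hx', if_true, Real.log_exp]
      nlinarith [mul_nonneg hn'.le (hm0 x)]
    have hZ0 : Z = 0 := by
      by_contra hne
      have hZt : Z ≠ ⊤ := by
        have := hZn 1 one_pos
        simp only [Nat.cast_one, ENNReal.ofReal_one, one_mul] at this
        exact (this.trans_lt ENNReal.ofReal_lt_top).ne
      have hZr : 0 < Z.toReal := ENNReal.toReal_pos hne hZt
      obtain ⟨n, hn⟩ := exists_nat_gt (max K 0 / Z.toReal)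
      have hn0 : (0 : ℝ) < n := lt_of_le_of_lt (by positivity) hn
      have h1 := hZn n (by exact_mod_cast hn0)
      rw [← ENNReal.ofReal_toReal hZt, ← ENNReal.ofReal_mul hn0.le] at h1
      have h2 := (ENNReal.ofReal_le_ofReal_iff' ).1 h1
      rw [div_lt_iff₀ hZr] at hn
      rcases h2 with h2 | h2
      · linarith [le_max_left K 0]
      · nlinarith
    rw [hZ, setLIntegral_eq_zero_iff (s := {x | s x = 0})
      (hsm (measurableSet_singleton 0)) hmm.ennreal_ofReal] at hZ0
    filter_upwards [hZ0] with x hx hux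
    have h1 := hx (by simp [hsdef, hux])
    rw [ENNReal.ofReal_eq_zero] at h1
    have h2 : m x = 0 := le_antisymm h1 (hm0 x)
    rcases mul_eq_zero.1 h2 with h3 | h3
    · simp [h3]
    · have : φ x = 0 := by simpa using (Real.rpow_eq_zero (abs_nonneg _) hA.ne').1 h3
      simp [this]
  refine ⟨?_, hz⟩
  set H : Y → ℝ := fun x => a x * (|u x| ^ (A - 1) * |φ x|) with hH
  have hHm : Measurable H := by fun_prop
  have hH0 : ∀ x, 0 ≤ H x := fun x => mul_nonneg (ha0 x) (by positivity)
  have hlim : ∀ᵐ x ∂μ, ENNReal.ofReal (c * H x) ≤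
      liminf (fun n : ℕ => ENNReal.ofReal (G (1 / ((n : ℝ) + 2)) x)) atTop := by
    filter_upwards [hz] with x hx
    rcases eq_or_ne (a x * φ x) 0 with h0 | h0
    · have : H x = 0 := by
        rcases mul_eq_zero.1 h0 with h3 | h3 <;> simp [hH, h3]
      simp [this]
    · have hφ0 : φ x ≠ 0 := right_ne_zero_of_mul h0
      have hu0 : u x ≠ 0 := fun h => h0 (hx h)
      have hsx : 0 < s x := by simp only [hsdef]; positivity
      have hev : ∀ᶠ n : ℕ in atTop, 1 / ((n : ℝ) + 2) ≤ s x := by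
        obtain ⟨n, hn⟩ := exists_nat_gt (1 / s x)
        filter_upwards [eventually_ge_atTop n] with k hk
        have hk' : (n : ℝ) ≤ k := by exact_mod_cast hk
        rw [div_le_iff₀ (by positivity)]
        rw [div_lt_iff₀ hsx] at hn
        nlinarith
      refine (le_liminf_of_le (by isBoundedDefault) ?_)
      filter_upwards [hev] with n hn
      refine ENNReal.ofReal_le_ofReal (le_of_eq ?_)
      simp only [hG, if_neg hsx.ne', if_pos hn]
      have hφp : 0 < |φ x| := abs_pos.2 hφ0
      have hup : 0 < |u x| := abs_pos.2 hu0
      have e : |φ x| ^ A = |φ x| ^ (A - 1) * |φ x| := by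
        rw [← Real.rpow_add_one hφp.ne', sub_add_cancel]
      simp only [hH, hmdef, hsdef]
      rw [Real.div_rpow hup.le hφp.le, e]
      have := (Real.rpow_pos_of_pos hφp (A - 1)).ne'
      field_simp
  have hfin : ∫⁻ x, ENNReal.ofReal (c * H x) ∂μ ≤ ENNReal.ofReal K := by
    calc ∫⁻ x, ENNReal.ofReal (c * H x) ∂μ
        ≤ ∫⁻ x, liminf (fun n : ℕ => ENNReal.ofReal (G (1 / ((n : ℝ) + 2)) x)) atTop ∂μ :=
          lintegral_mono_ae hlim
      _ ≤ liminf (fun n : ℕ => ∫⁻ x, ENNReal.ofReal (G (1 / ((n : ℝ) + 2)) x) ∂μ) atTop :=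
          lintegral_liminf_le fun n => (hGm _).ennreal_ofReal
      _ ≤ _ := by
          refine liminf_le_of_le (by isBoundedDefault) fun b hb => ?_
          obtain ⟨n, hn⟩ := hb.exists
          refine hn.trans (hGi _ (by positivity) ?_)
          rw [div_lt_one (by positivity)]
          linarith [(Nat.cast_nonneg n : (0 : ℝ) ≤ n)]
  have hcH : Integrable (fun x => c * H x) μ := by
    refine ⟨(hHm.const_mul c).aestronglyMeasurable, ?_⟩
    rw [hasFiniteIntegral_iff_ofReal (Eventually.of_forall fun x => mul_nonneg hc.le (hH0 x))]
    exact hfin.trans_lt ENNReal.ofReal_lt_top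
  have := hcH.const_mul c⁻¹
  simpa [← mul_assoc, hc.ne'] using this

/-- Differentiation under the integral sign in `t ↦ ∫ a |u + t φ|^A`. -/
theorem hasDerivAt_integral_mul_abs_rpow {a u φ b : Y → ℝ} (ha : AEStronglyMeasurable a μ)
    (hu : AEStronglyMeasurable u μ) (hφ : AEStronglyMeasurable φ μ) {A : ℝ} (hA : 0 < A)
    (hint : Integrable (fun x => a x * |u x| ^ A) μ) (hb : Integrable b μ)
    (hbd : ∀ᵐ x ∂μ, ∀ t ∈ Ioo (-1 : ℝ) 1, |a x * |u x + t * φ x| ^ A - a x * |u x| ^ A| ≤ b x * |t|)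
    (hd : 1 < A ∨ ∀ᵐ x ∂μ, u x = 0 → a x * φ x = 0) :
    Integrable (fun x => a x * (u x * |u x| ^ (A - 2) * φ x)) μ ∧
    HasDerivAt (fun t : ℝ => ∫ x, a x * |u x + t * φ x| ^ A ∂μ)
      (A * ∫ x, a x * (u x * |u x| ^ (A - 2) * φ x) ∂μ) 0 := by
  have hrm : ∀ p : ℝ, ∀ f : Y → ℝ, AEStronglyMeasurable f μ →
      AEStronglyMeasurable (fun x => |f x| ^ p) μ := fun p f hf =>
    ((hf.aemeasurable.abs).pow_const p).aestronglyMeasurable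
  have hF'm : AEStronglyMeasurable (fun x => A * (a x * (u x * |u x| ^ (A - 2) * φ x))) μ :=
    (ha.mul ((hu.mul (hrm _ _ hu)).mul hφ)).const_mul A
  have hpd : ∀ᵐ x ∂μ, HasDerivAt (fun t : ℝ => a x * |u x + t * φ x| ^ A)
      (A * (a x * (u x * |u x| ^ (A - 2) * φ x))) 0 := by
    have hcomp : ∀ x, HasDerivAt (fun y : ℝ => |y| ^ A) (A * |u x| ^ (A - 2) * u x) (u x) →
        HasDerivAt (fun t : ℝ => a x * |u x + t * φ x| ^ A)
          (A * (a x * (u x * |u x| ^ (A - 2) * φ x))) 0 := by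
      intro x hx
      have h1 : HasDerivAt (fun t : ℝ => u x + t * φ x) (φ x) 0 := by
        simpa using ((hasDerivAt_id (0 : ℝ)).mul_const (φ x)).const_add (u x)
      have hx' : HasDerivAt (fun y : ℝ => |y| ^ A) (A * |u x| ^ (A - 2) * u x)
          (u x + 0 * φ x) := by simpa using hx
      refine ((hx'.comp (0 : ℝ) h1).const_mul (a x)).congr_deriv ?_
      ring
    rcases hd with hA1 | hz
    · exact Eventually.of_forall fun x => hcomp x (hasDerivAt_abs_rpow _ hA1)
    · filter_upwards [hz] with x hx
      rcases eq_or_ne (u x) 0 with h0 | h0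
      · have hc : (fun t : ℝ => a x * |u x + t * φ x| ^ A) = fun _ => a x * |u x| ^ A := by
          funext t
          rcases mul_eq_zero.1 (hx h0) with h | h <;> simp [h]
        rw [hc, h0]
        simpa using hasDerivAt_const (0 : ℝ) (a x * |(0 : ℝ)| ^ A)
      · exact hcomp x (hasDerivAt_abs_rpow_of_ne h0 A)
  have hmain := hasFDerivAt_integral_of_dominated_loc_of_lip' (𝕜 := ℝ) (μ := μ) (x₀ := (0 : ℝ))
    (F := fun (t : ℝ) x => a x * |u x + t * φ x| ^ A) (bound := b)
    (F' := fun x => ContinuousLinearMap.toSpanSingleton ℝ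
      (A * (a x * (u x * |u x| ^ (A - 2) * φ x))))
    (Ioo_mem_nhds (show (-1 : ℝ) < 0 by norm_num) (show (0 : ℝ) < 1 by norm_num))
    (fun t _ => ha.mul (hrm _ _ (hu.add (hφ.const_mul t))))
    (by simpa using hint)
    ((ContinuousLinearMap.toSpanSingletonCLE (𝕜 := ℝ) (E := ℝ)).continuous.comp_aestronglyMeasurable
      hF'm)
    (by filter_upwards [hbd] with x hx t ht
        simpa using hx t ht)
    hb (by filter_upwards [hpd] with x hx using hx.hasFDerivAt)
  obtain ⟨hi, hder⟩ := hmain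
  have hi1 : Integrable (fun x => A * (a x * (u x * |u x| ^ (A - 2) * φ x))) μ := by
    simpa using hi.apply_continuousLinearMap (1 : ℝ)
  have hder1 := hder.hasDerivAt
  rw [ContinuousLinearMap.integral_apply hi] at hder1
  simp only [ContinuousLinearMap.toSpanSingleton_apply, one_smul] at hder1
  rw [integral_const_mul] at hder1
  refine ⟨?_, hder1⟩
  have hi2 := hi1.const_mul A⁻¹
  simpa [← mul_assoc, hA.ne'] using hi2

theorem integrable_mul_abs_add_abs_rpow {a u φ : Y → ℝ} (ha : AEStronglyMeasurable a μ)
    (hu : AEStronglyMeasurable u μ) (hφ : AEStronglyMeasurable φ μ) (ha0 : ∀ x, 0 ≤ a x) {A : ℝ}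
    (hA : 0 ≤ A) (hui : Integrable (fun x => a x * |u x| ^ A) μ)
    (hφi : Integrable (fun x => a x * |φ x| ^ A) μ) :
    Integrable (fun x => a x * (|u x| + |φ x|) ^ A) μ := by
  refine ((hui.add hφi).const_mul (2 ^ A)).mono' (ha.mul
    ((hu.aemeasurable.abs.add hφ.aemeasurable.abs).pow_const A).aestronglyMeasurable)
    (Eventually.of_forall fun x => ?_)
  have hx := ha0 x
  rw [Real.norm_of_nonneg (by positivity)]
  have h1 : (|u x| + |φ x|) ^ A ≤ 2 ^ A * (|u x| ^ A + |φ x| ^ A) :=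
    add_rpow_le_two_rpow_mul (abs_nonneg _) (abs_nonneg _) hA
  calc a x * (|u x| + |φ x|) ^ A ≤ a x * (2 ^ A * (|u x| ^ A + |φ x| ^ A)) := by gcongr
    _ = _ := by simp only [Pi.add_apply]; ring

theorem hasDerivAt_integral_mul_abs_rpow_of_one_lt {a u φ : Y → ℝ}
    (ha : AEStronglyMeasurable a μ) (hu : AEStronglyMeasurable u μ)
    (hφ : AEStronglyMeasurable φ μ) (ha0 : ∀ x, 0 ≤ a x) {A : ℝ} (hA : 1 < A)
    (hui : Integrable (fun x => a x * |u x| ^ A) μ)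
    (hφi : Integrable (fun x => a x * |φ x| ^ A) μ) :
    Integrable (fun x => a x * (u x * |u x| ^ (A - 2) * φ x)) μ ∧
    HasDerivAt (fun t : ℝ => ∫ x, a x * |u x + t * φ x| ^ A ∂μ)
      (A * ∫ x, a x * (u x * |u x| ^ (A - 2) * φ x) ∂μ) 0 := by
  have hA0 : 0 < A := by linarith
  refine hasDerivAt_integral_mul_abs_rpow ha hu hφ hA0 hui
    ((integrable_mul_abs_add_abs_rpow ha hu hφ ha0 hA0.le hui hφi).const_mul A)
    (Eventually.of_forall fun x t ht => ?_) (Or.inl hA)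
  have h1 := abs_rpow_add_sub_le_of_one_lt hA (u x) (φ x) (abs_le.2 ⟨ht.1.le, ht.2.le⟩)
  rw [← mul_sub, abs_mul, abs_of_nonneg (ha0 x)]
  calc a x * |(|u x + t * φ x| ^ A - |u x| ^ A)| ≤ a x * (A * (|u x| + |φ x|) ^ A * |t|) :=
        mul_le_mul_of_nonneg_left h1 (ha0 x)
    _ = _ := by ring

theorem hasDerivAt_integral_mul_abs_rpow_of_second_difference_le [SFinite μ] {a u φ : Y → ℝ}
    (ha : Measurable a) (hu : Measurable u) (hφ : Measurable φ) (ha0 : ∀ x, 0 ≤ a x) {A : ℝ}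
    (hA : 0 < A) (hui : Integrable (fun x => a x * |u x| ^ A) μ)
    (hφi : Integrable (fun x => a x * |φ x| ^ A) μ) {C q : ℝ} (hC : 0 ≤ C)
    (hq : 1 < q) (h : ∀ t : ℝ, 0 < t → t ≤ 1 →
      ∫ x, a x * (|u x + t * φ x| ^ A + |u x - t * φ x| ^ A - 2 * |u x| ^ A) ∂μ ≤ C * t ^ q) :
    Integrable (fun x => a x * (u x * |u x| ^ (A - 2) * φ x)) μ ∧
    HasDerivAt (fun t : ℝ => ∫ x, a x * |u x + t * φ x| ^ A ∂μ)
      (A * ∫ x, a x * (u x * |u x| ^ (A - 2) * φ x) ∂μ) 0 := by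
  rcases lt_or_ge 1 A with hA1 | hA1
  · exact hasDerivAt_integral_mul_abs_rpow_of_one_lt ha.aestronglyMeasurable
      hu.aestronglyMeasurable hφ.aestronglyMeasurable ha0 hA1 hui hφi
  · obtain ⟨hb, hz⟩ := integrable_of_second_difference_le ha hu hφ ha0 hA hA1 hφi hC hq h
    refine hasDerivAt_integral_mul_abs_rpow ha.aestronglyMeasurable
      hu.aestronglyMeasurable hφ.aestronglyMeasurable hA hui hb ?_ (Or.inr hz)
    filter_upwards [hz] with x hx t ht
    rw [← mul_sub, abs_mul, abs_of_nonneg (ha0 x)]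
    rcases eq_or_ne (u x) 0 with h0 | h0
    · rcases mul_eq_zero.1 (hx h0) with h | h <;> simp [h]
    · calc a x * |(|u x + t * φ x| ^ A - |u x| ^ A)| ≤ a x * (|u x| ^ (A - 1) * |t * φ x|) :=
            mul_le_mul_of_nonneg_left (abs_rpow_add_sub_le_mul hA hA1 h0 _) (ha0 x)
        _ = _ := by rw [abs_mul]; ring

end

end FracSystem

namespace FracSystem

open Filter Topology Set

/-- Fatou's lemma for nonnegative integrable functions with bounded integrals. -/
theorem integrable_of_tendsto_of_integral_le {Y : Type*} [MeasurableSpace Y] {μ : Measure Y}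
    {f : ℕ → Y → ℝ} {g : Y → ℝ} {K : ℝ} (hf : ∀ n, Integrable (f n) μ) (hf0 : ∀ n x, 0 ≤ f n x)
    (hK : ∀ n, ∫ x, f n x ∂μ ≤ K) (h : ∀ᵐ x ∂μ, Tendsto (fun n => f n x) atTop (𝓝 (g x))) :
    Integrable g μ ∧ ∫ x, g x ∂μ ≤ K := by
  have hg0 : 0 ≤ᵐ[μ] g := by
    filter_upwards [h] with x hx using ge_of_tendsto' hx fun n => hf0 n x
  have hgm : AEStronglyMeasurable g μ :=
    aestronglyMeasurable_of_tendsto_ae atTop (fun n => (hf n).1) h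
  have hle : ∫⁻ x, ENNReal.ofReal (g x) ∂μ ≤ ENNReal.ofReal K := by
    calc ∫⁻ x, ENNReal.ofReal (g x) ∂μ
        = ∫⁻ x, liminf (fun n => ENNReal.ofReal (f n x)) atTop ∂μ := by
          refine lintegral_congr_ae ?_
          filter_upwards [h] with x hx
          exact ((ENNReal.continuous_ofReal.tendsto _).comp hx).liminf_eq.symm
      _ ≤ liminf (fun n => ∫⁻ x, ENNReal.ofReal (f n x) ∂μ) atTop :=
          lintegral_liminf_le' fun n => (hf n).1.aemeasurable.ennreal_ofReal
      _ ≤ _ := by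
          refine liminf_le_of_le (by isBoundedDefault) fun b hb => ?_
          obtain ⟨n, hn⟩ := hb.exists
          refine hn.trans ?_
          rw [← ofReal_integral_eq_lintegral_ofReal (hf n) (Eventually.of_forall (hf0 n))]
          exact ENNReal.ofReal_le_ofReal (hK n)
  have hgi : Integrable g μ := by
    refine ⟨hgm, ?_⟩
    rw [hasFiniteIntegral_iff_ofReal hg0]
    exact hle.trans_lt ENNReal.ofReal_lt_top
  refine ⟨hgi, ?_⟩
  rw [← ofReal_integral_eq_lintegral_ofReal hgi hg0] at hle
  have hK0 : 0 ≤ K := (integral_nonneg (hf0 0)).trans (hK 0)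
  exact (ENNReal.ofReal_le_ofReal_iff hK0).1 hle

theorem quot_congr {N : ℕ} (s p : ℝ) {u v : Eu N → ℝ} (h : u =ᵐ[volume] v) :
    quot s p u =ᵐ[volume] quot s p v := by
  filter_upwards [ae_prod h] with z hz
  simp only [quot, hz.1, hz.2]

theorem gagliardoIntegrand_congr {N : ℕ} (s p : ℝ) {u v : Eu N → ℝ} (h : u =ᵐ[volume] v) :
    gagliardoIntegrand s p u =ᵐ[volume] gagliardoIntegrand s p v := by
  filter_upwards [ae_prod h] with z hz
  simp only [gagliardoIntegrand, hz.1, hz.2]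

theorem gagliardoIntegrand_nonneg {N : ℕ} (s p : ℝ) (u : Eu N → ℝ) (z : Eu N × Eu N) :
    0 ≤ gagliardoIntegrand s p u z :=
  div_nonneg (Real.rpow_nonneg (abs_nonneg _) _) (Real.rpow_nonneg (norm_nonneg _) _)

theorem gagliardo_nonneg {N : ℕ} (s p : ℝ) (u : Eu N → ℝ) : 0 ≤ gagliardo s p u :=
  integral_nonneg (gagliardoIntegrand_nonneg s p u)

theorem tendsto_quot {N : ℕ} (s p : ℝ) {u : ℕ → Eu N → ℝ} {v : Eu N → ℝ}
    (h : ∀ᵐ x, Tendsto (fun n => u n x) atTop (𝓝 (v x))) :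
    ∀ᵐ z : Eu N × Eu N, Tendsto (fun n => quot s p (u n) z) atTop (𝓝 (quot s p v z)) := by
  filter_upwards [ae_prod h] with z hz
  exact (hz.1.sub hz.2).div_const _

namespace X0

variable {N : ℕ} {Ω : Set (Eu N)} {s p : ℝ} [hp : Fact (1 < p)]

theorem measurable (u : X0 Ω s p) : Measurable u := u.1.stronglyMeasurable.measurable

theorem coe_add (u v : X0 Ω s p) : ⇑(u + v) =ᵐ[volume] fun x => u x + v x :=
  AEEqFun.coeFn_add u.1 v.1

theorem coe_smul (c : ℝ) (u : X0 Ω s p) : ⇑(c • u) =ᵐ[volume] fun x => c * u x :=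
  AEEqFun.coeFn_smul c u.1

theorem coe_sub (u v : X0 Ω s p) : ⇑(u - v) =ᵐ[volume] fun x => u x - v x :=
  AEEqFun.coeFn_sub u.1 v.1

theorem coe_add_smul (u φ : X0 Ω s p) (t : ℝ) : ⇑(u + t • φ) =ᵐ[volume] fun x => u x + t * φ x := by
  filter_upwards [coe_add u (t • φ), coe_smul t φ] with x h1 h2
  rw [h1, h2]

theorem quot_add_smul (u φ : X0 Ω s p) (t : ℝ) :
    quot s p ⇑(u + t • φ) =ᵐ[volume] fun z => quot s p u z + t * quot s p φ z := by
  filter_upwards [quot_congr s p (coe_add_smul u φ t)] with z hz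
  rw [hz]
  simp only [quot]
  ring

theorem quot_coe_sub (u v : X0 Ω s p) :
    quot s p ⇑(u - v) =ᵐ[volume] fun z => quot s p u z - quot s p v z := by
  filter_upwards [quot_congr s p (coe_sub u v)] with z hz
  rw [hz]
  simp only [quot]
  ring

theorem integrable_gagliardoIntegrand (u : X0 Ω s p) : Integrable (gagliardoIntegrand s p u) :=
  u.2.2.2

theorem norm_rpow_eq_gagliardo (u : X0 Ω s p) : ‖u‖ ^ p = gagliardo s p u := by
  have h0 : 0 < p := zero_lt_one.trans hp.out
  rw [norm_def, one_div, Real.rpow_inv_rpow (gagliardo_nonneg _ _ _) h0.ne']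

theorem norm_rpow_eq (u : X0 Ω s p) : ‖u‖ ^ p = ∫ z, |quot s p u z| ^ p := by
  rw [norm_rpow_eq_gagliardo, gagliardo]
  simp_rw [← norm_quot_rpow hp.out, Real.norm_eq_abs]

theorem integrable_quot_rpow (u : X0 Ω s p) : Integrable fun z => |quot s p u z| ^ p := by
  refine u.integrable_gagliardoIntegrand.congr (Eventually.of_forall fun z => ?_)
  simp only [← norm_quot_rpow hp.out, Real.norm_eq_abs]

theorem aesm_quot (u : X0 Ω s p) :
    AEStronglyMeasurable (quot s p u) (volume : Measure (Eu N × Eu N)) := u.memLp.1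

theorem norm_rpow_add_smul (u φ : X0 Ω s p) (t : ℝ) :
    ‖u + t • φ‖ ^ p = ∫ z, |quot s p u z + t * quot s p φ z| ^ p := by
  rw [norm_rpow_eq]
  refine integral_congr_ae ?_
  filter_upwards [quot_add_smul u φ t] with z hz
  rw [hz]

theorem fracPLaplace_eq (u φ : X0 Ω s p) : fracPLaplace u φ =
    ∫ z, quot s p u z * |quot s p u z| ^ (p - 2) * quot s p φ z := by
  refine integral_congr_ae (Eventually.of_forall fun z => ?_)
  have hp0 : 0 < p := zero_lt_one.trans hp.out
  rcases eq_or_ne z.1 z.2 with h | h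
  · simp [quot, h]
  · have hn : 0 < ‖z.1 - z.2‖ := norm_pos_iff.2 (sub_ne_zero.2 h)
    set d := ‖z.1 - z.2‖ ^ (((N : ℝ) + s * p) / p) with hd
    have hd0 : 0 < d := Real.rpow_pos_of_pos hn _
    have hdp : ‖z.1 - z.2‖ ^ ((N : ℝ) + s * p) = d ^ (p - 2) * d * d := by
      rw [← Real.rpow_add_one hd0.ne', ← Real.rpow_add_one hd0.ne', hd, ← Real.rpow_mul hn.le]
      congr 1
      field_simp
      ring
    simp only [quot, ← hd, hdp, abs_div, abs_of_pos hd0]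
    rw [Real.div_rpow (abs_nonneg _) hd0.le]
    have := (Real.rpow_pos_of_pos hd0 (p - 2)).ne'
    field_simp

theorem hasDerivAt_norm_rpow (u φ : X0 Ω s p) :
    HasDerivAt (fun t : ℝ => ‖u + t • φ‖ ^ p) (p * fracPLaplace u φ) 0 := by
  have h := (hasDerivAt_integral_mul_abs_rpow_of_one_lt (a := fun _ => (1 : ℝ))
    aestronglyMeasurable_const u.aesm_quot φ.aesm_quot (fun _ => zero_le_one) hp.out
    (by simpa using u.integrable_quot_rpow) (by simpa using φ.integrable_quot_rpow)).2
  simp only [one_mul] at h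
  simpa only [norm_rpow_add_smul, fracPLaplace_eq] using h

theorem exists_norm_second_difference_le (u φ : X0 Ω s p) :
    ∃ C q : ℝ, 0 ≤ C ∧ 1 < q ∧ ∀ t : ℝ, 0 < t → t ≤ 1 →
      ‖u + t • φ‖ ^ p + ‖u + (-t) • φ‖ ^ p - 2 * ‖u‖ ^ p ≤ C * t ^ q := by
  obtain ⟨C, q, hC, hq, h⟩ := exists_second_difference_le hp.out
  refine ⟨C * (‖u‖ ^ p + ‖φ‖ ^ p), q, by positivity, hq, fun t ht ht1 => ?_⟩
  have hi : ∀ t : ℝ, Integrable fun z => |quot s p u z + t * quot s p φ z| ^ p := fun t => by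
    refine (u + t • φ).integrable_quot_rpow.congr ?_
    filter_upwards [quot_add_smul u φ t] with z hz
    rw [hz]
  have hi2 : Integrable fun z => |quot s p u z + t * quot s p φ z| ^ p +
    |quot s p u z + -t * quot s p φ z| ^ p := (hi t).add (hi _)
  rw [norm_rpow_add_smul, norm_rpow_add_smul, norm_rpow_eq u, norm_rpow_eq φ,
    ← integral_add (hi t) (hi _), ← integral_const_mul,
    ← integral_sub hi2 (u.integrable_quot_rpow.const_mul 2),
    ← integral_add u.integrable_quot_rpow φ.integrable_quot_rpow, mul_right_comm,
    ← integral_const_mul]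
  refine integral_mono (hi2.sub (u.integrable_quot_rpow.const_mul 2))
    ((u.integrable_quot_rpow.add φ.integrable_quot_rpow).const_mul _) fun z => ?_
  simpa only [neg_mul, ← sub_eq_add_neg] using h (quot s p u z) (quot s p φ z) t ht ht1

/-- The Brezis–Lieb splitting of the Gagliardo norm. -/
theorem tendsto_norm_rpow_sub {u : ℕ → X0 Ω s p} {v : X0 Ω s p} {M : ℝ}
    (hM : ∀ n, ‖u n - v‖ ≤ M) (h : ∀ᵐ x, Tendsto (fun n => u n x) atTop (𝓝 (v x))) :
    Tendsto (fun n => ‖u n‖ ^ p - ‖u n - v‖ ^ p) atTop (𝓝 (‖v‖ ^ p)) := by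
  have hp0 : 0 < p := zero_lt_one.trans hp.out
  have hc : Continuous fun a : ℝ => |a| ^ p := continuous_abs.rpow_const fun _ => Or.inr hp0.le
  have hsub : ∀ n, (fun z => |quot s p (u n - v : X0 Ω s p) z| ^ p) =ᵐ[volume]
      fun z => |quot s p (u n) z - quot s p v z| ^ p := fun n => by
    filter_upwards [quot_coe_sub (u n) v] with z hz
    rw [hz]
  have hi : ∀ n, Integrable fun z => |quot s p (u n) z - quot s p v z| ^ p := fun n =>
    (u n - v).integrable_quot_rpow.congr (hsub n)
  have hn : ∀ n, ‖u n - v‖ ^ p = ∫ z, |quot s p (u n) z - quot s p v z| ^ p := fun n => by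
    rw [norm_rpow_eq]; exact integral_congr_ae (hsub n)
  have hbl := tendsto_integral_brezis_lieb (μ := (volume : Measure (Eu N × Eu N))) hc hc
    (fun a => by positivity) (by simp [Real.zero_rpow hp0.ne']) (by simp [Real.zero_rpow hp0.ne'])
    (fun ε hε => exists_abs_rpow_sub_le hp0 hε) (fun n => (u n).aesm_quot) v.aesm_quot
    v.integrable_quot_rpow hi (M := M ^ p) (fun n => by
      rw [← hn]; exact Real.rpow_le_rpow (norm_nonneg _) (hM n) hp0.le) (tendsto_quot s p h)
  rw [tendsto_iff_dist_tendsto_zero]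
  refine squeeze_zero (fun n => dist_nonneg) (fun n => ?_) hbl
  have hi2 : Integrable fun z => |quot s p (u n) z| ^ p - |quot s p (u n) z - quot s p v z| ^ p :=
    (u n).integrable_quot_rpow.sub (hi n)
  rw [Real.dist_eq, hn, norm_rpow_eq (u n), norm_rpow_eq v,
    ← integral_sub (u n).integrable_quot_rpow (hi n),
    ← integral_sub hi2 v.integrable_quot_rpow]
  exact abs_integral_le_integral_abs

/-- Bounded sequences that converge to `0` a.e. converge weakly to `0`. -/
theorem tendsto_dual_of_ae {z : ℕ → X0 Ω s p} {M : ℝ} (hM : ∀ n, ‖z n‖ ≤ M)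
    (h : ∀ᵐ x, Tendsto (fun n => z n x) atTop (𝓝 0)) (f : StrongDual ℝ (X0 Ω s p)) :
    Tendsto (fun n => f (z n)) atTop (𝓝 0) := by
  have hp1 : 1 < p := hp.out
  have hp0 : 0 < p := zero_lt_one.trans hp1
  have hM0 : 0 ≤ M := (norm_nonneg _).trans (hM 0)
  have key : ∀ f : StrongDual ℝ (X0 Ω s p), ∀ c : ℝ, 0 < c → ∀ᶠ n in atTop, f (z n) < c := by
    intro f c hc
    by_contra hcon
    have hfr : ∃ᶠ n in atTop, c ≤ f (z n) := by
      simpa [Filter.Frequently] using hcon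
    have hind : ∀ m : ℕ, ∃ y : X0 Ω s p, c * m ≤ f y ∧ ‖y‖ ^ p ≤ m * (M ^ p + 1) := by
      intro m
      induction m with
      | zero => exact ⟨0, by simp, by simp [Real.zero_rpow hp0.ne']⟩
      | succ m ih =>
        obtain ⟨y, hy1, hy2⟩ := ih
        have hbl := tendsto_norm_rpow_sub (u := fun n => y + z n) (v := y) (M := M)
          (fun n => by simpa using hM n) (by
            have hall : ∀ᵐ x, ∀ n, (y + z n : X0 Ω s p) x = y x + z n x :=
              ae_all_iff.2 fun n => coe_add y (z n)
            filter_upwards [h, hall] with x hx hx2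
            simp only [hx2]
            simpa using hx.const_add (y x))
        have hev := hbl.eventually_le_const (show ‖y‖ ^ p < ‖y‖ ^ p + 1 by linarith)
        obtain ⟨n, hn1, hn2⟩ := (hfr.and_eventually hev).exists
        refine ⟨y + z n, ?_, ?_⟩
        · rw [map_add]; push_cast; linarith
        · rw [add_sub_cancel_left] at hn2
          have := Real.rpow_le_rpow (norm_nonneg _) (hM n) hp0.le
          push_cast
          linarith
    have hcontra : ∀ m : ℕ, 0 < m → (m : ℝ) ^ (p - 1) ≤ (‖f‖ / c) ^ p * (M ^ p + 1) := by
      intro m hm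
      have hm' : (0 : ℝ) < m := by exact_mod_cast hm
      obtain ⟨y, hy1, hy2⟩ := hind m
      have h1 : (m : ℝ) ≤ ‖f‖ / c * ‖y‖ := by
        rw [div_mul_eq_mul_div, le_div_iff₀ hc, mul_comm]
        exact hy1.trans ((le_abs_self _).trans (f.le_opNorm y))
      have h2 : (m : ℝ) ^ p ≤ (‖f‖ / c) ^ p * (m * (M ^ p + 1)) := by
        calc (m : ℝ) ^ p ≤ (‖f‖ / c * ‖y‖) ^ p := Real.rpow_le_rpow hm'.le h1 hp0.le
          _ = (‖f‖ / c) ^ p * ‖y‖ ^ p := Real.mul_rpow (by positivity) (norm_nonneg _)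
          _ ≤ _ := by gcongr
      rw [Real.rpow_sub_one hm'.ne', div_le_iff₀ hm']
      linarith
    have hlim : Tendsto (fun m : ℕ => (m : ℝ) ^ (p - 1)) atTop atTop :=
      (tendsto_rpow_atTop (by linarith)).comp tendsto_natCast_atTop_atTop
    obtain ⟨m, hm1, hm2⟩ := ((hlim.eventually_gt_atTop _).and (eventually_gt_atTop 0)).exists
    exact absurd (hcontra m hm2) (not_le.2 hm1)
  refine tendsto_order.2 ⟨fun a ha => ?_, fun a ha => key f a ha⟩
  filter_upwards [key (-f) (-a) (by linarith)] with n hn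
  simp at hn
  linarith

/-- Lower semicontinuity of the Gagliardo norm under a.e. convergence. -/
theorem exists_of_tendsto_ae {u : ℕ → X0 Ω s p} {R : ℝ} (hR : ∀ n, ‖u n‖ ≤ R)
    {g : Eu N → ℝ} (hg : AEStronglyMeasurable g volume)
    (hgL : MemLp g (ENNReal.ofReal p) (volume.restrict Ω))
    (h : ∀ᵐ x, Tendsto (fun n => u n x) atTop (𝓝 (g x))) :
    ∃ v : X0 Ω s p, v =ᵐ[volume] g ∧ ‖v‖ ≤ R := by
  have hp0 : 0 < p := zero_lt_one.trans hp.out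
  have hR0 : 0 ≤ R := (norm_nonneg _).trans (hR 0)
  have hc := AEEqFun.coeFn_mk g hg
  have hF := integrable_of_tendsto_of_integral_le (μ := (volume : Measure (Eu N × Eu N)))
    (f := fun n z => |quot s p (u n) z| ^ p) (g := fun z => |quot s p g z| ^ p) (K := R ^ p)
    (fun n => (u n).integrable_quot_rpow) (fun n z => by positivity)
    (fun n => by rw [← norm_rpow_eq]; exact Real.rpow_le_rpow (norm_nonneg _) (hR n) hp0.le)
    (by filter_upwards [tendsto_quot s p h] with z hz
        exact hz.abs.rpow_const (Or.inr hp0.le))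
  simp only [← Real.norm_eq_abs, norm_quot_rpow hp.out] at hF
  have hmem : AEEqFun.mk g hg ∈ X0Submodule Ω s p := by
    refine ⟨?_, ?_, ?_⟩
    · exact (memLp_congr_ae (ae_restrict_of_ae hc)).2 hgL
    · filter_upwards [hc, h, ae_all_iff.2 fun n => (u n).2.2.1] with x h1 h2 h3 hx
      rw [h1]
      refine tendsto_nhds_unique h2 ?_
      have : (fun n => u n x) = fun _ => 0 := funext fun n => h3 n hx
      rw [this]
      exact tendsto_const_nhds
    · exact hF.1.congr (gagliardoIntegrand_congr s p hc.symm)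
  let v : X0 Ω s p := ⟨AEEqFun.mk g hg, hmem⟩
  refine ⟨v, hc, ?_⟩
  rw [norm_def, one_div]
  refine (Real.rpow_inv_le_iff_of_pos (gagliardo_nonneg _ _ _) hR0 hp0).2
    (le_trans (le_of_eq ?_) hF.2)
  exact integral_congr_ae (gagliardoIntegrand_congr s p hc)

end X0

theorem sobolevConst_nonneg (N : ℕ) (s p : ℝ) : 0 ≤ sobolevConst N s p := by
  refine Real.sInf_nonneg ?_
  rintro q ⟨u, -, -, -, rfl⟩
  exact div_nonneg (gagliardo_nonneg _ _ _)
    (Real.rpow_nonneg (integral_nonneg fun x => by positivity) _)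

theorem sobolevConst_mul_le {N : ℕ} {s p : ℝ} {u : Eu N →ₘ[volume] ℝ} (hu : u ≠ 0)
    (h1 : MemLp u (ENNReal.ofReal (critExp N s p)) volume)
    (h2 : Integrable (gagliardoIntegrand s p u)) :
    sobolevConst N s p * (∫ x, |u x| ^ critExp N s p) ^ (p / critExp N s p) ≤ gagliardo s p u := by
  have hI : 0 ≤ (∫ x, |u x| ^ critExp N s p) ^ (p / critExp N s p) :=
    Real.rpow_nonneg (integral_nonneg fun x => by positivity) _
  have hle : sobolevConst N s p ≤
      gagliardo s p u / (∫ x, |u x| ^ critExp N s p) ^ (p / critExp N s p) := by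
    refine csInf_le ⟨0, ?_⟩ ⟨u, hu, h1, h2, rfl⟩
    rintro q ⟨u, -, -, -, rfl⟩
    exact div_nonneg (gagliardo_nonneg _ _ _)
      (Real.rpow_nonneg (integral_nonneg fun x => by positivity) _)
  rcases hI.eq_or_lt with h0 | h0
  · rw [← h0, mul_zero]; exact gagliardo_nonneg _ _ _
  · rwa [le_div_iff₀ h0] at hle

/-- The Sobolev inequality for `X_{0,s,p}(Ω)`, in terms of the best constant. -/
theorem X0.sobolev {N : ℕ} {Ω : Set (Eu N)} (hΩ : Bornology.IsBounded Ω) {s p : ℝ}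
    [hp : Fact (1 < p)] (hP : 0 < critExp N s p) (hS : 0 < sobolevConst N s p) (u : X0 Ω s p) :
    Integrable (fun x => |u x| ^ critExp N s p) ∧
      ∫ x, |u x| ^ critExp N s p ≤ (‖u‖ ^ p / sobolevConst N s p) ^ (critExp N s p / p) := by
  have hp0 : 0 < p := zero_lt_one.trans hp.out
  set P := critExp N s p with hPdef
  set S := sobolevConst N s p with hSdef
  set T : ℕ → Eu N → ℝ := fun k x => max (min (u x) k) (-(k : ℝ)) with hT
  have hTm : ∀ k, Measurable (T k) := fun k =>
    (u.measurable.min measurable_const).max measurable_const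
  have hTle : ∀ k x, |T k x| ≤ k := fun k x => by
    have : (0 : ℝ) ≤ k := Nat.cast_nonneg k
    rw [abs_le]
    exact ⟨le_max_right _ _, max_le (min_le_right _ _) (by linarith)⟩
  have hT0 : ∀ k x, u x = 0 → T k x = 0 := fun k x h => by
    have : (0 : ℝ) ≤ k := Nat.cast_nonneg k
    simp [hT, h, this]
  have hTlip : ∀ k x y, |T k x - T k y| ≤ |u x - u y| := fun k x y =>
    (abs_max_sub_max_le_abs _ _ _).trans ((abs_min_sub_min_le_max _ _ _ _).trans (by simp))
  have hTi : ∀ k, Integrable fun x => |T k x| ^ P := by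
    intro k
    obtain ⟨R, hR⟩ := hΩ.subset_closedBall 0
    have hb : Integrable ((Metric.closedBall (0 : Eu N) R).indicator fun _ => (k : ℝ) ^ P) :=
      (integrable_indicator_iff Metric.isClosed_closedBall.measurableSet).2
        (integrableOn_const measure_closedBall_lt_top.ne)
    refine hb.mono' (((hTm k).abs.pow_const P).aestronglyMeasurable) ?_
    filter_upwards [u.2.2.1] with x hx
    rw [Real.norm_of_nonneg (by positivity)]
    by_cases hxR : x ∈ Metric.closedBall (0 : Eu N) R
    · rw [indicator_of_mem hxR]
      exact Real.rpow_le_rpow (abs_nonneg _) (hTle k x) hP.le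
    · rw [indicator_of_notMem hxR, hT0 k x (hx fun h => hxR (hR h)), abs_zero,
        Real.zero_rpow hP.ne']
  refine integrable_of_tendsto_of_integral_le hTi (fun k x => by positivity) (fun k => ?_)
    (Eventually.of_forall fun x => ?_)
  · set w : Eu N →ₘ[volume] ℝ := AEEqFun.mk (T k) (hTm k).aestronglyMeasurable with hw
    have hc : ⇑w =ᵐ[volume] T k := AEEqFun.coeFn_mk _ _
    have hJ : ∫ x, |w x| ^ P = ∫ x, |T k x| ^ P :=
      integral_congr_ae (by filter_upwards [hc] with x hx; rw [hx])
    have hJ0 : 0 ≤ ∫ x, |T k x| ^ P := integral_nonneg fun x => by positivity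
    by_cases hw0 : w = 0
    · have : ∫ x, |w x| ^ P = 0 := by
        rw [hw0]
        refine (integral_congr_ae (g := fun _ => (0 : ℝ)) ?_).trans (integral_zero _ _)
        filter_upwards [AEEqFun.coeFn_zero (α := Eu N) (β := ℝ) (μ := volume)] with x hx
        rw [hx]; simp [Real.zero_rpow hP.ne']
      rw [← hJ, this]
      positivity
    · have hlip : ∀ z, gagliardoIntegrand s p (T k) z ≤ gagliardoIntegrand s p u z := fun z => by
        simp only [gagliardoIntegrand]
        exact div_le_div_of_nonneg_right (Real.rpow_le_rpow (abs_nonneg _) (hTlip k _ _) hp0.le)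
          (Real.rpow_nonneg (norm_nonneg _) _)
      have hgm : Measurable (gagliardoIntegrand s p (T k)) := by
        have := hTm k
        unfold gagliardoIntegrand
        fun_prop
      have hgi : Integrable (gagliardoIntegrand s p (T k)) :=
        u.integrable_gagliardoIntegrand.mono' hgm.aestronglyMeasurable
          (Eventually.of_forall fun z => by
            rw [Real.norm_of_nonneg (gagliardoIntegrand_nonneg _ _ _ _)]; exact hlip z)
      have hmem : MemLp w (ENNReal.ofReal P) volume := by
        rw [memLp_congr_ae hc, ← integrable_norm_rpow_iff (hTm k).aestronglyMeasurable
          (by simpa using hP) ENNReal.ofReal_ne_top, ENNReal.toReal_ofReal hP.le]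
        exact hTi k
      have hs := sobolevConst_mul_le hw0 hmem (hgi.congr (gagliardoIntegrand_congr s p hc.symm))
      have hg : gagliardo s p w ≤ ‖u‖ ^ p := by
        rw [X0.norm_rpow_eq_gagliardo]
        refine (integral_congr_ae (gagliardoIntegrand_congr s p hc)).trans_le ?_
        exact integral_mono hgi u.integrable_gagliardoIntegrand hlip
      rw [← hPdef, ← hSdef, hJ] at hs
      have h3 : (∫ x, |T k x| ^ P) ^ (p / P) ≤ ‖u‖ ^ p / S := by
        rw [le_div_iff₀ hS, mul_comm]; exact hs.trans hg
      have h4 := Real.rpow_le_rpow (Real.rpow_nonneg hJ0 _) h3 (show 0 ≤ P / p by positivity)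
      rwa [← Real.rpow_mul hJ0, div_mul_div_cancel₀ hP.ne', div_self hp0.ne', Real.rpow_one] at h4
  · refine tendsto_const_nhds.congr' ?_
    obtain ⟨n, hn⟩ := exists_nat_ge |u x|
    filter_upwards [eventually_ge_atTop n] with k hk
    have hk' : (n : ℝ) ≤ k := by exact_mod_cast hk
    have h1 := abs_le.1 (hn.trans hk')
    simp only [hT]
    rw [min_eq_left h1.2, max_eq_left h1.1]

end FracSystem

namespace FracSystem

open Filter Topology Set

/-- The cells of the cubic grid of mesh `δ`. -/
def gridCell {N : ℕ} (δ : ℝ) (c : Fin N → ℤ) : Set (Eu N) := {x | ∀ i, ⌊x i / δ⌋ = c i}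

theorem measurableSet_gridCell {N : ℕ} (δ : ℝ) (c : Fin N → ℤ) :
    MeasurableSet (gridCell δ c) := by
  rw [gridCell, ofPred_forall]
  refine MeasurableSet.iInter fun i => ?_
  have hm : Measurable fun x : Eu N => ⌊x i / δ⌋ := by fun_prop
  exact hm (measurableSet_singleton (c i))

theorem volume_gridCell {N : ℕ} {δ : ℝ} (hδ : 0 < δ) (c : Fin N → ℤ) :
    volume (gridCell δ c) = ENNReal.ofReal (δ ^ N) := by
  have h : gridCell δ c = (WithLp.ofLp : Eu N → Fin N → ℝ) ⁻¹'
      Set.pi univ fun i => Ico (c i * δ) ((c i + 1) * δ) := by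
    ext x
    simp only [gridCell, mem_ofPred_eq, mem_preimage, mem_univ_pi, mem_Ico, Int.floor_eq_iff]
    refine forall_congr' fun i => ?_
    rw [le_div_iff₀ hδ, div_lt_iff₀ hδ]
  rw [h, (PiLp.volume_preserving_ofLp (Fin N)).measure_preimage
    (MeasurableSet.univ_pi fun i => measurableSet_Ico).nullMeasurableSet, Real.volume_pi_Ico]
  simp only [← sub_mul, add_sub_cancel_left, one_mul, Finset.prod_const, Finset.card_univ,
    Fintype.card_fin, ENNReal.ofReal_pow hδ.le]

theorem norm_sub_le_of_mem_gridCell {N : ℕ} {δ : ℝ} (hδ : 0 < δ) {c : Fin N → ℤ} {x y : Eu N}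
    (hx : x ∈ gridCell δ c) (hy : y ∈ gridCell δ c) : ‖x - y‖ ≤ √N * δ := by
  rw [EuclideanSpace.norm_eq]
  have h : ∀ i, ‖(x - y) i‖ ^ 2 ≤ δ ^ 2 := by
    intro i
    have h1 := Int.floor_eq_iff.1 (hx i)
    have h2 := Int.floor_eq_iff.1 (hy i)
    rw [le_div_iff₀ hδ, div_lt_iff₀ hδ] at h1 h2
    rw [Real.norm_eq_abs, sq_abs, PiLp.sub_apply]
    exact sq_le_sq' (by linarith [h1.1, h2.2]) (by linarith [h1.2, h2.1])
  calc √(∑ i, ‖(x - y) i‖ ^ 2) ≤ √(∑ _i : Fin N, δ ^ 2) :=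
        Real.sqrt_le_sqrt (Finset.sum_le_sum fun i _ => h i)
    _ = √N * δ := by
        rw [Finset.sum_const, Finset.card_univ, Fintype.card_fin, nsmul_eq_mul,
          Real.sqrt_mul (Nat.cast_nonneg N), Real.sqrt_sq hδ.le]

theorem exists_finset_gridCell_cover {N : ℕ} {Ω : Set (Eu N)} (hΩ : Bornology.IsBounded Ω)
    {δ : ℝ} (hδ : 0 < δ) : ∃ F : Finset (Fin N → ℤ), Ω ⊆ ⋃ c ∈ F, gridCell δ c := by
  obtain ⟨R, hR⟩ := hΩ.subset_closedBall 0
  refine ⟨Fintype.piFinset fun _ => Finset.Icc ⌊-R / δ⌋ ⌊R / δ⌋, fun x hx => ?_⟩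
  have hxR : ‖x‖ ≤ R := by simpa using hR hx
  refine mem_biUnion (x := fun i => ⌊x i / δ⌋) ?_ (fun i => rfl)
  simp only [Finset.mem_coe, Fintype.mem_piFinset, Finset.mem_Icc]
  intro i
  have hi := abs_le.1 ((Real.norm_eq_abs (x i)) ▸ (PiLp.norm_apply_le x i).trans hxR)
  constructor <;> refine Int.floor_mono ?_ <;> gcongr
  · exact hi.1
  · exact hi.2

theorem pairwise_disjoint_gridCell {N : ℕ} (δ : ℝ) (c d : Fin N → ℤ) (h : c ≠ d) :
    Disjoint (gridCell δ c) (gridCell δ d) :=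
  Set.disjoint_left.2 fun _ hx hy => h (funext fun i => (hx i).symm.trans (hy i))

namespace X0

variable {N : ℕ} {Ω : Set (Eu N)} {s p : ℝ} [hp : Fact (1 < p)]

theorem memLp_volume (hΩ : MeasurableSet Ω) (u : X0 Ω s p) : MemLp u (ENNReal.ofReal p) volume := by
  have h := (memLp_indicator_iff_restrict hΩ).2 u.2.1
  refine (memLp_congr_ae ?_).1 h
  filter_upwards [u.2.2.1] with x hx
  by_cases hxΩ : x ∈ Ω
  · rw [indicator_of_mem hxΩ]; rfl
  · rw [indicator_of_notMem hxΩ]; exact (hx hxΩ).symm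

theorem integrable_rpow (hΩ : MeasurableSet Ω) (u : X0 Ω s p) :
    Integrable fun x => |u x| ^ p := by
  have hp0 : 0 < p := zero_lt_one.trans hp.out
  have h := (u.memLp_volume hΩ).integrable_norm_rpow (by simpa using hp0) ENNReal.ofReal_ne_top
  simpa [ENNReal.toReal_ofReal hp0.le] using h

theorem integrableOn (hΩ : MeasurableSet Ω) (u : X0 Ω s p) {Q : Set (Eu N)}
    (hQ : volume Q ≠ ⊤) : IntegrableOn u Q := by
  have : IsFiniteMeasure (volume.restrict Q) := ⟨by simpa using hQ.lt_top⟩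
  exact (((u.memLp_volume hΩ).restrict Q).mono_exponent
    (by simpa using hp.out.le)).integrable le_rfl

/-- Poincaré inequality on a set of small diameter. -/
theorem setIntegral_rpow_le (hΩ : MeasurableSet Ω) (hs : 0 < s) (w : X0 Ω s p) {Q : Set (Eu N)}
    (hQ : MeasurableSet Q) {V D : ℝ} (hV : 0 < V) (hQV : volume Q = ENNReal.ofReal V)
    (hD : 0 ≤ D) (hQD : ∀ x ∈ Q, ∀ y ∈ Q, ‖x - y‖ ≤ D) :
    ∫ x in Q, |w x| ^ p ≤ 2 ^ p * (D ^ ((N : ℝ) + s * p) / V *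
      (∫ z in Q ×ˢ Q, gagliardoIntegrand s p w z) + V * |V⁻¹ * ∫ x in Q, w x| ^ p) := by
  have hp1 : 1 < p := hp.out
  have hp0 : 0 < p := zero_lt_one.trans hp1
  have hNs : 0 < (N : ℝ) + s * p := by positivity
  have hQt : volume Q ≠ ⊤ := by rw [hQV]; exact ENNReal.ofReal_ne_top
  have hVr : volume.real Q = V := by rw [measureReal_def, hQV, ENNReal.toReal_ofReal hV.le]
  have hfin : IsFiniteMeasure (volume.restrict Q) := ⟨by simpa using hQt.lt_top⟩
  have hne : NeZero (volume.restrict Q) := ⟨by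
    rw [Ne, Measure.restrict_eq_zero, hQV, ENNReal.ofReal_eq_zero]; linarith⟩
  have hwm := w.measurable
  have hwi : IntegrableOn w Q := w.integrableOn hΩ hQt
  have hwp : IntegrableOn (fun x => |w x| ^ p) Q := (w.integrable_rpow hΩ).integrableOn
  have hdom : ∀ x ∈ Q, ∀ y ∈ Q, |w x - w y| ^ p ≤
      D ^ ((N : ℝ) + s * p) * gagliardoIntegrand s p w (x, y) := by
    intro x hx y hy
    rcases eq_or_ne x y with rfl | hxy
    · simp only [sub_self, abs_zero, Real.zero_rpow hp0.ne']
      exact mul_nonneg (by positivity) (gagliardoIntegrand_nonneg _ _ _ _)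
    · have hn : 0 < ‖x - y‖ := norm_pos_iff.2 (sub_ne_zero.2 hxy)
      have h1 : 0 < ‖x - y‖ ^ ((N : ℝ) + s * p) := Real.rpow_pos_of_pos hn _
      simp only [gagliardoIntegrand]
      rw [mul_div_assoc', le_div_iff₀ h1, mul_comm]
      gcongr
      exact hQD x hx y hy
  have hgi : IntegrableOn (gagliardoIntegrand s p w) (Q ×ˢ Q) volume :=
    w.integrable_gagliardoIntegrand.integrableOn
  have hpi : IntegrableOn (fun z : Eu N × Eu N => |w z.1 - w z.2| ^ p) (Q ×ˢ Q) volume := by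
    refine (hgi.const_mul (D ^ ((N : ℝ) + s * p))).mono' ?_ ?_
    · have : Measurable fun z : Eu N × Eu N => |w z.1 - w z.2| ^ p := by fun_prop
      exact this.aestronglyMeasurable
    · filter_upwards [ae_restrict_mem (hQ.prod hQ)] with z hz
      rw [Real.norm_of_nonneg (by positivity)]
      exact hdom z.1 hz.1 z.2 hz.2
  set m := V⁻¹ * ∫ x in Q, w x with hm
  have hconv : ConvexOn ℝ univ fun x : ℝ => |x| ^ p := by
    refine ⟨convex_univ, fun x _ y _ a b ha hb hab => ?_⟩
    have h1 := (convexOn_rpow hp1.le).2 (mem_Ici.2 (abs_nonneg x)) (mem_Ici.2 (abs_nonneg y))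
      ha hb hab
    refine le_trans (Real.rpow_le_rpow (abs_nonneg _) ?_ hp0.le) h1
    simp only [smul_eq_mul]
    refine (abs_add_le _ _).trans (le_of_eq ?_)
    rw [abs_mul, abs_mul, abs_of_nonneg ha, abs_of_nonneg hb]
  have hjensen : ∀ x ∈ Q, |w x - m| ^ p ≤ V⁻¹ * ∫ y in Q, |w x - w y| ^ p := by
    intro x hx
    have hfi : Integrable (fun y => w x - w y) (volume.restrict Q) :=
      (integrable_const _).sub hwi
    have hgi : Integrable ((fun x : ℝ => |x| ^ p) ∘ fun y => w x - w y) (volume.restrict Q) := by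
      have h := integrable_mul_abs_add_abs_rpow (μ := volume.restrict Q) (a := fun _ => (1 : ℝ))
        (u := fun _ => w x) (φ := w) aestronglyMeasurable_const aestronglyMeasurable_const
        hwm.aestronglyMeasurable (fun _ => zero_le_one) hp0.le (by simp)
        (by simpa [IntegrableOn] using hwp)
      refine h.mono' ?_ (Eventually.of_forall fun y => ?_)
      · have : Measurable fun y => |w x - w y| ^ p := by fun_prop
        exact this.aestronglyMeasurable
      · simp only [Function.comp, one_mul]
        rw [Real.norm_of_nonneg (by positivity)]
        gcongr
        exact abs_sub _ _
    have h := hconv.map_average_le (μ := volume.restrict Q)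
      (continuous_abs.rpow_const fun _ => Or.inr hp0.le).continuousOn isClosed_univ
      (Eventually.of_forall fun _ => mem_univ _) hfi hgi
    rw [setAverage_eq, setAverage_eq, hVr, smul_eq_mul, smul_eq_mul,
      integral_sub (integrable_const _) hwi, setIntegral_const, hVr, smul_eq_mul, mul_sub,
      inv_mul_cancel_left₀ hV.ne'] at h
    exact h
  have hwm2 : IntegrableOn (fun x => V⁻¹ * ∫ y in Q, |w x - w y| ^ p) Q := by
    have := hpi
    rw [IntegrableOn, Measure.volume_eq_prod, ← Measure.prod_restrict] at this
    exact this.integral_prod_left.const_mul _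
  have hwmi : IntegrableOn (fun x => |w x - m| ^ p) Q := by
    refine hwm2.mono' ?_ ?_
    · have : Measurable fun x => |w x - m| ^ p := by fun_prop
      exact this.aestronglyMeasurable
    · filter_upwards [ae_restrict_mem hQ] with x hx
      rw [Real.norm_of_nonneg (by positivity)]
      exact hjensen x hx
  have hcell : ∫ x in Q, |w x - m| ^ p ≤
      D ^ ((N : ℝ) + s * p) / V * ∫ z in Q ×ˢ Q, gagliardoIntegrand s p w z := by
    calc ∫ x in Q, |w x - m| ^ p ≤ ∫ x in Q, V⁻¹ * ∫ y in Q, |w x - w y| ^ p :=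
          setIntegral_mono_on hwmi hwm2 hQ hjensen
      _ = V⁻¹ * ∫ z in Q ×ˢ Q, |w z.1 - w z.2| ^ p := by
          rw [integral_const_mul, Measure.volume_eq_prod, setIntegral_prod _ hpi]
      _ ≤ V⁻¹ * ∫ z in Q ×ˢ Q, D ^ ((N : ℝ) + s * p) * gagliardoIntegrand s p w z := by
          refine mul_le_mul_of_nonneg_left ?_ (by positivity)
          exact setIntegral_mono_on hpi (hgi.const_mul _) (hQ.prod hQ)
            fun z hz => hdom z.1 hz.1 z.2 hz.2
      _ = _ := by rw [integral_const_mul]; ring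
  calc ∫ x in Q, |w x| ^ p ≤ ∫ x in Q, 2 ^ p * (|w x - m| ^ p + |m| ^ p) := by
        refine setIntegral_mono_on hwp ((hwmi.add (integrable_const _)).const_mul _) hQ
          fun x _ => ?_
        refine le_trans ?_ (add_rpow_le_two_rpow_mul (abs_nonneg _) (abs_nonneg _) hp0.le)
        gcongr
        simpa using abs_add_le (w x - m) m
    _ = 2 ^ p * ((∫ x in Q, |w x - m| ^ p) + V * |m| ^ p) := by
        rw [integral_const_mul, integral_add hwmi (integrable_const _), setIntegral_const, hVr,
          smul_eq_mul]
    _ ≤ _ := by gcongr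

/-- The `L^p` norm is controlled by finitely many cell integrals up to a small multiple of the
Gagliardo norm. -/
theorem integral_rpow_le_grid (hΩ : MeasurableSet Ω) (hs : 0 < s) {δ : ℝ} (hδ : 0 < δ)
    {F : Finset (Fin N → ℤ)} (hF : Ω ⊆ ⋃ c ∈ F, gridCell δ c) (w : X0 Ω s p) :
    ∫ x, |w x| ^ p ≤ 2 ^ p * (√N ^ ((N : ℝ) + s * p) * δ ^ (s * p) * ‖w‖ ^ p +
      ∑ c ∈ F, δ ^ N * |(δ ^ N)⁻¹ * ∫ x in gridCell δ c, w x| ^ p) := by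
  have hp0 : 0 < p := zero_lt_one.trans hp.out
  have hδN : 0 < δ ^ N := by positivity
  have hwp := w.integrable_rpow hΩ
  have h1 : ∫ x, |w x| ^ p ≤ ∑ c ∈ F, ∫ x in gridCell δ c, |w x| ^ p := by
    rw [← integral_biUnion_finset F (fun c _ => measurableSet_gridCell δ c)
      (fun c _ d _ h => pairwise_disjoint_gridCell δ c d h) (fun c _ => hwp.integrableOn)]
    refine le_of_eq (setIntegral_eq_integral_of_ae_compl_eq_zero ?_).symm
    filter_upwards [w.2.2.1] with x hx hxF
    have : w x = 0 := hx fun h => hxF (hF h)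
    simp [this, Real.zero_rpow hp0.ne']
  have h2 : ∑ c ∈ F, ∫ z in gridCell δ c ×ˢ gridCell δ c, gagliardoIntegrand s p w z ≤
      ‖w‖ ^ p := by
    rw [← integral_biUnion_finset F
      (fun c _ => (measurableSet_gridCell δ c).prod (measurableSet_gridCell δ c))
      (fun c _ d _ h => Set.disjoint_left.2 fun z hz hz' =>
        Set.disjoint_left.1 (pairwise_disjoint_gridCell δ c d h) hz.1 hz'.1)
      (fun c _ => w.integrable_gagliardoIntegrand.integrableOn), norm_rpow_eq_gagliardo]
    exact setIntegral_le_integral w.integrable_gagliardoIntegrand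
      (Eventually.of_forall (gagliardoIntegrand_nonneg s p w))
  refine h1.trans ?_
  calc ∑ c ∈ F, ∫ x in gridCell δ c, |w x| ^ p
      ≤ ∑ c ∈ F, 2 ^ p * ((√N * δ) ^ ((N : ℝ) + s * p) / δ ^ N *
        (∫ z in gridCell δ c ×ˢ gridCell δ c, gagliardoIntegrand s p w z) +
        δ ^ N * |(δ ^ N)⁻¹ * ∫ x in gridCell δ c, w x| ^ p) :=
        Finset.sum_le_sum fun c _ => w.setIntegral_rpow_le hΩ hs (measurableSet_gridCell δ c) hδN
          (volume_gridCell hδ c) (by positivity)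
          fun x hx y hy => norm_sub_le_of_mem_gridCell hδ hx hy
    _ = 2 ^ p * ((√N * δ) ^ ((N : ℝ) + s * p) / δ ^ N *
        (∑ c ∈ F, ∫ z in gridCell δ c ×ˢ gridCell δ c, gagliardoIntegrand s p w z) +
        ∑ c ∈ F, δ ^ N * |(δ ^ N)⁻¹ * ∫ x in gridCell δ c, w x| ^ p) := by
        rw [← Finset.mul_sum, Finset.sum_add_distrib, ← Finset.mul_sum]
    _ ≤ 2 ^ p * ((√N * δ) ^ ((N : ℝ) + s * p) / δ ^ N * ‖w‖ ^ p +
        ∑ c ∈ F, δ ^ N * |(δ ^ N)⁻¹ * ∫ x in gridCell δ c, w x| ^ p) := by gcongr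
    _ = _ := by
        congr 4
        rw [Real.mul_rpow (Real.sqrt_nonneg _) hδ.le, Real.rpow_add hδ, Real.rpow_natCast]
        field_simp

/-- Rellich–Kondrachov: bounded sequences have subsequences that converge a.e. to a function of
`L^p`. -/
theorem exists_subseq_tendsto_ae (hΩ : MeasurableSet Ω) (hΩb : Bornology.IsBounded Ω)
    (hs : 0 < s) (hP : 1 ≤ critExp N s p) (hS : 0 < sobolevConst N s p) {u : ℕ → X0 Ω s p}
    {M : ℝ} (hM : ∀ n, ‖u n‖ ≤ M) :
    ∃ k : ℕ → ℕ, StrictMono k ∧ ∃ g : Eu N → ℝ, MemLp g (ENNReal.ofReal p) volume ∧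
      ∀ᵐ x, Tendsto (fun n => u (k n) x) atTop (𝓝 (g x)) := by
  have hp1 : 1 < p := hp.out
  have hp0 : 0 < p := zero_lt_one.trans hp1
  have hM0 : 0 ≤ M := (norm_nonneg _).trans (hM 0)
  have hfact : Fact (1 ≤ ENNReal.ofReal p) := ⟨by simpa using hp1.le⟩
  set P := critExp N s p with hPdef
  have hP0 : 0 < P := by linarith
  set δ : ℕ → ℝ := fun k => 1 / ((k : ℝ) + 1) with hδdef
  have hδ : ∀ k, 0 < δ k := fun k => by positivity
  set B : ℝ := (M ^ p / sobolevConst N s p) ^ (P / p) with hB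
  have hvol : ∀ k (c : Fin N → ℤ), volume (gridCell (δ k) c) ≠ ⊤ := fun k c => by
    rw [volume_gridCell (hδ k)]; exact ENNReal.ofReal_ne_top
  set a : ℕ → (ℕ × (Fin N → ℤ)) → ℝ := fun n j => ∫ x in gridCell (δ j.1) j.2, u n x with ha
  have hbound : ∀ n j, |a n j| ≤ volume.real (gridCell (δ j.1) j.2) + B := by
    intro n j
    set Q := gridCell (δ j.1) j.2 with hQ
    have hQt : volume Q ≠ ⊤ := hvol _ _
    obtain ⟨hi, hle⟩ := (u n).sobolev hΩb hP0 hS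
    have h1 : ∫ x, |u n x| ^ P ≤ B := hle.trans (by
      have := Real.rpow_le_rpow (norm_nonneg _) (hM n) hp0.le
      rw [hB]; gcongr)
    calc |a n j| ≤ ∫ x in Q, |u n x| := abs_integral_le_integral_abs
      _ ≤ ∫ x in Q, (1 + |u n x| ^ P) := by
          refine integral_mono ((u n).integrableOn hΩ hQt).abs
            ((integrableOn_const hQt).add hi.integrableOn) fun x => ?_
          rcases le_total |u n x| 1 with h | h
          · have : 0 ≤ |u n x| ^ P := by positivity
            simp only; linarith
          · have := Real.rpow_le_rpow_of_exponent_le h hP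
            rw [Real.rpow_one] at this
            simp only; linarith
      _ = volume.real Q + ∫ x in Q, |u n x| ^ P := by
          rw [integral_add (integrableOn_const hQt).integrable hi.integrableOn.integrable,
            setIntegral_const, smul_eq_mul, mul_one]
      _ ≤ _ := by
          have := setIntegral_le_integral (s := Q) hi
            (Eventually.of_forall fun x => Real.rpow_nonneg (abs_nonneg (u n x)) P)
          linarith
  have hcomp : IsCompact (Set.pi univ fun j : ℕ × (Fin N → ℤ) =>
      Metric.closedBall (0 : ℝ) (volume.real (gridCell (δ j.1) j.2) + B)) :=
    isCompact_univ_pi fun j => isCompact_closedBall _ _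
  obtain ⟨l, -, k, hk, hlim⟩ := hcomp.tendsto_subseq (x := a) fun n j _ => by
    rw [mem_closedBall_zero_iff, Real.norm_eq_abs]; exact hbound n j
  have hcoord : ∀ j, Tendsto (fun n => a (k n) j) atTop (𝓝 (l j)) := fun j =>
    (tendsto_pi_nhds.1 hlim) j
  set v : ℕ → X0 Ω s p := fun n => u (k n) with hv
  -- the integrals of the differences tend to zero
  have hcau : ∀ ε : ℝ, 0 < ε → ∃ n₀, ∀ m ≥ n₀, ∀ n ≥ n₀, ∫ x, |v m x - v n x| ^ p < ε := by
    intro ε hε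
    have hsp : 0 < s * p := by positivity
    have hδ0 : Tendsto δ atTop (𝓝 0) := tendsto_one_div_add_atTop_nhds_zero_nat
    have ht1 : Tendsto (fun j => 2 ^ p * (√N ^ ((N : ℝ) + s * p) * δ j ^ (s * p) * (2 * M) ^ p))
        atTop (𝓝 0) := by
      have := ((((hδ0.rpow_const (Or.inr hsp.le)).const_mul (√N ^ ((N : ℝ) + s * p))).mul_const
        ((2 * M) ^ p)).const_mul (2 ^ p))
      simpa [Real.zero_rpow hsp.ne'] using this
    obtain ⟨j, hj⟩ := (ht1.eventually_lt_const (half_pos hε)).exists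
    obtain ⟨F, hF⟩ := exists_finset_gridCell_cover hΩb (hδ j)
    have ht2 : Tendsto (fun q : ℕ × ℕ => 2 ^ p * ∑ c ∈ F, δ j ^ N *
        |(δ j ^ N)⁻¹ * (a (k q.1) (j, c) - a (k q.2) (j, c))| ^ p) (atTop ×ˢ atTop) (𝓝 0) := by
      have h0 : ∀ c ∈ F, Tendsto (fun q : ℕ × ℕ => δ j ^ N *
          |(δ j ^ N)⁻¹ * (a (k q.1) (j, c) - a (k q.2) (j, c))| ^ p) (atTop ×ˢ atTop) (𝓝 0) := by
        intro c _
        have h1 := ((hcoord (j, c)).comp tendsto_fst).sub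
          ((hcoord (j, c)).comp (tendsto_snd (f := (atTop : Filter ℕ)) (g := (atTop : Filter ℕ))))
        have h2 := (((h1.const_mul (δ j ^ N)⁻¹).abs.rpow_const (p := p) (Or.inr hp0.le)).const_mul
          (δ j ^ N))
        simpa [Real.zero_rpow hp0.ne'] using h2
      simpa using (tendsto_finsetSum F h0).const_mul (2 ^ p)
    have hev := ht2.eventually_lt_const (half_pos hε)
    rw [prod_atTop_atTop_eq, eventually_atTop_prod_self] at hev
    obtain ⟨n₀, hn₀⟩ := hev
    refine ⟨n₀, fun m hm n hn => ?_⟩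
    have h1 := (v m - v n).integral_rpow_le_grid hΩ hs (hδ j) hF
    have h2 : ∫ x, |(v m - v n : X0 Ω s p) x| ^ p = ∫ x, |v m x - v n x| ^ p := by
      refine integral_congr_ae ?_
      filter_upwards [coe_sub (v m) (v n)] with x hx
      rw [hx]
    have h3 : ∀ c, ∫ x in gridCell (δ j) c, (v m - v n : X0 Ω s p) x =
        a (k m) (j, c) - a (k n) (j, c) := by
      intro c
      simp only [ha]
      rw [← integral_sub ((u (k m)).integrableOn hΩ (hvol j c))
        ((u (k n)).integrableOn hΩ (hvol j c))]
      exact integral_congr_ae (ae_restrict_of_ae (coe_sub (v m) (v n)))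
    have h4 : ‖v m - v n‖ ^ p ≤ (2 * M) ^ p :=
      Real.rpow_le_rpow (norm_nonneg _) ((norm_sub_le _ _).trans
        (by linarith [hM (k m), hM (k n)])) hp0.le
    simp only [h2, h3] at h1
    have h5 := hn₀ m n hm hn
    have h6 : 2 ^ p * (√N ^ ((N : ℝ) + s * p) * δ j ^ (s * p) * ‖v m - v n‖ ^ p) ≤
        2 ^ p * (√N ^ ((N : ℝ) + s * p) * δ j ^ (s * p) * (2 * M) ^ p) := by
      have := (hδ j).le
      gcongr
    rw [mul_add] at h1
    linarith
  have hmem : ∀ n, MemLp (v n) (ENNReal.ofReal p) volume := fun n => (v n).memLp_volume hΩ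
  have hC : CauchySeq fun n => (hmem n).toLp := by
    rw [Metric.cauchySeq_iff]
    intro ε hε
    obtain ⟨n₀, hn₀⟩ := hcau (ε ^ p) (by positivity)
    refine ⟨n₀, fun m hm n hn => ?_⟩
    have hsub := (hmem m).sub (hmem n)
    rw [dist_eq_norm, ← MemLp.toLp_sub, Lp.norm_toLp, hsub.eLpNorm_eq_integral_rpow_norm
      (by simpa using hp0) ENNReal.ofReal_ne_top, ENNReal.toReal_ofReal hp0.le,
      ENNReal.toReal_ofReal (Real.rpow_nonneg (integral_nonneg fun x => by positivity) _)]
    exact (Real.rpow_inv_lt_iff_of_pos (integral_nonneg fun x => by positivity) hε.le hp0).2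
      (hn₀ m hm n hn)
  obtain ⟨G, hG⟩ := cauchySeq_tendsto_of_complete hC
  obtain ⟨k', hk', hae⟩ := (tendstoInMeasure_of_tendsto_Lp hG).exists_seq_tendsto_ae
  refine ⟨k ∘ k', hk.comp hk', G, Lp.memLp G, ?_⟩
  filter_upwards [hae, ae_all_iff.2 fun n => (hmem n).coeFn_toLp] with x hx hx2
  simp only [hx2] at hx
  exact hx

end X0

end FracSystem

namespace FracSystem

open Filter Topology Set

/-- Young's inequality for `∫ |u|^A |v|^B` when `A / P + B / Q = 1`. -/
theorem integral_abs_rpow_mul_abs_rpow_le {Y : Type*} [MeasurableSpace Y] {μ : Measure Y}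
    {u v : Y → ℝ} (hu : AEStronglyMeasurable u μ) (hv : AEStronglyMeasurable v μ)
    {A B P Q : ℝ} (hA : 0 < A) (hB : 0 < B) (hP : 0 < P) (hQ : 0 < Q) (hAB : A / P + B / Q = 1)
    (hui : Integrable (fun x => |u x| ^ P) μ) (hvi : Integrable (fun x => |v x| ^ Q) μ) :
    Integrable (fun x => |u x| ^ A * |v x| ^ B) μ ∧
      ∫ x, |u x| ^ A * |v x| ^ B ∂μ ≤ A / P * ∫ x, |u x| ^ P ∂μ + B / Q * ∫ x, |v x| ^ Q ∂μ := by
  have hpt : ∀ x, |u x| ^ A * |v x| ^ B ≤ A / P * |u x| ^ P + B / Q * |v x| ^ Q := fun x => by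
    have h := Real.geom_mean_le_arith_mean2_weighted (w₁ := A / P) (w₂ := B / Q) (by positivity)
      (by positivity) (Real.rpow_nonneg (abs_nonneg (u x)) P)
      (Real.rpow_nonneg (abs_nonneg (v x)) Q) hAB
    rwa [← Real.rpow_mul (abs_nonneg _), ← Real.rpow_mul (abs_nonneg _), mul_div_cancel₀ _ hP.ne',
      mul_div_cancel₀ _ hQ.ne'] at h
  have hi : Integrable (fun x => |u x| ^ A * |v x| ^ B) μ := by
    refine ((hui.const_mul (A / P)).add (hvi.const_mul (B / Q))).mono' ?_
      (Eventually.of_forall fun x => ?_)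
    · exact ((hu.aemeasurable.abs.pow_const A).mul
        (hv.aemeasurable.abs.pow_const B)).aestronglyMeasurable
    · rw [Real.norm_of_nonneg (by positivity)]
      exact hpt x
  refine ⟨hi, ?_⟩
  rw [← integral_const_mul, ← integral_const_mul,
    ← integral_add (hui.const_mul _) (hvi.const_mul _)]
  exact integral_mono hi ((hui.const_mul _).add (hvi.const_mul _)) hpt

/-- Along a ray, the energy at a zero of its derivative exceeds the energy at any earlier time at
which the derivative is positive. -/
theorem ray_le {p₁ p₂ r a b c L t₁ : ℝ} (hp₁ : 1 < p₁) (hp₂ : 1 < p₂) (h₁ : p₁ < r) (h₂ : p₂ < r)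
    (ha : 0 ≤ a) (hb : 0 ≤ b) (ht₁ : 0 < t₁) (ht₁' : t₁ ≤ 1)
    (hpos : 0 ≤ a * t₁ ^ (p₁ - 1) + b * t₁ ^ (p₂ - 1) - r * c * t₁ ^ (r - 1) - L)
    (hzero : a + b - r * c - L = 0) :
    a / p₁ * t₁ ^ p₁ + b / p₂ * t₁ ^ p₂ - c * t₁ ^ r - t₁ * L ≤ a / p₁ + b / p₂ - c - L := by
  have hr : 1 < r := by linarith
  set q := r - 1 with hq
  have hq0 : 0 < q := by linarith
  set G : ℝ → ℝ := fun x => a * x ^ ((p₁ - 1) / q) + b * x ^ ((p₂ - 1) / q) + -(r * c * x) + -L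
    with hG
  have hconc : ConcaveOn ℝ (Ici 0) G := by
    have h1 := (Real.concaveOn_rpow (p := (p₁ - 1) / q) (div_nonneg (by linarith) hq0.le)
      ((div_le_one hq0).2 (by linarith))).smul ha
    have h2 := (Real.concaveOn_rpow (p := (p₂ - 1) / q) (div_nonneg (by linarith) hq0.le)
      ((div_le_one hq0).2 (by linarith))).smul hb
    have h3 : ConcaveOn ℝ (Ici (0 : ℝ)) fun x : ℝ => -(r * c * x) :=
      ⟨convex_Ici 0, fun x _ y _ s t _ _ _ => le_of_eq (by simp only [smul_eq_mul]; ring)⟩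
    exact ((h1.add h2).add h3).add_const (-L)
  have hGt : ∀ t, 0 < t → G (t ^ q) =
      a * t ^ (p₁ - 1) + b * t ^ (p₂ - 1) - r * c * t ^ (r - 1) - L := fun t ht => by
    simp only [hG, ← Real.rpow_mul ht.le, mul_div_cancel₀ _ hq0.ne', ← hq]
    ring
  have hG1 : G 1 = 0 := by simp only [hG, Real.one_rpow]; linarith
  have hnn : ∀ t ∈ Icc t₁ 1, 0 ≤ a * t ^ (p₁ - 1) + b * t ^ (p₂ - 1) - r * c * t ^ (r - 1) - L := by
    intro t ht
    have ht0 : 0 < t := ht₁.trans_le ht.1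
    rw [← hGt t ht0]
    have hx1 : t₁ ^ q ≤ t ^ q := Real.rpow_le_rpow ht₁.le ht.1 hq0.le
    have hx2 : t ^ q ≤ 1 := Real.rpow_le_one ht0.le ht.2 hq0.le
    have := hconc.min_le_of_mem_Icc (mem_Ici.2 (Real.rpow_nonneg ht₁.le q))
      (mem_Ici.2 zero_le_one) ⟨hx1, hx2⟩
    refine le_trans (le_min ?_ ?_) this
    · rw [hGt t₁ ht₁]; exact hpos
    · rw [hG1]
  have hder : ∀ t ∈ Icc t₁ 1, HasDerivAt
      (fun t : ℝ => a / p₁ * t ^ p₁ + b / p₂ * t ^ p₂ - c * t ^ r - t * L)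
      (a * t ^ (p₁ - 1) + b * t ^ (p₂ - 1) - r * c * t ^ (r - 1) - L) t := by
    intro t ht
    have ht0 : t ≠ 0 := (ht₁.trans_le ht.1).ne'
    have h := ((((Real.hasDerivAt_rpow_const (p := p₁) (Or.inl ht0)).const_mul (a / p₁)).add
      ((Real.hasDerivAt_rpow_const (p := p₂) (Or.inl ht0)).const_mul (b / p₂))).sub
      ((Real.hasDerivAt_rpow_const (p := r) (Or.inl ht0)).const_mul c)).sub
      ((hasDerivAt_id t).mul_const L)
    refine h.congr_deriv ?_
    have : p₁ ≠ 0 := by linarith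
    have : p₂ ≠ 0 := by linarith
    field_simp
  have hmono := monotoneOn_of_deriv_nonneg (convex_Icc t₁ 1)
    (f := fun t : ℝ => a / p₁ * t ^ p₁ + b / p₂ * t ^ p₂ - c * t ^ r - t * L)
    (fun t ht => (hder t ht).continuousAt.continuousWithinAt)
    (fun t ht => (hder t (interior_subset ht)).differentiableAt.differentiableWithinAt)
    (fun t ht => by
      rw [(hder t (interior_subset ht)).deriv]; exact hnn t (interior_subset ht))
  have := hmono (left_mem_Icc.2 ht₁') (right_mem_Icc.2 ht₁') ht₁'
  simpa using this

namespace X0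

variable {N : ℕ} {Ω : Set (Eu N)} {s p : ℝ} [hp : Fact (1 < p)]

theorem fracPLaplace_smul_right (u φ : X0 Ω s p) (c : ℝ) :
    fracPLaplace u (c • φ) = c * fracPLaplace u φ := by
  rw [fracPLaplace_eq, fracPLaplace_eq, ← integral_const_mul]
  refine integral_congr_ae ?_
  filter_upwards [quot_congr s p (coe_smul c φ)] with z hz
  rw [hz]
  simp only [quot]
  ring

theorem integral_critExp_le (hΩ : Bornology.IsBounded Ω) (hP : 0 < critExp N s p) {σ : ℝ}
    (hσ : 0 < σ) (hσS : σ ≤ sobolevConst N s p ^ (critExp N s p / p)) (u : X0 Ω s p) :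
    Integrable (fun x => |u x| ^ critExp N s p) ∧
      ∫ x, |u x| ^ critExp N s p ≤ σ⁻¹ * ‖u‖ ^ critExp N s p := by
  have hp0 : 0 < p := zero_lt_one.trans hp.out
  have hS : 0 < sobolevConst N s p := by
    refine (sobolevConst_nonneg N s p).lt_of_ne fun h => ?_
    rw [← h, Real.zero_rpow (by positivity)] at hσS
    linarith
  obtain ⟨h1, h2⟩ := u.sobolev hΩ hP hS
  refine ⟨h1, h2.trans ?_⟩
  rw [Real.div_rpow (by positivity) hS.le, ← Real.rpow_mul (norm_nonneg _),
    mul_div_cancel₀ _ hp0.ne', div_eq_inv_mul]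
  gcongr

/-- An interior minimizer of the energy in one variable satisfies its Euler–Lagrange equation, and
the possibly singular lower order term can be tested. -/
theorem euler_lagrange (u : X0 Ω s p) (f : StrongDual ℝ (X0 Ω s p)) {a : Eu N → ℝ}
    (ha : Measurable a) (ha0 : ∀ x, 0 ≤ a x) {A : ℝ} (hA : 0 < A)
    (hint : ∀ ψ : X0 Ω s p, IntegrableOn (fun x => a x * |ψ x| ^ A) Ω) {r : ℝ} (hr : 0 < r)
    (hmin : ∀ ψ : X0 Ω s p, ‖ψ‖ ≤ r →
      A / p * ‖u‖ ^ p - (∫ x in Ω, a x * |u x| ^ A) - A * f u ≤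
      A / p * ‖u + ψ‖ ^ p - (∫ x in Ω, a x * |(u + ψ) x| ^ A) - A * f (u + ψ))
    (φ : X0 Ω s p) :
    IntegrableOn (fun x => a x * (u x * |u x| ^ (A - 2) * φ x)) Ω ∧
      fracPLaplace u φ = (∫ x in Ω, a x * (u x * |u x| ^ (A - 2) * φ x)) + f φ := by
  have hp0 : 0 < p := zero_lt_one.trans hp.out
  have key : ∀ φ : X0 Ω s p, ‖φ‖ ≤ r →
      IntegrableOn (fun x => a x * (u x * |u x| ^ (A - 2) * φ x)) Ω ∧
      fracPLaplace u φ = (∫ x in Ω, a x * (u x * |u x| ^ (A - 2) * φ x)) + f φ := by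
    intro φ hφ
    have hco : ∀ t : ℝ, (fun x => a x * |(u + t • φ : X0 Ω s p) x| ^ A) =ᵐ[volume.restrict Ω]
        fun x => a x * |u x + t * φ x| ^ A := fun t => by
      filter_upwards [ae_restrict_of_ae (coe_add_smul u φ t)] with x hx
      rw [hx]
    have hit : ∀ t : ℝ, IntegrableOn (fun x => a x * |u x + t * φ x| ^ A) Ω := fun t =>
      (hint (u + t • φ)).congr (hco t)
    have hm : ∀ t : ℝ, |t| ≤ 1 →
        A / p * ‖u‖ ^ p - (∫ x in Ω, a x * |u x| ^ A) - A * f u ≤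
        A / p * ‖u + t • φ‖ ^ p - (∫ x in Ω, a x * |u x + t * φ x| ^ A) - A * f (u + t • φ) := by
      intro t ht
      rw [← integral_congr_ae (hco t)]
      refine hmin _ ?_
      rw [norm_smul, Real.norm_eq_abs]
      exact (mul_le_of_le_one_left (norm_nonneg _) ht).trans hφ
    obtain ⟨C, q, hC, hq, hsd⟩ := exists_norm_second_difference_le u φ
    have hh : ∀ t : ℝ, 0 < t → t ≤ 1 →
        ∫ x in Ω, a x * (|u x + t * φ x| ^ A + |u x - t * φ x| ^ A - 2 * |u x| ^ A) ≤
          A / p * C * t ^ q := by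
      intro t ht ht1
      have hi2 : IntegrableOn (fun x => a x * |u x + t * φ x| ^ A + a x * |u x + -t * φ x| ^ A) Ω :=
        (hit t).add (hit (-t))
      have e1 : ∫ x in Ω, a x * (|u x + t * φ x| ^ A + |u x - t * φ x| ^ A - 2 * |u x| ^ A) =
          (∫ x in Ω, a x * |u x + t * φ x| ^ A) + (∫ x in Ω, a x * |u x + -t * φ x| ^ A) -
            2 * ∫ x in Ω, a x * |u x| ^ A := by
        rw [← integral_add (hit t) (hit (-t)), ← integral_const_mul,
          ← integral_sub hi2 ((hint u).const_mul 2)]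
        refine integral_congr_ae (Eventually.of_forall fun x => ?_)
        simp only [neg_mul, ← sub_eq_add_neg]
        ring
      have h1 := hm t (by rwa [abs_of_pos ht])
      have h2 := hm (-t) (by rwa [abs_neg, abs_of_pos ht])
      have h3 := mul_le_mul_of_nonneg_left (hsd t ht ht1) (show 0 ≤ A / p by positivity)
      rw [map_add, map_smul, smul_eq_mul] at h1 h2
      rw [e1]
      linarith
    obtain ⟨hi, hd⟩ := hasDerivAt_integral_mul_abs_rpow_of_second_difference_le
      (μ := volume.restrict Ω) ha u.measurable φ.measurable ha0 hA (hint u) (hint φ)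
      (by positivity) hq hh
    refine ⟨hi, ?_⟩
    have hf : HasDerivAt (fun t : ℝ => A * f (u + t • φ)) (A * f φ) 0 := by
      have h1 : HasDerivAt (fun t : ℝ => A * (f u + t * f φ)) (A * f φ) 0 := by
        simpa using (((hasDerivAt_id (0 : ℝ)).mul_const (f φ)).const_add (f u)).const_mul A
      simpa only [map_add, map_smul, smul_eq_mul] using h1
    have hJ := (((hasDerivAt_norm_rpow u φ).const_mul (A / p)).sub hd).sub hf
    have hloc : IsLocalMin (fun t : ℝ => A / p * ‖u + t • φ‖ ^ p -
        (∫ x in Ω, a x * |u x + t * φ x| ^ A) - A * f (u + t • φ)) 0 := by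
      filter_upwards [Icc_mem_nhds (show (-1 : ℝ) < 0 by norm_num) (show (0 : ℝ) < 1 by norm_num)]
        with t ht
      simpa using hm t (abs_le.2 ht)
    have h0 := hloc.hasDerivAt_eq_zero hJ
    have h1 : A / p * (p * fracPLaplace u φ) = A * fracPLaplace u φ := by field_simp
    rw [h1] at h0
    have h2 : A * (fracPLaplace u φ - (∫ x in Ω, a x * (u x * |u x| ^ (A - 2) * φ x)) - f φ) = 0 := by
      linarith
    have := (mul_eq_zero.1 h2).resolve_left hA.ne'
    linarith
  set τ := r / (‖φ‖ + 1) with hτ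
  have hτ0 : 0 < τ := by positivity
  obtain ⟨h1, h2⟩ := key (τ • φ) (by
    rw [norm_smul, Real.norm_of_nonneg hτ0.le, hτ, div_mul_eq_mul_div, div_le_iff₀ (by positivity)]
    nlinarith [norm_nonneg φ])
  have hco : (fun x => a x * (u x * |u x| ^ (A - 2) * (τ • φ : X0 Ω s p) x))
      =ᵐ[volume.restrict Ω] fun x => τ * (a x * (u x * |u x| ^ (A - 2) * φ x)) := by
    filter_upwards [ae_restrict_of_ae (coe_smul τ φ)] with x hx
    rw [hx]; ring
  refine ⟨?_, ?_⟩
  · have h3 := (h1.congr hco).const_mul τ⁻¹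
    simpa [← mul_assoc, hτ0.ne', IntegrableOn] using h3
  · rw [integral_congr_ae hco, integral_const_mul, fracPLaplace_smul_right, map_smul, smul_eq_mul,
      ← mul_add] at h2
    exact mul_left_cancel₀ hτ0.ne' h2

end X0

section

variable {N : ℕ} {Ω : Set (Eu N)} {s₁ s₂ p₁ p₂ : ℝ} [hp₁ : Fact (1 < p₁)] [hp₂ : Fact (1 < p₂)]

/-- The coupling term `∫_Ω |u|^(α+1) |v|^(β+1)`. -/
noncomputable def coupling (α β : ℝ) (w : X0 Ω s₁ p₁ × X0 Ω s₂ p₂) : ℝ :=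
  ∫ x in Ω, |w.1 x| ^ (α + 1) * |w.2 x| ^ (β + 1)

variable {α β : ℝ} {f₁ : StrongDual ℝ (X0 Ω s₁ p₁)} {f₂ : StrongDual ℝ (X0 Ω s₂ p₂)}

theorem energy_eq (w : X0 Ω s₁ p₁ × X0 Ω s₂ p₂) : energy α β f₁ f₂ w =
    (α + 1) / p₁ * ‖w.1‖ ^ p₁ + (β + 1) / p₂ * ‖w.2‖ ^ p₂ - coupling α β w
      - (α + 1) * f₁ w.1 - (β + 1) * f₂ w.2 := rfl

theorem coupling_smul (hα : 0 < α + 1) (hβ : 0 < β + 1) {t : ℝ} (ht : 0 ≤ t)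
    (w : X0 Ω s₁ p₁ × X0 Ω s₂ p₂) :
    coupling α β (t • w) = t ^ (α + β + 2) * coupling α β w := by
  rw [coupling, coupling, ← integral_const_mul]
  refine integral_congr_ae ?_
  filter_upwards [ae_restrict_of_ae (X0.coe_smul t w.1), ae_restrict_of_ae (X0.coe_smul t w.2)]
    with x h1 h2
  rw [Prod.smul_fst, Prod.smul_snd, h1, h2, abs_mul, abs_mul, abs_of_nonneg ht,
    Real.mul_rpow ht (abs_nonneg _), Real.mul_rpow ht (abs_nonneg _),
    show α + β + 2 = (α + 1) + (β + 1) by ring, Real.rpow_add_of_nonneg ht hα.le hβ.le]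
  ring

theorem energy_smul (hα : 0 < α + 1) (hβ : 0 < β + 1) {t : ℝ} (ht : 0 ≤ t)
    (w : X0 Ω s₁ p₁ × X0 Ω s₂ p₂) : energy α β f₁ f₂ (t • w) =
    (α + 1) * ‖w.1‖ ^ p₁ / p₁ * t ^ p₁ + (β + 1) * ‖w.2‖ ^ p₂ / p₂ * t ^ p₂
      - coupling α β w * t ^ (α + β + 2) - t * ((α + 1) * f₁ w.1 + (β + 1) * f₂ w.2) := by
  rw [energy_eq, coupling_smul hα hβ ht, Prod.smul_fst, Prod.smul_snd, norm_smul, norm_smul,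
    Real.norm_of_nonneg ht, Real.mul_rpow ht (norm_nonneg _), Real.mul_rpow ht (norm_nonneg _),
    map_smul, map_smul, smul_eq_mul, smul_eq_mul]
  ring

/-- The derivative of the energy at `w` in the direction `w`. -/
noncomputable def radialDeriv (α β : ℝ) (f₁ : StrongDual ℝ (X0 Ω s₁ p₁))
    (f₂ : StrongDual ℝ (X0 Ω s₂ p₂)) (w : X0 Ω s₁ p₁ × X0 Ω s₂ p₂) : ℝ :=
  (α + 1) * ‖w.1‖ ^ p₁ + (β + 1) * ‖w.2‖ ^ p₂ - (α + β + 2) * coupling α β w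
    - ((α + 1) * f₁ w.1 + (β + 1) * f₂ w.2)

theorem hasDerivAt_energy_smul (hα : 0 < α + 1) (hβ : 0 < β + 1)
    (w : X0 Ω s₁ p₁ × X0 Ω s₂ p₂) :
    HasDerivAt (fun t : ℝ => energy α β f₁ f₂ (t • w)) (radialDeriv α β f₁ f₂ w) 1 := by
  have h1 : (1 : ℝ) ≠ 0 := one_ne_zero
  have hp₁0 : p₁ ≠ 0 := (zero_lt_one.trans hp₁.out).ne'
  have hp₂0 : p₂ ≠ 0 := (zero_lt_one.trans hp₂.out).ne'
  have h := ((((Real.hasDerivAt_rpow_const (p := p₁) (Or.inl h1)).const_mul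
    ((α + 1) * ‖w.1‖ ^ p₁ / p₁)).add
    ((Real.hasDerivAt_rpow_const (p := p₂) (Or.inl h1)).const_mul
    ((β + 1) * ‖w.2‖ ^ p₂ / p₂))).sub
    ((Real.hasDerivAt_rpow_const (p := α + β + 2) (Or.inl h1)).const_mul (coupling α β w))).sub
    ((hasDerivAt_id (1 : ℝ)).mul_const ((α + 1) * f₁ w.1 + (β + 1) * f₂ w.2))
  refine (h.congr_of_eventuallyEq ?_).congr_deriv ?_
  · filter_upwards [lt_mem_nhds zero_lt_one] with t ht
    exact energy_smul hα hβ (le_of_lt ht) w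
  · simp only [Real.one_rpow, radialDeriv]
    field_simp

theorem hasLineDerivAt_energy (hα : 0 < α + 1) (hβ : 0 < β + 1)
    (w : X0 Ω s₁ p₁ × X0 Ω s₂ p₂) :
    HasLineDerivAt ℝ (energy α β f₁ f₂) (radialDeriv α β f₁ f₂ w) w w := by
  have h1 : HasDerivAt (fun t : ℝ => 1 + t) 1 0 := by
    simpa using (hasDerivAt_id (0 : ℝ)).const_add 1
  have h2 := hasDerivAt_energy_smul (f₁ := f₁) (f₂ := f₂) hα hβ w
  rw [show (1 : ℝ) = 1 + 0 by ring] at h2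
  have h3 := h2.comp (0 : ℝ) h1
  rw [mul_one] at h3
  have h4 : ((fun t : ℝ => energy α β f₁ f₂ (t • w)) ∘ fun t : ℝ => 1 + t) =
      fun t => energy α β f₁ f₂ (w + t • w) := by
    funext t
    simp only [Function.comp, add_smul, one_smul]
  rw [h4] at h3
  exact h3

theorem mem_nehari_iff (hα : 0 < α + 1) (hβ : 0 < β + 1) (w : X0 Ω s₁ p₁ × X0 Ω s₂ p₂) :
    w ∈ nehari α β f₁ f₂ ↔ w ≠ 0 ∧ radialDeriv α β f₁ f₂ w = 0 := by
  refine and_congr_right fun _ => ⟨fun h => ?_, fun h => ?_⟩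
  · exact HasDerivAt.unique (hasLineDerivAt_energy hα hβ w) h
  · have := hasLineDerivAt_energy (f₁ := f₁) (f₂ := f₂) hα hβ w
    rwa [h] at this

theorem radialDeriv_smul (hα : 0 < α + 1) (hβ : 0 < β + 1) {t : ℝ} (ht : 0 < t)
    (w : X0 Ω s₁ p₁ × X0 Ω s₂ p₂) : radialDeriv α β f₁ f₂ (t • w) =
    t * ((α + 1) * ‖w.1‖ ^ p₁ * t ^ (p₁ - 1) + (β + 1) * ‖w.2‖ ^ p₂ * t ^ (p₂ - 1)
      - (α + β + 2) * coupling α β w * t ^ (α + β + 2 - 1)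
      - ((α + 1) * f₁ w.1 + (β + 1) * f₂ w.2)) := by
  rw [radialDeriv, coupling_smul hα hβ ht.le, Prod.smul_fst, Prod.smul_snd, norm_smul, norm_smul,
    Real.norm_of_nonneg ht.le, Real.mul_rpow ht.le (norm_nonneg _),
    Real.mul_rpow ht.le (norm_nonneg _), map_smul, map_smul, smul_eq_mul, smul_eq_mul,
    Real.rpow_sub_one ht.ne', Real.rpow_sub_one ht.ne', Real.rpow_sub_one ht.ne']
  field_simp

end

end FracSystem

namespace FracSystem

open Filter Topology Set

theorem rpow_le_rpow_mul_rpow_sub {x R p P : ℝ} (hx : 0 ≤ x) (hxR : x ≤ R) (hp : 0 < p)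
    (hpP : p < P) : x ^ P ≤ x ^ p * R ^ (P - p) := by
  calc x ^ P = x ^ p * x ^ (P - p) := by
        rw [← Real.rpow_add_of_nonneg hx hp.le (by linarith), add_sub_cancel]
    _ ≤ _ := by
        have : x ^ (P - p) ≤ R ^ (P - p) := Real.rpow_le_rpow hx hxR (by linarith)
        gcongr

section

variable {N : ℕ} {Ω : Set (Eu N)} {s₁ s₂ p₁ p₂ : ℝ} [hp₁ : Fact (1 < p₁)] [hp₂ : Fact (1 < p₂)]
  {α β : ℝ} {f₁ : StrongDual ℝ (X0 Ω s₁ p₁)} {f₂ : StrongDual ℝ (X0 Ω s₂ p₂)}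

theorem coupling_le (hΩb : Bornology.IsBounded Ω) (hα : 0 < α + 1) (hβ : 0 < β + 1)
    (hP : 0 < critExp N s₁ p₁) (hQ : 0 < critExp N s₂ p₂)
    (H1 : (α + 1) / critExp N s₁ p₁ + (β + 1) / critExp N s₂ p₂ = 1) {σ : ℝ} (hσ : 0 < σ)
    (hσ₁ : σ ≤ sobolevConst N s₁ p₁ ^ (critExp N s₁ p₁ / p₁))
    (hσ₂ : σ ≤ sobolevConst N s₂ p₂ ^ (critExp N s₂ p₂ / p₂)) (w : X0 Ω s₁ p₁ × X0 Ω s₂ p₂) :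
    IntegrableOn (fun x => |w.1 x| ^ (α + 1) * |w.2 x| ^ (β + 1)) Ω ∧
      coupling α β w ≤ σ⁻¹ * ((α + 1) / critExp N s₁ p₁ * ‖w.1‖ ^ critExp N s₁ p₁ +
        (β + 1) / critExp N s₂ p₂ * ‖w.2‖ ^ critExp N s₂ p₂) := by
  obtain ⟨hu, hu'⟩ := w.1.integral_critExp_le hΩb hP hσ hσ₁
  obtain ⟨hv, hv'⟩ := w.2.integral_critExp_le hΩb hQ hσ hσ₂
  obtain ⟨h1, h2⟩ := integral_abs_rpow_mul_abs_rpow_le (μ := volume.restrict Ω)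
    w.1.measurable.aestronglyMeasurable w.2.measurable.aestronglyMeasurable hα hβ hP hQ H1
    hu.integrableOn hv.integrableOn
  refine ⟨h1, h2.trans ?_⟩
  have h3 := setIntegral_le_integral (s := Ω) hu
    (Eventually.of_forall fun x => Real.rpow_nonneg (abs_nonneg (w.1 x)) _)
  have h4 := setIntegral_le_integral (s := Ω) hv
    (Eventually.of_forall fun x => Real.rpow_nonneg (abs_nonneg (w.2 x)) _)
  calc _ ≤ (α + 1) / critExp N s₁ p₁ * (σ⁻¹ * ‖w.1‖ ^ critExp N s₁ p₁) +
        (β + 1) / critExp N s₂ p₂ * (σ⁻¹ * ‖w.2‖ ^ critExp N s₂ p₂) := by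
        have h5 := h3.trans hu'
        have h6 := h4.trans hv'
        gcongr
    _ = _ := by ring

/-- The Brezis–Lieb splitting of the coupling term. -/
theorem tendsto_coupling_sub (hΩb : Bornology.IsBounded Ω) (hα : 0 < α + 1) (hβ : 0 < β + 1)
    (hP : 0 < critExp N s₁ p₁) (hQ : 0 < critExp N s₂ p₂)
    (H1 : (α + 1) / critExp N s₁ p₁ + (β + 1) / critExp N s₂ p₂ = 1) {σ : ℝ} (hσ : 0 < σ)
    (hσ₁ : σ ≤ sobolevConst N s₁ p₁ ^ (critExp N s₁ p₁ / p₁))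
    (hσ₂ : σ ≤ sobolevConst N s₂ p₂ ^ (critExp N s₂ p₂ / p₂))
    {u : ℕ → X0 Ω s₁ p₁ × X0 Ω s₂ p₂} {w : X0 Ω s₁ p₁ × X0 Ω s₂ p₂} {M₁ M₂ : ℝ}
    (hM₁ : ∀ n, ‖(u n - w).1‖ ≤ M₁) (hM₂ : ∀ n, ‖(u n - w).2‖ ≤ M₂)
    (h₁ : ∀ᵐ x, Tendsto (fun n => (u n).1 x) atTop (𝓝 (w.1 x)))
    (h₂ : ∀ᵐ x, Tendsto (fun n => (u n).2 x) atTop (𝓝 (w.2 x))) :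
    Tendsto (fun n => coupling α β (u n) - coupling α β (u n - w)) atTop (𝓝 (coupling α β w)) := by
  set P := critExp N s₁ p₁ with hPd
  set Q := critExp N s₂ p₂ with hQd
  have hcr : ∀ p : ℝ, 0 < p → Continuous fun a : ℝ => |a| ^ p := fun p hp =>
    continuous_abs.rpow_const fun _ => Or.inr hp.le
  have hint := fun w : X0 Ω s₁ p₁ × X0 Ω s₂ p₂ =>
    (coupling_le hΩb hα hβ hP hQ H1 hσ hσ₁ hσ₂ w).1
  have hPi := fun w : X0 Ω s₁ p₁ => w.integral_critExp_le hΩb hP hσ hσ₁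
  have hQi := fun w : X0 Ω s₂ p₂ => w.integral_critExp_le hΩb hQ hσ hσ₂
  have hs₁ : ∀ n, ∀ᵐ x ∂(volume.restrict Ω), (u n - w).1 x = (u n).1 x - w.1 x := fun n =>
    ae_restrict_of_ae (X0.coe_sub (u n).1 w.1)
  have hs₂ : ∀ n, ∀ᵐ x ∂(volume.restrict Ω), (u n - w).2 x = (u n).2 x - w.2 x := fun n =>
    ae_restrict_of_ae (X0.coe_sub (u n).2 w.2)
  have hci : ∀ n, (fun x => |(u n - w).1 x| ^ P + |(u n - w).2 x| ^ Q) =ᵐ[volume.restrict Ω]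
      fun x => |(u n).1 x - w.1 x| ^ P + |(u n).2 x - w.2 x| ^ Q := fun n => by
    filter_upwards [hs₁ n, hs₂ n] with x hx1 hx2
    rw [hx1, hx2]
  have hcj : ∀ n, (fun x => |(u n - w).1 x| ^ (α + 1) * |(u n - w).2 x| ^ (β + 1))
      =ᵐ[volume.restrict Ω]
      fun x => |(u n).1 x - w.1 x| ^ (α + 1) * |(u n).2 x - w.2 x| ^ (β + 1) := fun n => by
    filter_upwards [hs₁ n, hs₂ n] with x hx1 hx2
    rw [hx1, hx2]
  have hΦi : ∀ w : X0 Ω s₁ p₁ × X0 Ω s₂ p₂,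
      IntegrableOn (fun x => |w.1 x| ^ P + |w.2 x| ^ Q) Ω := fun w =>
    (hPi w.1).1.integrableOn.add (hQi w.2).1.integrableOn
  have hbl := tendsto_integral_brezis_lieb (μ := volume.restrict Ω) (E := ℝ × ℝ)
    (j := fun a => |a.1| ^ (α + 1) * |a.2| ^ (β + 1)) (Φ := fun a => |a.1| ^ P + |a.2| ^ Q)
    (((hcr _ hα).comp continuous_fst).mul ((hcr _ hβ).comp continuous_snd))
    (((hcr _ hP).comp continuous_fst).add ((hcr _ hQ).comp continuous_snd))
    (fun a => by positivity) (by simp [Real.zero_rpow hP.ne', Real.zero_rpow hQ.ne'])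
    (by simp [Real.zero_rpow hα.ne'])
    (fun ε hε => exists_abs_mul_rpow_sub_le hα hβ hP hQ H1 hε)
    (f := fun n x => ((u n).1 x, (u n).2 x)) (g := fun x => (w.1 x, w.2 x))
    (fun n => ((u n).1.measurable.prodMk (u n).2.measurable).aestronglyMeasurable)
    (w.1.measurable.prodMk w.2.measurable).aestronglyMeasurable (hΦi w)
    (fun n => (hΦi (u n - w)).congr (hci n)) (M := σ⁻¹ * M₁ ^ P + σ⁻¹ * M₂ ^ Q)
    (fun n => by
      refine (integral_congr_ae (hci n)).symm.trans_le ?_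
      rw [integral_add (hPi _).1.integrableOn (hQi _).1.integrableOn]
      have h3 := setIntegral_le_integral (s := Ω) (hPi (u n - w).1).1
        (Eventually.of_forall fun x => Real.rpow_nonneg (abs_nonneg ((u n - w).1 x)) _)
      have h4 := setIntegral_le_integral (s := Ω) (hQi (u n - w).2).1
        (Eventually.of_forall fun x => Real.rpow_nonneg (abs_nonneg ((u n - w).2 x)) _)
      have h5 : σ⁻¹ * ‖(u n - w).1‖ ^ P ≤ σ⁻¹ * M₁ ^ P := by
        have := Real.rpow_le_rpow (norm_nonneg _) (hM₁ n) hP.le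
        gcongr
      have h6 : σ⁻¹ * ‖(u n - w).2‖ ^ Q ≤ σ⁻¹ * M₂ ^ Q := by
        have := Real.rpow_le_rpow (norm_nonneg _) (hM₂ n) hQ.le
        gcongr
      exact add_le_add ((h3.trans (hPi _).2).trans h5) ((h4.trans (hQi _).2).trans h6))
    (by filter_upwards [ae_restrict_of_ae h₁, ae_restrict_of_ae h₂] with x hx1 hx2
        exact hx1.prodMk_nhds hx2)
  rw [tendsto_iff_dist_tendsto_zero]
  refine squeeze_zero (fun n => dist_nonneg) (fun n => ?_) hbl
  have hin : IntegrableOn (fun x => |(u n).1 x - w.1 x| ^ (α + 1) *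
      |(u n).2 x - w.2 x| ^ (β + 1)) Ω := (hint (u n - w)).congr (hcj n)
  have hi2 : IntegrableOn (fun x => |(u n).1 x| ^ (α + 1) * |(u n).2 x| ^ (β + 1) -
    |(u n).1 x - w.1 x| ^ (α + 1) * |(u n).2 x - w.2 x| ^ (β + 1)) Ω := (hint (u n)).sub hin
  have e : coupling α β (u n - w) = ∫ x in Ω, |(u n).1 x - w.1 x| ^ (α + 1) *
      |(u n).2 x - w.2 x| ^ (β + 1) := integral_congr_ae (hcj n)
  rw [Real.dist_eq, e, coupling, coupling, ← integral_sub (hint (u n)) hin,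
    ← integral_sub hi2 (hint w)]
  exact abs_integral_le_integral_abs

/-- The energy attains its minimum over a small product of balls. -/
theorem exists_isMinOn_energy (hΩ : MeasurableSet Ω) (hΩb : Bornology.IsBounded Ω)
    (hs₁ : 0 < s₁) (hs₂ : 0 < s₂) (hα : 0 < α + 1) (hβ : 0 < β + 1)
    (hP : p₁ < critExp N s₁ p₁) (hQ : p₂ < critExp N s₂ p₂)
    (H1 : (α + 1) / critExp N s₁ p₁ + (β + 1) / critExp N s₂ p₂ = 1) {σ : ℝ} (hσ : 0 < σ)
    (hσ₁ : σ ≤ sobolevConst N s₁ p₁ ^ (critExp N s₁ p₁ / p₁))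
    (hσ₂ : σ ≤ sobolevConst N s₂ p₂ ^ (critExp N s₂ p₂ / p₂))
    {R₁ R₂ : ℝ} (hR₁ : 0 ≤ R₁) (hR₂ : 0 ≤ R₂)
    (hRσ₁ : R₁ ^ (critExp N s₁ p₁ - p₁) < σ) (hRσ₂ : R₂ ^ (critExp N s₂ p₂ - p₂) < σ) :
    ∃ w : X0 Ω s₁ p₁ × X0 Ω s₂ p₂, ‖w.1‖ ≤ R₁ ∧ ‖w.2‖ ≤ R₂ ∧
      ∀ w' : X0 Ω s₁ p₁ × X0 Ω s₂ p₂, ‖w'.1‖ ≤ R₁ → ‖w'.2‖ ≤ R₂ →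
        energy α β f₁ f₂ w ≤ energy α β f₁ f₂ w' := by
  have hp₁1 : 1 < p₁ := hp₁.out
  have hp₂1 : 1 < p₂ := hp₂.out
  have hp₁0 : 0 < p₁ := by linarith
  have hp₂0 : 0 < p₂ := by linarith
  set P := critExp N s₁ p₁ with hPd
  set Q := critExp N s₂ p₂ with hQd
  have hP0 : 0 < P := by linarith
  have hQ0 : 0 < Q := by linarith
  have hS : ∀ S r : ℝ, 0 ≤ S → 0 < r → σ ≤ S ^ r → 0 < S := by
    intro S r h0 hr h
    refine h0.lt_of_ne fun h' => ?_
    rw [← h', Real.zero_rpow hr.ne'] at h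
    linarith
  have hS₁ := hS _ _ (sobolevConst_nonneg N s₁ p₁) (by positivity) hσ₁
  have hS₂ := hS _ _ (sobolevConst_nonneg N s₂ p₂) (by positivity) hσ₂
  have hcle := fun w : X0 Ω s₁ p₁ × X0 Ω s₂ p₂ =>
    (coupling_le hΩb hα hβ hP0 hQ0 H1 hσ hσ₁ hσ₂ w).2
  set T : Set ℝ := {e | ∃ w : X0 Ω s₁ p₁ × X0 Ω s₂ p₂, ‖w.1‖ ≤ R₁ ∧ ‖w.2‖ ≤ R₂ ∧
    e = energy α β f₁ f₂ w} with hT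
  have hTne : T.Nonempty := ⟨_, 0, by simpa using hR₁, by simpa using hR₂, rfl⟩
  have hTbd : BddBelow T := by
    refine ⟨-(σ⁻¹ * ((α + 1) / P * R₁ ^ P + (β + 1) / Q * R₂ ^ Q)) - (α + 1) * (‖f₁‖ * R₁)
      - (β + 1) * (‖f₂‖ * R₂), ?_⟩
    rintro e ⟨w, h1, h2, rfl⟩
    rw [energy_eq]
    have e1 : coupling α β w ≤ σ⁻¹ * ((α + 1) / P * R₁ ^ P + (β + 1) / Q * R₂ ^ Q) :=
      (hcle w).trans (by gcongr)
    have e2 : f₁ w.1 ≤ ‖f₁‖ * R₁ := (le_abs_self _).trans ((f₁.le_opNorm _).trans (by gcongr))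
    have e3 : f₂ w.2 ≤ ‖f₂‖ * R₂ := (le_abs_self _).trans ((f₂.le_opNorm _).trans (by gcongr))
    have e4 : 0 ≤ (α + 1) / p₁ * ‖w.1‖ ^ p₁ := by positivity
    have e5 : 0 ≤ (β + 1) / p₂ * ‖w.2‖ ^ p₂ := by positivity
    have e6 := mul_le_mul_of_nonneg_left e2 hα.le
    have e7 := mul_le_mul_of_nonneg_left e3 hβ.le
    linarith
  obtain ⟨e, -, hlim, hmem⟩ := exists_seq_tendsto_sInf hTne hTbd
  choose u hu₁ hu₂ hue using hmem
  obtain ⟨k, hk, g₁, hg₁, hae₁⟩ := X0.exists_subseq_tendsto_ae hΩ hΩb hs₁ (by linarith) hS₁ hu₁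
  obtain ⟨l, hl, g₂, hg₂, hae₂⟩ := X0.exists_subseq_tendsto_ae hΩ hΩb hs₂ (by linarith) hS₂
    (u := fun n => (u (k n)).2) (fun n => hu₂ (k n))
  set v : ℕ → X0 Ω s₁ p₁ × X0 Ω s₂ p₂ := fun n => u (k (l n)) with hv
  have hv₁ : ∀ n, ‖(v n).1‖ ≤ R₁ := fun n => hu₁ _
  have hv₂ : ∀ n, ‖(v n).2‖ ≤ R₂ := fun n => hu₂ _
  have hva₁ : ∀ᵐ x, Tendsto (fun n => (v n).1 x) atTop (𝓝 (g₁ x)) := by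
    filter_upwards [hae₁] with x hx using hx.comp hl.tendsto_atTop
  obtain ⟨w₁, hw₁, hw₁R⟩ := X0.exists_of_tendsto_ae hv₁ hg₁.1 (hg₁.restrict Ω) hva₁
  obtain ⟨w₂, hw₂, hw₂R⟩ := X0.exists_of_tendsto_ae hv₂ hg₂.1 (hg₂.restrict Ω) hae₂
  refine ⟨(w₁, w₂), hw₁R, hw₂R, fun w' h1 h2 => ?_⟩
  refine le_trans ?_ (csInf_le hTbd ⟨w', h1, h2, rfl⟩)
  set w : X0 Ω s₁ p₁ × X0 Ω s₂ p₂ := (w₁, w₂) with hw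
  have ha₁ : ∀ᵐ x, Tendsto (fun n => (v n).1 x) atTop (𝓝 (w.1 x)) := by
    filter_upwards [hva₁, hw₁] with x hx hx2
    rwa [← hx2] at hx
  have ha₂ : ∀ᵐ x, Tendsto (fun n => (v n).2 x) atTop (𝓝 (w.2 x)) := by
    filter_upwards [hae₂, hw₂] with x hx hx2
    rwa [← hx2] at hx
  have hd₁ : ∀ n, ‖(v n).1 - w.1‖ ≤ R₁ + R₁ := fun n =>
    (norm_sub_le _ _).trans (add_le_add (hv₁ n) hw₁R)
  have hd₂ : ∀ n, ‖(v n).2 - w.2‖ ≤ R₂ + R₂ := fun n =>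
    (norm_sub_le _ _).trans (add_le_add (hv₂ n) hw₂R)
  have hN₁ := X0.tendsto_norm_rpow_sub hd₁ ha₁
  have hN₂ := X0.tendsto_norm_rpow_sub hd₂ ha₂
  have hC := tendsto_coupling_sub (α := α) (β := β) hΩb hα hβ hP0 hQ0 H1 hσ hσ₁ hσ₂
    hd₁ hd₂ ha₁ ha₂
  have hf : ∀ {s p : ℝ} [Fact (1 < p)] (f : StrongDual ℝ (X0 Ω s p)) (z : ℕ → X0 Ω s p)
      (y : X0 Ω s p) (M : ℝ), (∀ n, ‖z n - y‖ ≤ M) →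
      (∀ᵐ x, Tendsto (fun n => z n x) atTop (𝓝 (y x))) →
      Tendsto (fun n => f (z n)) atTop (𝓝 (f y)) := by
    intro s p _ f z y M hM hz
    have h := X0.tendsto_dual_of_ae hM (by
      filter_upwards [hz, ae_all_iff.2 fun n => X0.coe_sub (z n) y] with x hx hx2
      simp only [hx2]
      simpa using hx.sub_const (y x)) f
    simpa using h.add_const (f y)
  have hf₁ := hf f₁ _ _ _ hd₁ ha₁
  have hf₂ := hf f₂ _ _ _ hd₂ ha₂
  have hve : Tendsto (fun n => energy α β f₁ f₂ (v n)) atTop (𝓝 (sInf T)) := by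
    have := hlim.comp ((hk.comp hl).tendsto_atTop)
    refine this.congr fun n => hue _
  -- the remainder is eventually nonnegative
  have hrad : ∀ {R p P : ℝ} (x : ℕ → ℝ) (y : ℕ → ℝ) (L : ℝ), 0 < p → p < P → 0 ≤ R → 0 ≤ L →
      R ^ (P - p) < σ → (∀ n, 0 ≤ x n) → (∀ n, 0 ≤ y n) → (∀ n, x n ≤ R) →
      Tendsto (fun n => x n ^ p - y n ^ p) atTop (𝓝 L) →
      ∀ᶠ n in atTop, σ⁻¹ * (1 / P * y n ^ P) ≤ 1 / p * y n ^ p := by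
    intro R p P x y L hp hpP hR hL hRσ hx hy hxR hlim
    have hPp : 0 < P - p := by linarith
    set r := σ ^ (P - p)⁻¹ with hr
    have hr0 : 0 < r := by positivity
    have hrσ : r ^ (P - p) = σ := Real.rpow_inv_rpow hσ.le hPp.ne'
    have hRr : R < r := by
      rw [← hrσ] at hRσ
      exact (Real.rpow_lt_rpow_iff hR hr0.le hPp).1 hRσ
    have hRrp : R ^ p < r ^ p := Real.rpow_lt_rpow hR hRr hp
    have hev := hlim.eventually_const_lt (show R ^ p - r ^ p < L by linarith)
    filter_upwards [hev] with n hn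
    have h1 : x n ^ p ≤ R ^ p := Real.rpow_le_rpow (hx n) (hxR n) hp.le
    have h2 : y n ≤ r := (Real.rpow_le_rpow_iff (hy n) hr0.le hp).1 (by linarith)
    have h3 := rpow_le_rpow_mul_rpow_sub (hy n) h2 hp hpP
    rw [hrσ] at h3
    have h4 : 1 / P ≤ 1 / p := one_div_le_one_div_of_le hp hpP.le
    have h5 : 0 ≤ y n ^ p := Real.rpow_nonneg (hy n) p
    have h6 : 0 ≤ 1 / P := one_div_nonneg.2 (hp.trans hpP).le
    calc σ⁻¹ * (1 / P * y n ^ P) ≤ σ⁻¹ * (1 / P * (y n ^ p * σ)) := by gcongr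
      _ = 1 / P * y n ^ p := by field_simp
      _ ≤ _ := by gcongr
  have hr₁ := hrad (fun n => ‖(v n).1‖) (fun n => ‖(v n).1 - w.1‖) _ hp₁0 hP hR₁
    (Real.rpow_nonneg (norm_nonneg w.1) p₁) hRσ₁ (fun n => norm_nonneg _) (fun n => norm_nonneg _)
    hv₁ hN₁
  have hr₂ := hrad (fun n => ‖(v n).2‖) (fun n => ‖(v n).2 - w.2‖) _ hp₂0 hQ hR₂
    (Real.rpow_nonneg (norm_nonneg w.2) p₂) hRσ₂ (fun n => norm_nonneg _) (fun n => norm_nonneg _)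
    hv₂ hN₂
  have hlimit : Tendsto (fun n => (α + 1) / p₁ * (‖(v n).1‖ ^ p₁ - ‖(v n).1 - w.1‖ ^ p₁) +
      (β + 1) / p₂ * (‖(v n).2‖ ^ p₂ - ‖(v n).2 - w.2‖ ^ p₂) -
      (coupling α β (v n) - coupling α β (v n - w)) - (α + 1) * f₁ (v n).1 - (β + 1) * f₂ (v n).2)
      atTop (𝓝 (energy α β f₁ f₂ w)) :=
    ((((hN₁.const_mul _).add (hN₂.const_mul _)).sub hC).sub (hf₁.const_mul _)).sub
      (hf₂.const_mul _)
  refine le_of_tendsto_of_tendsto hlimit hve ?_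
  filter_upwards [hr₁, hr₂] with n h1 h2
  rw [energy_eq]
  have h3 := hcle (v n - w)
  have e1 := mul_le_mul_of_nonneg_left h1 hα.le
  have e2 := mul_le_mul_of_nonneg_left h2 hβ.le
  have e3 : σ⁻¹ * ((α + 1) / P * ‖(v n - w).1‖ ^ P + (β + 1) / Q * ‖(v n - w).2‖ ^ Q) =
      (α + 1) * (σ⁻¹ * (1 / P * ‖(v n).1 - w.1‖ ^ P)) +
      (β + 1) * (σ⁻¹ * (1 / Q * ‖(v n).2 - w.2‖ ^ Q)) := by
    rw [Prod.fst_sub, Prod.snd_sub]; ring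
  rw [e3] at h3
  have e4 : (α + 1) * (1 / p₁ * ‖(v n).1 - w.1‖ ^ p₁) = (α + 1) / p₁ * ‖(v n).1 - w.1‖ ^ p₁ := by
    ring
  have e5 : (β + 1) * (1 / p₂ * ‖(v n).2 - w.2‖ ^ p₂) = (β + 1) / p₂ * ‖(v n).2 - w.2‖ ^ p₂ := by
    ring
  linarith

/-- A minimizer of the energy over a product of balls that lies in the interior is a weak
solution. -/
theorem isWeakSolution_of_isMinOn (hα : 0 < α + 1) (hβ : 0 < β + 1)
    (hint : ∀ w : X0 Ω s₁ p₁ × X0 Ω s₂ p₂,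
      IntegrableOn (fun x => |w.1 x| ^ (α + 1) * |w.2 x| ^ (β + 1)) Ω)
    {R₁ R₂ : ℝ} {w : X0 Ω s₁ p₁ × X0 Ω s₂ p₂} (hw₁ : ‖w.1‖ < R₁) (hw₂ : ‖w.2‖ < R₂)
    (hmin : ∀ w' : X0 Ω s₁ p₁ × X0 Ω s₂ p₂, ‖w'.1‖ ≤ R₁ → ‖w'.2‖ ≤ R₂ →
        energy α β f₁ f₂ w ≤ energy α β f₁ f₂ w') : IsWeakSolution α β f₁ f₂ w := by
  have hc : ∀ w : X0 Ω s₁ p₁ × X0 Ω s₂ p₂, coupling α β w =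
      ∫ x in Ω, |w.2 x| ^ (β + 1) * |w.1 x| ^ (α + 1) := fun w => by
    simp only [coupling, mul_comm]
  refine ⟨fun φ => ?_, fun φ => ?_⟩
  · have h := X0.euler_lagrange w.1 f₁ (a := fun x => |w.2 x| ^ (β + 1))
      (w.2.measurable.abs.pow_const _) (fun x => by positivity) hα
      (fun ψ => by simpa only [mul_comm] using hint (ψ, w.2)) (sub_pos.2 hw₁)
      (fun ψ hψ => by
        have := hmin (w.1 + ψ, w.2) (by linarith [norm_add_le w.1 ψ]) hw₂.le
        rw [energy_eq, energy_eq, hc, hc] at this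
        linarith) φ
    have e : ∀ x, |w.2 x| ^ (β + 1) * (w.1 x * |w.1 x| ^ (α + 1 - 2) * φ x) =
        w.1 x * |w.1 x| ^ (α - 1) * |w.2 x| ^ (β + 1) * φ x := fun x => by
      rw [show α + 1 - 2 = α - 1 by ring]; ring
    simpa only [e] using h
  · have h := X0.euler_lagrange w.2 f₂ (a := fun x => |w.1 x| ^ (α + 1))
      (w.1.measurable.abs.pow_const _) (fun x => by positivity) hβ
      (fun ψ => hint (w.1, ψ)) (sub_pos.2 hw₂)
      (fun ψ hψ => by
        have := hmin (w.1, w.2 + ψ) hw₁.le (by linarith [norm_add_le w.2 ψ])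
        rw [energy_eq, energy_eq, coupling, coupling] at this
        linarith) φ
    have e : ∀ x, |w.1 x| ^ (α + 1) * (w.2 x * |w.2 x| ^ (β + 1 - 2) * φ x) =
        |w.1 x| ^ (α + 1) * (w.2 x * |w.2 x| ^ (β - 1)) * φ x := fun x => by
      rw [show β + 1 - 2 = β - 1 by ring]; ring
    simpa only [e] using h

end

end FracSystem

namespace FracSystem

open Filter Topology Set

/-- Young's inequality with a parameter; the linear dependence on `F` uses `F ≤ 1`. -/
theorem mul_le_rpow_div_add {p ν F x : ℝ} (hp : 1 < p) (hν : 0 < ν) (hF : 0 ≤ F) (hF1 : F ≤ 1)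
    (hx : 0 ≤ x) : F * x ≤ ν ^ p / p * x ^ p + F * (1 / (conjExp p * ν ^ conjExp p)) := by
  have hpq : p.HolderConjugate (conjExp p) := Real.HolderConjugate.conjExponent hp
  have hq : 0 < conjExp p := hpq.symm.pos
  calc F * x = ν * x * (F / ν) := by field_simp
    _ ≤ (ν * x) ^ p / p + (F / ν) ^ conjExp p / conjExp p :=
        Real.young_inequality_of_nonneg (by positivity) (by positivity) hpq
    _ = ν ^ p / p * x ^ p + F ^ conjExp p * (1 / (conjExp p * ν ^ conjExp p)) := by
        rw [Real.mul_rpow hν.le hx, Real.div_rpow hF hν.le]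
        field_simp
    _ ≤ _ := by
        have := Real.rpow_le_self_of_le_one hF hF1 hpq.symm.lt.le
        gcongr

section

variable {N : ℕ} {Ω : Set (Eu N)} {s₁ s₂ p₁ p₂ : ℝ} [hp₁ : Fact (1 < p₁)] [hp₂ : Fact (1 < p₂)]
  {α β : ℝ} {f₁ : StrongDual ℝ (X0 Ω s₁ p₁)} {f₂ : StrongDual ℝ (X0 Ω s₂ p₂)}

theorem le_radialDeriv (hΩb : Bornology.IsBounded Ω) (hα : 0 < α + 1) (hβ : 0 < β + 1)
    (hP : p₁ < critExp N s₁ p₁) (hQ : p₂ < critExp N s₂ p₂)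
    (H1 : (α + 1) / critExp N s₁ p₁ + (β + 1) / critExp N s₂ p₂ = 1)
    (h₁ : p₁ < α + β + 2) {σ : ℝ} (hσ : 0 < σ)
    (hσ₁ : σ ≤ sobolevConst N s₁ p₁ ^ (critExp N s₁ p₁ / p₁))
    (hσ₂ : σ ≤ sobolevConst N s₂ p₂ ^ (critExp N s₂ p₂ / p₂))
    {R₁ R₂ : ℝ} (hR₁ : R₁ ^ (critExp N s₁ p₁ - p₁) = bConst α β α p₁ * σ)
    (hR₂ : R₂ ^ (critExp N s₂ p₂ - p₂) = bConst α β β p₂ * σ)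
    {ν μ : ℝ} (hν : 0 < ν) (hμ : 0 < μ) (hf₁ : ‖f₁‖ ≤ 1) (hf₂ : ‖f₂‖ ≤ 1)
    (w : X0 Ω s₁ p₁ × X0 Ω s₂ p₂) (hw₁ : ‖w.1‖ ≤ R₁) (hw₂ : ‖w.2‖ ≤ R₂) :
    (α + 1) * (cConst α β p₁ - ν ^ p₁ / p₁) * ‖w.1‖ ^ p₁ +
      (β + 1) * (cConst α β p₂ - μ ^ p₂ / p₂) * ‖w.2‖ ^ p₂ -
      (‖f₁‖ + ‖f₂‖) * (1 / dConst p₁ p₂ α β ν μ) ≤ radialDeriv α β f₁ f₂ w := by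
  have hp₁1 := hp₁.out
  have hp₂1 := hp₂.out
  have hp₁0 : 0 < p₁ := by linarith
  have hp₂0 : 0 < p₂ := by linarith
  have hk : 0 < α + β + 1 := by linarith
  have hC := (coupling_le hΩb hα hβ (hp₁0.trans hP) (hp₂0.trans hQ) H1 hσ hσ₁ hσ₂ w).2
  have e₁ := rpow_le_rpow_mul_rpow_sub (norm_nonneg w.1) hw₁ hp₁0 hP
  have e₂ := rpow_le_rpow_mul_rpow_sub (norm_nonneg w.2) hw₂ hp₂0 hQ
  rw [hR₁] at e₁
  rw [hR₂] at e₂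
  have y₁ := mul_le_rpow_div_add hp₁1 hν (norm_nonneg f₁) hf₁ (norm_nonneg w.1)
  have y₂ := mul_le_rpow_div_add hp₂1 hμ (norm_nonneg f₂) hf₂ (norm_nonneg w.2)
  have d₁ : f₁ w.1 ≤ ‖f₁‖ * ‖w.1‖ := (le_abs_self _).trans (f₁.le_opNorm _)
  have d₂ : f₂ w.2 ≤ ‖f₂‖ * ‖w.2‖ := (le_abs_self _).trans (f₂.le_opNorm _)
  have q₁ : 0 < (α + 1) / critExp N s₁ p₁ := div_pos hα (hp₁0.trans hP)
  have q₂ : 0 < (β + 1) / critExp N s₂ p₂ := div_pos hβ (hp₂0.trans hQ)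
  have c₁ : 0 < conjExp p₁ := (Real.HolderConjugate.conjExponent hp₁1).symm.pos
  have c₂ : 0 < conjExp p₂ := (Real.HolderConjugate.conjExponent hp₂1).symm.pos
  have b₁ : 0 ≤ bConst α β α p₁ :=
    div_nonneg (mul_nonneg hα.le (by linarith)) (mul_nonneg (by linarith) hk.le)
  have b₂ : 0 ≤ bConst α β β p₂ :=
    div_nonneg (mul_nonneg hβ.le (by linarith)) (mul_nonneg (by linarith) hk.le)
  set U := ‖w.1‖ ^ p₁ with hU
  set V := ‖w.2‖ ^ p₂ with hV
  have hU0 : 0 ≤ U := by positivity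
  have hV0 : 0 ≤ V := by positivity
  have hC' : coupling α β w ≤ bConst α β α p₁ * U + bConst α β β p₂ * V := by
    calc coupling α β w ≤ σ⁻¹ * ((α + 1) / critExp N s₁ p₁ * (U * (bConst α β α p₁ * σ)) +
          (β + 1) / critExp N s₂ p₂ * (V * (bConst α β β p₂ * σ))) := hC.trans (by gcongr)
      _ = (α + 1) / critExp N s₁ p₁ * (bConst α β α p₁ * U) +
          (β + 1) / critExp N s₂ p₂ * (bConst α β β p₂ * V) := by field_simp
      _ ≤ 1 * (bConst α β α p₁ * U) + 1 * (bConst α β β p₂ * V) := by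
          gcongr <;> linarith
      _ = _ := by ring
  have hC2 := mul_le_mul_of_nonneg_left hC' (show 0 ≤ α + β + 2 by linarith)
  have hc : (α + 1) * U + (β + 1) * V - (α + β + 2) * (bConst α β α p₁ * U + bConst α β β p₂ * V) =
      (α + 1) * cConst α β p₁ * U + (β + 1) * cConst α β p₂ * V := by
    have : α + β + 2 ≠ 0 := by linarith
    rw [bConst, bConst, cConst, cConst]
    field_simp
    ring
  have hD : 1 / dConst p₁ p₂ α β ν μ = (α + 1) * (1 / (conjExp p₁ * ν ^ conjExp p₁)) +
      (β + 1) * (1 / (conjExp p₂ * μ ^ conjExp p₂)) := by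
    rw [dConst, one_div_one_div]; ring
  have m₁ := mul_le_mul_of_nonneg_left (d₁.trans y₁) hα.le
  have m₂ := mul_le_mul_of_nonneg_left (d₂.trans y₂) hβ.le
  set A := 1 / (conjExp p₁ * ν ^ conjExp p₁) with hA
  set B := 1 / (conjExp p₂ * μ ^ conjExp p₂) with hB
  have z₁ : 0 ≤ ‖f₁‖ * ((β + 1) * B) := by positivity
  have z₂ : 0 ≤ ‖f₂‖ * ((α + 1) * A) := by positivity
  rw [hD, radialDeriv]
  linarith

/-- A direction in which the linear part of the energy is positive gives negative energies. -/
theorem exists_energy_neg (hα : 0 < α + 1) (hβ : 0 < β + 1) (hr : 1 < α + β + 2)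
    (hf : 0 < ‖f₁‖ + ‖f₂‖) {R₁ R₂ : ℝ} (hR₁ : 0 < R₁) (hR₂ : 0 < R₂) :
    ∃ w : X0 Ω s₁ p₁ × X0 Ω s₂ p₂, ‖w.1‖ ≤ R₁ ∧ ‖w.2‖ ≤ R₂ ∧ energy α β f₁ f₂ w < 0 := by
  have hdir : ∃ w : X0 Ω s₁ p₁ × X0 Ω s₂ p₂, 0 < (α + 1) * f₁ w.1 + (β + 1) * f₂ w.2 := by
    by_contra! h
    have h1 : f₁ = 0 := by
      ext u
      have e1 := h (u, 0)
      have e2 := h (-u, 0)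
      simp only [map_zero, map_neg] at e1 e2
      simp only [zero_apply]
      nlinarith
    have h2 : f₂ = 0 := by
      ext u
      have e1 := h (0, u)
      have e2 := h (0, -u)
      simp only [map_zero, map_neg] at e1 e2
      simp only [zero_apply]
      nlinarith
    simp [h1, h2] at hf
  obtain ⟨w, hw⟩ := hdir
  have hT : ∀ {q : ℝ}, 1 < q → ∀ c : ℝ, Tendsto (fun t : ℝ => c * t ^ (q - 1)) (𝓝[>] 0) (𝓝 0) := by
    intro q hq c
    have h : ContinuousAt (fun t : ℝ => c * t ^ (q - 1)) 0 :=
      continuousAt_const.mul (Real.continuousAt_rpow_const _ _ (Or.inr (by linarith)))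
    have h' := h.tendsto
    rw [Real.zero_rpow (by linarith), mul_zero] at h'
    exact h'.mono_left nhdsWithin_le_nhds
  have hlim := (((hT hp₁.out ((α + 1) * ‖w.1‖ ^ p₁ / p₁)).add
    (hT hp₂.out ((β + 1) * ‖w.2‖ ^ p₂ / p₂))).sub (hT hr (coupling α β w)))
  simp only [add_zero, sub_zero] at hlim
  have hn : ∀ x R : ℝ, 0 ≤ x → 0 < R → ∀ᶠ t : ℝ in 𝓝[>] 0, t * x ≤ R := by
    intro x R _ hR
    have : Tendsto (fun t : ℝ => t * x) (𝓝[>] 0) (𝓝 0) := by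
      have h := (continuous_id.mul continuous_const).tendsto' (0 : ℝ) (0 * x) rfl
      rw [zero_mul] at h
      exact h.mono_left nhdsWithin_le_nhds
    exact this.eventually_le_const hR
  obtain ⟨t, ht, h1, h2, h3⟩ := (eventually_mem_nhdsWithin.and ((hlim.eventually_lt_const hw).and
    ((hn _ _ (norm_nonneg w.1) hR₁).and (hn _ _ (norm_nonneg w.2) hR₂)))).exists
  have ht0 : (0 : ℝ) < t := ht
  refine ⟨t • w, ?_, ?_, ?_⟩
  · rwa [Prod.smul_fst, norm_smul, Real.norm_of_nonneg ht0.le]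
  · rwa [Prod.smul_snd, norm_smul, Real.norm_of_nonneg ht0.le]
  · rw [energy_smul hα hβ ht0.le]
    have e : ∀ q : ℝ, t ^ q = t * t ^ (q - 1) := fun q => by
      rw [Real.rpow_sub_one ht0.ne']; field_simp
    rw [e p₁, e p₂, e (α + β + 2)]
    have := mul_pos ht0 (sub_pos.2 h1)
    linarith

end

end FracSystem

namespace FracSystem

open Filter Topology Set

theorem lt_critExp {N : ℕ} {s p : ℝ} (hp : 0 < p) (hs : 0 < s) (hN : p * s < N) :
    p < critExp N s p := by
  have : 0 < N - s * p := by linarith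
  rw [critExp, lt_div_iff₀ this]
  nlinarith [mul_pos hs hp]

theorem bConst_pos {α β r t : ℝ} (hr : 0 < r + 1) (ht : 1 < t) (h : 0 < α + β + 1) :
    0 < bConst α β r t :=
  div_pos (mul_pos hr (by linarith)) (mul_pos (by linarith) h)

theorem bConst_lt_one {α β r t : ℝ} (hr : 0 < r + 1) (ht : 1 < t) (hr' : r + 1 < α + β + 2)
    (ht' : t < α + β + 2) : bConst α β r t < 1 := by
  rw [bConst, div_lt_one (mul_pos (by linarith) (by linarith))]
  exact mul_lt_mul'' hr' (by linarith) hr.le (by linarith)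

theorem cConst_sub_pos {α β p ν : ℝ} (hp : 1 < p) (h : p < α + β + 2) (hν : 0 < ν)
    (hν' : ν < (p * cConst α β p) ^ (1 / p)) : 0 < cConst α β p - ν ^ p / p := by
  have hp0 : 0 < p := by linarith
  have hc : 0 < cConst α β p := div_pos (by linarith) (by linarith)
  have h1 := Real.rpow_lt_rpow hν.le hν' hp0
  rw [← Real.rpow_mul (by positivity), one_div_mul_cancel hp0.ne', Real.rpow_one] at h1
  rw [sub_pos, div_lt_iff₀ hp0]
  linarith

theorem dConst_pos {p₁ p₂ α β ν μ : ℝ} (hp₁ : 1 < p₁) (hp₂ : 1 < p₂) (hα : 0 < α + 1)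
    (hβ : 0 < β + 1) (hν : 0 < ν) (hμ : 0 < μ) : 0 < dConst p₁ p₂ α β ν μ := by
  have h₁ : 0 < conjExp p₁ := (Real.HolderConjugate.conjExponent hp₁).symm.pos
  have h₂ : 0 < conjExp p₂ := (Real.HolderConjugate.conjExponent hp₂).symm.pos
  unfold dConst
  positivity

theorem exists_rpow_eq {x p P : ℝ} (hx : 0 < x) (hpP : p < P) :
    ∃ R : ℝ, 0 < R ∧ R ^ (P - p) = x ∧ x ^ (p / (P - p)) = R ^ p := by
  have h : P - p ≠ 0 := by linarith
  refine ⟨x ^ (P - p)⁻¹, by positivity, Real.rpow_inv_rpow hx.le h, ?_⟩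
  rw [← Real.rpow_mul hx.le, div_eq_inv_mul]

section

variable {N : ℕ} {Ω : Set (Eu N)} {s₁ s₂ p₁ p₂ : ℝ} [hp₁ : Fact (1 < p₁)] [hp₂ : Fact (1 < p₂)]
  {α β : ℝ} {f₁ : StrongDual ℝ (X0 Ω s₁ p₁)} {f₂ : StrongDual ℝ (X0 Ω s₂ p₂)}

/-- A minimizer of the energy over a product of balls on whose boundary the energy is radially
increasing lies in the interior and on the Nehari set. -/
theorem interior_of_isMinOn (hα : 0 < α + 1) (hβ : 0 < β + 1) {R₁ R₂ : ℝ}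
    (hbd : ∀ w : X0 Ω s₁ p₁ × X0 Ω s₂ p₂, ‖w.1‖ ≤ R₁ → ‖w.2‖ ≤ R₂ → (‖w.1‖ = R₁ ∨ ‖w.2‖ = R₂) →
      0 < radialDeriv α β f₁ f₂ w)
    {w : X0 Ω s₁ p₁ × X0 Ω s₂ p₂} (hw₁ : ‖w.1‖ ≤ R₁) (hw₂ : ‖w.2‖ ≤ R₂)
    (hmin : ∀ w' : X0 Ω s₁ p₁ × X0 Ω s₂ p₂, ‖w'.1‖ ≤ R₁ → ‖w'.2‖ ≤ R₂ →
        energy α β f₁ f₂ w ≤ energy α β f₁ f₂ w') :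
    ‖w.1‖ < R₁ ∧ ‖w.2‖ < R₂ ∧ radialDeriv α β f₁ f₂ w = 0 := by
  have hd := hasDerivAt_energy_smul (f₁ := f₁) (f₂ := f₂) hα hβ w
  have hnpos : radialDeriv α β f₁ f₂ w ≤ 0 := by
    have hs : Tendsto (slope (fun t : ℝ => energy α β f₁ f₂ (t • w)) 1) (𝓝[<] 1)
        (𝓝 (radialDeriv α β f₁ f₂ w)) :=
      (hasDerivAt_iff_tendsto_slope.1 hd).mono_left
        (nhdsWithin_mono _ fun t (ht : t < 1) => ht.ne)
    refine le_of_tendsto hs ?_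
    filter_upwards [Ioo_mem_nhdsLT (zero_lt_one' ℝ)] with t ht
    rw [slope_def_field, one_smul]
    have hsm : ∀ x : ℝ, 0 ≤ x → |t| * x ≤ x := fun x hx => by
      rw [abs_of_pos ht.1]; exact mul_le_of_le_one_left hx ht.2.le
    have := hmin (t • w)
      (by rw [Prod.smul_fst, norm_smul]; exact (hsm _ (norm_nonneg _)).trans hw₁)
      (by rw [Prod.smul_snd, norm_smul]; exact (hsm _ (norm_nonneg _)).trans hw₂)
    exact div_nonpos_of_nonneg_of_nonpos (by linarith) (by linarith [ht.2])
  have h₁ : ‖w.1‖ < R₁ := hw₁.lt_of_ne fun h => (hbd w hw₁ hw₂ (Or.inl h)).not_ge hnpos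
  have h₂ : ‖w.2‖ < R₂ := hw₂.lt_of_ne fun h => (hbd w hw₁ hw₂ (Or.inr h)).not_ge hnpos
  refine ⟨h₁, h₂, IsLocalMin.hasDerivAt_eq_zero ?_ hd⟩
  have hn : ∀ x R : ℝ, x < R → ∀ᶠ t : ℝ in 𝓝 1, |t| * x ≤ R := fun x R hxR => by
    have h : Tendsto (fun t : ℝ => |t| * x) (𝓝 1) (𝓝 (|1| * x)) :=
      (continuous_abs.mul continuous_const).tendsto 1
    rw [abs_one, one_mul] at h
    exact h.eventually_le_const hxR
  filter_upwards [hn _ _ h₁, hn _ _ h₂] with t ht₁ ht₂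
  rw [one_smul]
  refine hmin _ ?_ ?_
  · rwa [Prod.smul_fst, norm_smul]
  · rwa [Prod.smul_snd, norm_smul]

/-- The part of the Nehari set outside a product of balls on whose boundary the energy is radially
increasing has no smaller energies. -/
theorem le_energy_of_mem_nehari (hα : 0 < α + 1) (hβ : 0 < β + 1) (hr₁ : p₁ < α + β + 2)
    (hr₂ : p₂ < α + β + 2) {R₁ R₂ : ℝ} (hR₁ : 0 < R₁) (hR₂ : 0 < R₂)
    (hbd : ∀ w : X0 Ω s₁ p₁ × X0 Ω s₂ p₂, ‖w.1‖ ≤ R₁ → ‖w.2‖ ≤ R₂ → (‖w.1‖ = R₁ ∨ ‖w.2‖ = R₂) →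
      0 < radialDeriv α β f₁ f₂ w) {m : ℝ}
    (hmin : ∀ w' : X0 Ω s₁ p₁ × X0 Ω s₂ p₂, ‖w'.1‖ ≤ R₁ → ‖w'.2‖ ≤ R₂ → m ≤ energy α β f₁ f₂ w')
    {w : X0 Ω s₁ p₁ × X0 Ω s₂ p₂} (hw : w ∈ nehari α β f₁ f₂) : m ≤ energy α β f₁ f₂ w := by
  obtain ⟨-, hw0⟩ := (mem_nehari_iff hα hβ w).1 hw
  set M := max (‖w.1‖ / R₁) (‖w.2‖ / R₂) with hM
  rcases le_or_gt M 1 with hM1 | hM1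
  · have h := max_le_iff.1 hM1
    exact hmin w ((div_le_one hR₁).1 h.1) ((div_le_one hR₂).1 h.2)
  have hM0 : 0 < M := by linarith
  have ht : 0 < M⁻¹ := by positivity
  have h₁ : ‖(M⁻¹ • w).1‖ = M⁻¹ * ‖w.1‖ := by
    rw [Prod.smul_fst, norm_smul, Real.norm_of_nonneg ht.le]
  have h₂ : ‖(M⁻¹ • w).2‖ = M⁻¹ * ‖w.2‖ := by
    rw [Prod.smul_snd, norm_smul, Real.norm_of_nonneg ht.le]
  have l₁ : ‖(M⁻¹ • w).1‖ ≤ R₁ := by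
    rw [h₁, inv_mul_le_iff₀ hM0, ← div_le_iff₀ hR₁]; exact le_max_left _ _
  have l₂ : ‖(M⁻¹ • w).2‖ ≤ R₂ := by
    rw [h₂, inv_mul_le_iff₀ hM0, ← div_le_iff₀ hR₂]; exact le_max_right _ _
  have hb := hbd _ l₁ l₂ (by
    rw [h₁, h₂, inv_mul_eq_iff_eq_mul₀ hM0.ne', inv_mul_eq_iff_eq_mul₀ hM0.ne',
      ← div_eq_iff hR₁.ne', ← div_eq_iff hR₂.ne']
    exact (max_choice _ _).imp Eq.symm Eq.symm)
  rw [radialDeriv_smul hα hβ ht] at hb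
  have hray := ray_le hp₁.out hp₂.out hr₁ hr₂
    (mul_nonneg hα.le (Real.rpow_nonneg (norm_nonneg w.1) p₁))
    (mul_nonneg hβ.le (Real.rpow_nonneg (norm_nonneg w.2) p₂)) ht (inv_le_one_of_one_le₀ hM1.le)
    (pos_of_mul_pos_right hb ht.le).le hw0
  refine (hmin _ l₁ l₂).trans ?_
  rw [energy_smul hα hβ ht.le]
  refine hray.trans (le_of_eq ?_)
  rw [energy_eq]
  ring

end

end FracSystem

theorem theorem2p1 (N : ℕ) (Ω : Set (FracSystem.Eu N)) (hΩ : FracSystem.IsC1BoundedDomain Ω)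
    (s₁ s₂ p₁ p₂ α β : ℝ) [Fact (1 < p₁)] [Fact (1 < p₂)]
    (hs₁ : 0 < s₁ ∧ s₁ < 1) (hs₂ : 0 < s₂ ∧ s₂ < 1)
    (hN : max (p₁ * s₁) (p₂ * s₂) < (N : ℝ)) (hα : -1 < α) (hβ : -1 < β)
    (f₁ : StrongDual ℝ (FracSystem.X0 Ω s₁ p₁)) (f₂ : StrongDual ℝ (FracSystem.X0 Ω s₂ p₂))
    (ν μ : ℝ)
    (hν : 0 < ν ∧ ν < (p₁ * FracSystem.cConst α β p₁) ^ (1 / p₁))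
    (hμ : 0 < μ ∧ μ < (p₂ * FracSystem.cConst α β p₂) ^ (1 / p₂))
    (H1 : (α + 1) / FracSystem.critExp N s₁ p₁ + (β + 1) / FracSystem.critExp N s₂ p₂ = 1)
    (H2 : max p₁ p₂ < α + β + 2)
    (H3 : 0 < ‖f₁‖ + ‖f₂‖ ∧
      ‖f₁‖ + ‖f₂‖ < min (min (FracSystem.eps₁ N s₁ s₂ p₁ p₂ α β ν μ)
        (FracSystem.eps₂ N s₁ s₂ p₁ p₂ α β ν μ)) 1) :
    ∃ w : FracSystem.X0 Ω s₁ p₁ × FracSystem.X0 Ω s₂ p₂,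
      FracSystem.IsWeakSolution α β f₁ f₂ w ∧
      w ∈ FracSystem.nehari α β f₁ f₂ ∧
      IsLeast (FracSystem.energy α β f₁ f₂ '' FracSystem.nehari α β f₁ f₂)
        (FracSystem.energy α β f₁ f₂ w) ∧
      FracSystem.energy α β f₁ f₂ w < 0 := by
  have hp₁ : 1 < p₁ := Fact.out
  have hp₂ : 1 < p₂ := Fact.out
  obtain ⟨hN₁, hN₂⟩ := max_lt_iff.1 hN
  obtain ⟨hr₁, hr₂⟩ := max_lt_iff.1 H2
  obtain ⟨hf, hF⟩ := H3
  obtain ⟨hF', hF₃⟩ := lt_min_iff.1 hF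
  obtain ⟨hF₁, hF₂⟩ := lt_min_iff.1 hF'
  have hα' : 0 < α + 1 := by linarith
  have hβ' : 0 < β + 1 := by linarith
  have hP := FracSystem.lt_critExp (by linarith) hs₁.1 hN₁
  have hQ := FracSystem.lt_critExp (by linarith) hs₂.1 hN₂
  have hP0 : 0 < FracSystem.critExp N s₁ p₁ := by linarith
  have hQ0 : 0 < FracSystem.critExp N s₂ p₂ := by linarith
  set σ := FracSystem.minSob N s₁ s₂ p₁ p₂ with hσd
  have hσ : 0 < σ := by
    have h0 : 0 ≤ σ := le_min (Real.rpow_nonneg (FracSystem.sobolevConst_nonneg _ _ _) _)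
      (Real.rpow_nonneg (FracSystem.sobolevConst_nonneg _ _ _) _)
    refine h0.lt_of_ne fun h => ?_
    rw [FracSystem.eps₁, ← hσd, ← h, mul_zero, Real.zero_rpow
      (div_pos (by linarith) (by linarith)).ne', mul_zero] at hF₁
    linarith
  have hb₁ : 0 < FracSystem.bConst α β α p₁ := FracSystem.bConst_pos hα' hp₁ (by linarith)
  have hb₂ : 0 < FracSystem.bConst α β β p₂ := FracSystem.bConst_pos hβ' hp₂ (by linarith)
  have hb₁' : FracSystem.bConst α β α p₁ < 1 := FracSystem.bConst_lt_one hα' hp₁ (by linarith) hr₁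
  have hb₂' : FracSystem.bConst α β β p₂ < 1 := FracSystem.bConst_lt_one hβ' hp₂ (by linarith) hr₂
  obtain ⟨R₁, hR₁, hRP, hRp⟩ := FracSystem.exists_rpow_eq (mul_pos hb₁ hσ) hP
  obtain ⟨R₂, hR₂, hRQ, hRq⟩ := FracSystem.exists_rpow_eq (mul_pos hb₂ hσ) hQ
  have hκ₁ := FracSystem.cConst_sub_pos hp₁ hr₁ hν.1 hν.2
  have hκ₂ := FracSystem.cConst_sub_pos hp₂ hr₂ hμ.1 hμ.2
  have hd := FracSystem.dConst_pos hp₁ hp₂ hα' hβ' hν.1 hμ.1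
  rw [FracSystem.eps₁, ← hσd, hRp] at hF₁
  rw [FracSystem.eps₂, ← hσd, hRq] at hF₂
  have hF₁' : (‖f₁‖ + ‖f₂‖) * (1 / FracSystem.dConst p₁ p₂ α β ν μ) <
      (α + 1) * (FracSystem.cConst α β p₁ - ν ^ p₁ / p₁) * R₁ ^ p₁ := by
    rw [mul_one_div, div_lt_iff₀ hd]; linarith
  have hF₂' : (‖f₁‖ + ‖f₂‖) * (1 / FracSystem.dConst p₁ p₂ α β ν μ) <
      (β + 1) * (FracSystem.cConst α β p₂ - μ ^ p₂ / p₂) * R₂ ^ p₂ := by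
    rw [mul_one_div, div_lt_iff₀ hd]; linarith
  have hσ₁ : σ ≤ FracSystem.sobolevConst N s₁ p₁ ^ (FracSystem.critExp N s₁ p₁ / p₁) :=
    min_le_left _ _
  have hσ₂ : σ ≤ FracSystem.sobolevConst N s₂ p₂ ^ (FracSystem.critExp N s₂ p₂ / p₂) :=
    min_le_right _ _
  have hbd : ∀ w : FracSystem.X0 Ω s₁ p₁ × FracSystem.X0 Ω s₂ p₂, ‖w.1‖ ≤ R₁ → ‖w.2‖ ≤ R₂ →
      (‖w.1‖ = R₁ ∨ ‖w.2‖ = R₂) → 0 < FracSystem.radialDeriv α β f₁ f₂ w := by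
    intro w h1 h2 h
    refine lt_of_lt_of_le ?_ (FracSystem.le_radialDeriv hΩ.isBounded hα' hβ' hP hQ H1 hr₁ hσ
      hσ₁ hσ₂ hRP hRQ hν.1 hμ.1 (by linarith [norm_nonneg f₂])
      (by linarith [norm_nonneg f₁]) w h1 h2)
    have n₁ : 0 ≤ (α + 1) * (FracSystem.cConst α β p₁ - ν ^ p₁ / p₁) * ‖w.1‖ ^ p₁ := by positivity
    have n₂ : 0 ≤ (β + 1) * (FracSystem.cConst α β p₂ - μ ^ p₂ / p₂) * ‖w.2‖ ^ p₂ := by positivity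
    rcases h with h | h
    · rw [h] at n₁ ⊢; linarith
    · rw [h] at n₂ ⊢; linarith
  obtain ⟨w, hw₁, hw₂, hmin⟩ := FracSystem.exists_isMinOn_energy (f₁ := f₁) (f₂ := f₂)
    hΩ.isOpen.measurableSet hΩ.isBounded hs₁.1 hs₂.1 hα' hβ' hP hQ H1 hσ hσ₁ hσ₂ hR₁.le hR₂.le
    (hRP.trans_lt (mul_lt_of_lt_one_left hσ hb₁')) (hRQ.trans_lt (mul_lt_of_lt_one_left hσ hb₂'))
  obtain ⟨w₀, hw₀₁, hw₀₂, hw₀⟩ := FracSystem.exists_energy_neg (f₁ := f₁) (f₂ := f₂) hα' hβ'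
    (by linarith) hf hR₁ hR₂
  have hneg : FracSystem.energy α β f₁ f₂ w < 0 := (hmin w₀ hw₀₁ hw₀₂).trans_lt hw₀
  obtain ⟨hi₁, hi₂, hrad⟩ := FracSystem.interior_of_isMinOn hα' hβ' hbd hw₁ hw₂ hmin
  have hw : w ∈ FracSystem.nehari α β f₁ f₂ := by
    refine (FracSystem.mem_nehari_iff hα' hβ' w).2 ⟨?_, hrad⟩
    rintro rfl
    have h := FracSystem.energy_smul (f₁ := f₁) (f₂ := f₂) hα' hβ' le_rfl
      (0 : FracSystem.X0 Ω s₁ p₁ × FracSystem.X0 Ω s₂ p₂)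
    rw [smul_zero, Real.zero_rpow (by linarith), Real.zero_rpow (by linarith),
      Real.zero_rpow (by linarith)] at h
    linarith
  refine ⟨w, FracSystem.isWeakSolution_of_isMinOn hα' hβ'
    (fun w => (FracSystem.coupling_le hΩ.isBounded hα' hβ' hP0 hQ0 H1 hσ hσ₁ hσ₂ w).1) hi₁ hi₂ hmin,
    hw, ⟨Set.mem_image_of_mem _ hw, ?_⟩, hneg⟩
  rintro _ ⟨w', hw', rfl⟩
  exact FracSystem.le_energy_of_mem_nehari hα' hβ' hr₁ hr₂ hR₁ hR₂ hbd hmin hw'
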